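/- **Strings.** Let $T=T[0..n)$ be a string of length $n$ over a linearly ordered alphabet, and let $\sigma$ be the number of distinct symbols occurring in $T$. For a string $w$, an integer $p\in[1,|w|]$ is a *period* of $w$ if $w[i]=w[i+p]$ whenever $0\le i<|w|-p$. **Modified LZ-like encodings.** A *modified LZ-like encoding* of $T$ is a factorization of $T$ into nonempty phrases. A phrase of minimum period $1$ is encoded as a triple $(\ell,c,1)$, where $\ell$ is its length and $c$ is its only symbol. A phrase of minimum period $p\ge 2$ is encoded as a triple $(\ell,s,p)$, where $\ell\ge p$ is its length and $s$ is a previous occurrence of its length-$p$ prefix. In a phrase $(\ell,s,p)$ that starts at position $b$, position $i$ refers to position $s+((i-b)\bmod p)$, and its height is one more than the height of that position. Positions in phrases $(\ell,c,1)$ have height $0$. The encoding is *$h$-bounded* if all heights are at most $h$. **LZHB4.** The encoding LZHB4 with height bound $h$ is built greedily from left to right. Suppose $T[0..b)$ has been encoded. Say that an occurrence $s$ of a string $x$ is *admissible* if it lies inside the encoded part, i.e. $s+|x|\le b$, and all positions of $T[s..s+|x|)$ have height less than $h$. The next phrase has the largest length $\ell\geq 1$ with $b+\ell\le n$ such that one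 of the following holds: * $T[b..b+\ell)$ has period $1$; or * for every $1\le\ell'\le\ell$, the string $T[b..b+p')$ has an admissible occurrence, where $p'$ is the minimum period of $T[b..b+\ell')$. Let $p$ be the minimum period of $T[b..b+\ell)$. If $p=1$ the phrase is $(\ell,T[b],1)$. Otherwise it is $(\ell,s,p)$, where $s$ is the leftmost admissible occurrence of $T[b..b+p)$. **Machine model.** We use a unit-cost random access machine. It performs arithmetic and comparisons on words of $O(\log n)$ bits. The symbols of the input are on a read-only random access tape and can only be compared with each other and copied to a write-only output tape. Space is the number of memory words. **Theorem.** There is an algorithm that, given $h\in\mathbb{N}$ and a string $T$ of length $n$ over any linearly ordered alphabet, computes the LZHB4 encoding of $T$ with height bound $h$, which is an $h$-bounded modified LZ-like encoding of $T$. For every constant $h$ it takes $O(n\log\sigma)$ time and $O(n)$ space, with constants that may depend on $h$ only. (Precisely: for every $h$ there are $C,k\in\mathbb{N}$ such that, for every such $T$, the algorithm halts within $C\,(n(\lfloor\log_2\sigma\rfloor+1)+1)$ steps and uses at most $C(n+1)$ memory words, all words being less than $(n+2)^k$. For $n=0$ read $\lfloor\log_2\sigma\rfloor$ as $0$.) 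-/

import Mathlib

/-! Positions are numbered from `0`: a text `T` of length `n` is `T[0..n)`. -/

namespace LZHB

section Strings

variable {α : Type*}

/-- The factor `T[b..b+l)` (of length `l` whenever `b + l ≤ |T|`). -/
def factor (T : List α) (b l : ℕ) : List α := (T.drop b).take l

/-- `p ∈ [1, |w|]` is a period of `w`: `w[i] = w[i+p]` whenever both sides are defined. -/
def IsPeriod (w : List α) (p : ℕ) : Prop := 1 ≤ p ∧ p ≤ w.length ∧ w.HasPeriod p

/-- The minimum period of a nonempty string. -/
noncomputable def minPeriod (w : List α) : ℕ := sInf {p | IsPeriod w p}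

end Strings

section Encodings

variable {α : Type*}

/-- The triples of a modified LZ-like encoding: `run l c` is `(l, c, 1)` with `c` a symbol, and
`copy l s p` is `(l, s, p)` with `s` a position. -/
inductive Phrase (α : Type*) where
  | run (len : ℕ) (c : α)
  | copy (len src per : ℕ)

/-- The length of a phrase. -/
def Phrase.len : Phrase α → ℕ
  | .run l _ => l
  | .copy l _ _ => l

/-- The total length of the phrases; this is also the starting position of the next phrase. -/
def totalLength (E : List (Phrase α)) : ℕ := (E.map Phrase.len).sum

/-- Appends to the list `H` of the heights of all positions before a phrase the heights of the
positions of that phrase, from left to right. The positions of a phrase `(l, c, 1)` are roots;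
the `k`-th position of a phrase `(l, s, p)` refers to position `s + (k mod p)`. -/
def appendHeights (H : List ℕ) : Phrase α → List ℕ
  | .run l _ => H ++ List.replicate l 0
  | .copy l s p => (List.range l).foldl (fun H' k => H' ++ [H'.getD (s + k % p) 0 + 1]) H

/-- The heights of all positions in the referencing forest of an encoding. -/
def heights (E : List (Phrase α)) : List ℕ := E.foldl appendHeights []

/-- `ph` is a possible phrase of a modified LZ-like encoding of `T`, starting at position `b`. A
phrase of period `1` is a power of a symbol; any other phrase has minimum period `p ≥ 2` and
carries the position of a previous occurrence of its prefix of length `p`. -/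
def IsModifiedPhrase (T : List α) (b : ℕ) : Phrase α → Prop
  | .run l c => 1 ≤ l ∧ factor T b l = List.replicate l c
  | .copy l s p => b + l ≤ T.length ∧ 2 ≤ p ∧ p ≤ l ∧ minPeriod (factor T b l) = p ∧
      s < b ∧ factor T s p = factor T b p

/-- `E` is a modified LZ-like encoding of `T`. -/
def IsModifiedEncoding (T : List α) (E : List (Phrase α)) : Prop :=
  totalLength E = T.length ∧
    ∀ E₁ ph E₂, E = E₁ ++ ph :: E₂ → IsModifiedPhrase T (totalLength E₁) ph

/-- All heights are at most `h`. -/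
def IsBounded (h : ℕ) (E : List (Phrase α)) : Prop := ∀ x ∈ heights E, x ≤ h

/-- `T[s..s+p)` is a previous occurrence of `T[b..b+p)` that satisfies the height constraint: it
lies in the part `T[0..b)` that has been encoded already, with heights `H`, and all its positions
have height less than `h`, so that the positions referring to it get height at most `h`. -/
def IsSource (h : ℕ) (T : List α) (H : List ℕ) (b p s : ℕ) : Prop :=
  s + p ≤ b ∧ factor T s p = factor T b p ∧ ∀ i, s ≤ i → i < s + p → H.getD i 0 < h

/-- The lengths `l` among which the greedy phrase starting at `b` takes the largest. -/
def IsCandidate (h : ℕ) (T : List α) (H : List ℕ) (b l : ℕ) : Prop :=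
  1 ≤ l ∧ b + l ≤ T.length ∧
    (IsPeriod (factor T b l) 1 ∨
      ∀ l', 1 ≤ l' → l' ≤ l → ∃ s, IsSource h T H b (minPeriod (factor T b l')) s)

/-- `ph` is the greedy phrase starting at position `b`, where `H` lists the heights of the
positions before `b`: its length is the largest candidate, its period is the minimum period of
the phrase, and, if this is not `1`, its source is the leftmost previous occurrence of its prefix
of that length that satisfies the height constraint. -/
def IsGreedyPhrase (h : ℕ) (T : List α) (H : List ℕ) (b : ℕ) : Phrase α → Prop
  | .run l c => IsGreatest {l | IsCandidate h T H b l} l ∧ minPeriod (factor T b l) = 1 ∧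
      T[b]? = some c
  | .copy l s p => IsGreatest {l | IsCandidate h T H b l} l ∧ minPeriod (factor T b l) = p ∧
      2 ≤ p ∧ IsLeast {s | IsSource h T H b p s} s

/-- `E` is the encoding LZHB4 of `T` with height bound `h`. -/
def IsLZHB4 (h : ℕ) (T : List α) (E : List (Phrase α)) : Prop :=
  totalLength E = T.length ∧
    ∀ E₁ ph E₂, E = E₁ ++ ph :: E₂ → IsGreedyPhrase h T (heights E₁) (totalLength E₁) ph

end Encodings

section Machine

/-! A random access machine with structured control flow. Registers and memory cells hold machine
words (natural numbers below a bound `W`), and the memory has `S` cells. The input is a string of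
`n` symbols of a linearly ordered alphabet, kept on a read-only random access input tape; symbols
can only be compared with each other and copied to the write-only output tape. Every instruction
and every evaluation of a test takes one step. A step that would produce a word that is not below
`W`, or would access a memory cell or an input position out of range, makes the execution fail. -/

/-- Arithmetic on words: `sub` is truncated, and `div` and `mod` round down. -/
inductive ArithOp where
  | add | sub | mul | div | mod

def ArithOp.eval : ArithOp → ℕ → ℕ → ℕ
  | .add, x, y => x + y
  | .sub, x, y => x - y
  | .mul, x, y => x * y
  | .div, x, y => x / y
  | .mod, x, y => x % y

/-- Instructions; all arguments but the constant `val` are names of registers. -/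
inductive Instr where
  | const (dst val : ℕ)
  | arith (op : ArithOp) (dst x y : ℕ)
  | load (dst addr : ℕ)
  | store (addr src : ℕ)
  | emitWord (src : ℕ)
  | emitSymbol (pos : ℕ)

/-- Tests; the arguments are names of registers. `symEq` and `symLt` compare the two input symbols
whose positions are in the registers. -/
inductive Test where
  | wordEq (x y : ℕ)
  | wordLt (x y : ℕ)
  | symEq (x y : ℕ)
  | symLt (x y : ℕ)

inductive Program where
  | skip
  | instr (i : Instr)
  | seq (p q : Program)
  | ite (c : Test) (p q : Program)
  | loop (c : Test) (p : Program)

/-- A configuration: registers, memory, and the output written so far, a string of words and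
symbols. -/
structure Config (α : Type*) where
  reg : ℕ → ℕ
  mem : ℕ → ℕ
  out : List (ℕ ⊕ α)

variable {α : Type*}

/-- Writes the word `v` to register `r`, provided that it is below `W`. -/
def Config.setReg (W : ℕ) (c : Config α) (r v : ℕ) : Option (Config α) :=
  if v < W then some { c with reg := Function.update c.reg r v } else none

/-- The effect of an instruction on input `T` with words below `W` and `S` memory cells. -/
def Instr.exec (T : List α) (W S : ℕ) (c : Config α) : Instr → Option (Config α)
  | .const dst val => c.setReg W dst val
  | .arith op dst x y => c.setReg W dst (op.eval (c.reg x) (c.reg y))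
  | .load dst addr => if c.reg addr < S then c.setReg W dst (c.mem (c.reg addr)) else none
  | .store addr src =>
      if c.reg addr < S ∧ c.reg src < W then
        some { c with mem := Function.update c.mem (c.reg addr) (c.reg src) }
      else none
  | .emitWord src => some { c with out := c.out ++ [Sum.inl (c.reg src)] }
  | .emitSymbol pos => T[c.reg pos]?.map fun a => { c with out := c.out ++ [Sum.inr a] }

/-- The value of a test, if defined. -/
def Test.eval [LinearOrder α] (T : List α) (c : Config α) : Test → Option Bool
  | .wordEq x y => some (decide (c.reg x = c.reg y))
  | .wordLt x y => some (decide (c.reg x < c.reg y))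
  | .symEq x y => T[c.reg x]?.bind fun a => T[c.reg y]?.map fun b => decide (a = b)
  | .symLt x y => T[c.reg x]?.bind fun a => T[c.reg y]?.map fun b => decide (a < b)

/-- `Runs T W S P c t c'`: started in configuration `c` on input `T`, with words below `W` and `S`
memory cells, program `P` halts after exactly `t` steps in configuration `c'`. -/
inductive Runs [LinearOrder α] (T : List α) (W S : ℕ) :
    Program → Config α → ℕ → Config α → Prop where
  | skip (c : Config α) : Runs T W S .skip c 1 c
  | instr {i : Instr} {c c' : Config α} : i.exec T W S c = some c' →
      Runs T W S (.instr i) c 1 c'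
  | seq {p q : Program} {c c₁ c₂ : Config α} {t₁ t₂ : ℕ} :
      Runs T W S p c t₁ c₁ → Runs T W S q c₁ t₂ c₂ → Runs T W S (.seq p q) c (t₁ + t₂) c₂
  | iteTrue {b : Test} {p q : Program} {c c' : Config α} {t : ℕ} :
      b.eval T c = some true → Runs T W S p c t c' → Runs T W S (.ite b p q) c (1 + t) c'
  | iteFalse {b : Test} {p q : Program} {c c' : Config α} {t : ℕ} :
      b.eval T c = some false → Runs T W S q c t c' → Runs T W S (.ite b p q) c (1 + t) c'
  | loopDone {b : Test} {p : Program} {c : Config α} :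
      b.eval T c = some false → Runs T W S (.loop b p) c 1 c
  | loopStep {b : Test} {p : Program} {c c₁ c₂ : Config α} {t₁ t₂ : ℕ} :
      b.eval T c = some true → Runs T W S p c t₁ c₁ → Runs T W S (.loop b p) c₁ t₂ c₂ →
      Runs T W S (.loop b p) c (1 + t₁ + t₂) c₂

/-- The initial configuration: register `0` holds the length `n` of the input, register `1` holds
the parameter `h`; all other registers and all memory cells are `0`, and the output is empty. -/
def Config.init (α : Type*) (n h : ℕ) : Config α where
  reg r := if r = 0 then n else if r = 1 then h else 0
  mem _ := 0
  out := []

/-- A phrase on the output tape. -/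
def Phrase.output : Phrase α → List (ℕ ⊕ α)
  | .run l c => [Sum.inl l, Sum.inr c, Sum.inl 1]
  | .copy l s p => [Sum.inl l, Sum.inl s, Sum.inl p]

/-- On input `T` with parameter `h`, program `P` outputs the encoding `E` and halts within `time`
steps, using `space` memory cells and words below `W`. -/
def Computes [LinearOrder α] (P : Program) (T : List α) (h : ℕ) (E : List (Phrase α))
    (time space W : ℕ) : Prop :=
  T.length < W ∧ h < W ∧ ∃ (t : ℕ) (c : Config α),
    Runs T W space P (Config.init α T.length h) t c ∧ c.out = E.flatMap Phrase.output ∧ t ≤ time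

end Machine

end LZHB

/-! The admissible occurrences are factors of a single auxiliary text (`admissible`): the encoded
part, with names instead of symbols and with a separator at every position whose height is not below
`h`. This text only grows at its right end, so its suffix automaton can be maintained online. At the
start `b` of a phrase, reading from the root of the automaton finds the largest `m` such that
`T[b..b+m)` has an admissible occurrence. Prefixes of admissible words are admissible and minimum
periods do not decrease with the length. Hence a length is a candidate exactly if the minimum period
of the prefix of that length is at most `max m 1` (`isGreatest_candidate`). A Knuth-Morris-Pratt
scan that starts at `b` finds the largest such length `l` and its minimum period `p` (`wp_period`).
Unless the text ends there, the minimum period of length `l + 1` exceeds `m`, so `m ≤ l` and the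
look-ahead is paid for by the phrase. Reading the first `p` names once more leads to a state that
knows where its word first ends; this gives the leftmost source (`IsFirst.isLeast`).

The states of the automaton are the closed words, the longest words with given sets of occurrences.
Appending `c` to `U` creates at most two of them, `Uc` and the longest suffix `y` of `Uc` that
occurs in `U` (`closed_concat_iff`), and splits at most the class of the closure `q` of `y`.
`Sam.concat` turns this into an update of links and edges, and `wp_extend` shows that the program
performs it. A text of length `n` has at most `2n + 1` states and `3n + 1` edges
(`closed_finite_ncard`, `edges_finite_ncard`), which bounds the space. The time for following links
is amortized against the number of closed suffixes of the text, and the time for copying edges to a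
clone against the number of allocated nodes.

The factor `log σ` has two sources. The edges of a state form a digital search tree over the bits of
the names; names and the separator are at most `σ + 1`, so an edge is found in `O(log σ)` steps
(`wp_find`). The names come from a merge sort that drops duplicates while merging: `k` blocks hold
at most `min n (kσ)` elements, so about `log σ` rounds cost `O(n)` each and the others form a
geometric series (`sortCost_le_log`).

The programs are written in a small structured language with arrays, and `Exec.comp_runs` carries
them over to the machine with slowdown 15. The language has no multiplication, so the words grow no
faster than the time, and the bound on words follows from the bound on time. -/

set_option linter.constructorNameAsVariable false
set_option autoImplicit false

namespace LZHB

/-! ### A structured language compiled to the machine -/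

section Language

/-- The registers of the structured language. -/
inductive Reg where
  | n | h | al | last | v | c | u | t | r | w | x | d | cur | p | q | cl | g | b | e | i | k | j
  | m | per | s | f | dol
  deriving DecidableEq

/-- The arrays of the structured language. -/
inductive Arr where
  | HD | NX | RP | NM | LEN | LNK | FST | LH | LC | RC | KEY | TG | SB | F | HT
  deriving DecidableEq

/-- States of the structured language: registers, arrays, elapsed time and output. -/
structure St (α : Type*) where
  n : ℕ
  h : ℕ
  al : ℕ
  last : ℕ
  v : ℕ
  c : ℕ
  u : ℕ
  t : ℕ
  r : ℕ
  w : ℕ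
  x : ℕ
  d : ℕ
  cur : ℕ
  p : ℕ
  q : ℕ
  cl : ℕ
  g : ℕ
  b : ℕ
  e : ℕ
  i : ℕ
  k : ℕ
  j : ℕ
  m : ℕ
  per : ℕ
  s : ℕ
  f : ℕ
  dol : ℕ
  HD : ℕ → ℕ
  NX : ℕ → ℕ
  RP : ℕ → ℕ
  NM : ℕ → ℕ
  LEN : ℕ → ℕ
  LNK : ℕ → ℕ
  FST : ℕ → ℕ
  LH : ℕ → ℕ
  LC : ℕ → ℕ
  RC : ℕ → ℕ
  KEY : ℕ → ℕ
  TG : ℕ → ℕ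
  SB : ℕ → ℕ
  F : ℕ → ℕ
  HT : ℕ → ℕ
  tm : ℕ
  out : List (ℕ ⊕ α)

variable {α : Type*}

def St.get (a : St α) : Reg → ℕ
  | .n => a.n | .h => a.h | .al => a.al | .last => a.last | .v => a.v | .c => a.c | .u => a.u
  | .t => a.t | .r => a.r | .w => a.w | .x => a.x | .d => a.d | .cur => a.cur | .p => a.p
  | .q => a.q | .cl => a.cl | .g => a.g | .b => a.b | .e => a.e | .i => a.i | .k => a.k
  | .j => a.j | .m => a.m | .per => a.per | .s => a.s | .f => a.f | .dol => a.dol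

def St.set (a : St α) (y : ℕ) : Reg → St α
  | .n => { a with n := y } | .h => { a with h := y } | .al => { a with al := y }
  | .last => { a with last := y } | .v => { a with v := y } | .c => { a with c := y }
  | .u => { a with u := y } | .t => { a with t := y } | .r => { a with r := y }
  | .w => { a with w := y } | .x => { a with x := y } | .d => { a with d := y }
  | .cur => { a with cur := y } | .p => { a with p := y } | .q => { a with q := y }
  | .cl => { a with cl := y } | .g => { a with g := y } | .b => { a with b := y }
  | .e => { a with e := y } | .i => { a with i := y } | .k => { a with k := y }
  | .j => { a with j := y } | .m => { a with m := y } | .per => { a with per := y }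
  | .s => { a with s := y } | .f => { a with f := y } | .dol => { a with dol := y }

def St.arr (a : St α) : Arr → ℕ → ℕ
  | .HD => a.HD | .NX => a.NX | .RP => a.RP | .NM => a.NM | .LEN => a.LEN | .LNK => a.LNK
  | .FST => a.FST | .LH => a.LH | .LC => a.LC | .RC => a.RC | .KEY => a.KEY | .TG => a.TG
  | .SB => a.SB | .F => a.F | .HT => a.HT

def St.setArr (a : St α) (y : ℕ → ℕ) : Arr → St α
  | .HD => { a with HD := y } | .NX => { a with NX := y } | .RP => { a with RP := y }
  | .NM => { a with NM := y } | .LEN => { a with LEN := y } | .LNK => { a with LNK := y }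
  | .FST => { a with FST := y } | .LH => { a with LH := y } | .LC => { a with LC := y }
  | .RC => { a with RC := y } | .KEY => { a with KEY := y } | .TG => { a with TG := y }
  | .SB => { a with SB := y } | .F => { a with F := y } | .HT => { a with HT := y }

def St.tick (a : St α) (k : ℕ) : St α := { a with tm := a.tm + k }

def St.emit (a : St α) (o : ℕ ⊕ α) : St α := { a with out := a.out ++ [o] }

theorem St.get_set (a : St α) (y : ℕ) (r r' : Reg) :
    (a.set y r).get r' = if r' = r then y else a.get r' := by
  cases r <;> cases r' <;> rfl

theorem St.arr_set (a : St α) (y : ℕ) (r : Reg) : (a.set y r).arr = a.arr := by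
  funext k; cases r <;> cases k <;> rfl

theorem St.get_setArr (a : St α) (y : ℕ → ℕ) (r : Arr) : (a.setArr y r).get = a.get := by
  funext k; cases r <;> cases k <;> rfl

theorem St.arr_setArr (a : St α) (y : ℕ → ℕ) (r r' : Arr) :
    (a.setArr y r).arr r' = if r' = r then y else a.arr r' := by
  cases r <;> cases r' <;> rfl

theorem St.out_set (a : St α) (y : ℕ) (r : Reg) : (a.set y r).out = a.out := by cases r <;> rfl
theorem St.tm_set (a : St α) (y : ℕ) (r : Reg) : (a.set y r).tm = a.tm := by cases r <;> rfl
theorem St.out_setArr (a : St α) (y : ℕ → ℕ) (r : Arr) : (a.setArr y r).out = a.out := by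
  cases r <;> rfl
theorem St.tm_setArr (a : St α) (y : ℕ → ℕ) (r : Arr) : (a.setArr y r).tm = a.tm := by
  cases r <;> rfl
theorem St.get_tick (a : St α) (k : ℕ) : (a.tick k).get = a.get := by funext r; cases r <;> rfl
theorem St.arr_tick (a : St α) (k : ℕ) : (a.tick k).arr = a.arr := by funext r; cases r <;> rfl

/-- Expressions. -/
inductive Ex where
  | reg (r : Reg)
  | const (k : ℕ)
  | succ (a : Ex)
  | sub (a b : Ex)
  | half (a : Ex)
  | par (a : Ex)
  | ld (r : Arr) (a : Ex)

def Ex.ev (s : St α) : Ex → ℕ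
  | .reg r => s.get r
  | .const k => k
  | .succ a => a.ev s + 1
  | .sub a b => a.ev s - b.ev s
  | .half a => a.ev s / 2
  | .par a => a.ev s % 2
  | .ld r a => s.arr r (a.ev s)

/-- The time charged for an evaluation, and also a bound on growth: `const k` counts `k + 1`, so
that a value exceeds the stored words by at most its size. -/
def Ex.size : Ex → ℕ
  | .reg _ => 1
  | .const k => k + 1
  | .succ a => a.size + 1
  | .sub a b => a.size + b.size + 1
  | .half a => a.size + 1
  | .par a => a.size + 1
  | .ld _ a => a.size + 1

/-- Tests; `sl` compares two input symbols. -/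
inductive Tst where
  | eq (a b : Ex)
  | ne (a b : Ex)
  | lt (a b : Ex)
  | sl (a b : Ex)
  | and (a b : Tst)

def Tst.size : Tst → ℕ
  | .eq a b => a.size + b.size + 1
  | .ne a b => a.size + b.size + 1
  | .lt a b => a.size + b.size + 1
  | .sl a b => a.size + b.size + 1
  | .and a b => a.size + b.size + 1

def Tst.ev [LinearOrder α] (T : List α) (s : St α) : Tst → Prop
  | .eq a b => a.ev s = b.ev s
  | .ne a b => a.ev s ≠ b.ev s
  | .lt a b => a.ev s < b.ev s
  | .sl a b => ∃ x ∈ T[a.ev s]?, ∃ y ∈ T[b.ev s]?, x < y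
  | .and a b => a.ev T s ∧ b.ev T s

/-- All symbols that the test compares exist. -/
def Tst.ok (n : ℕ) (s : St α) : Tst → Prop
  | .sl a b => a.ev s < n ∧ b.ev s < n
  | .and a b => a.ok n s ∧ b.ok n s
  | _ => True

/-- Commands. -/
inductive Cmd where
  | set (r : Reg) (a : Ex)
  | store (r : Arr) (a b : Ex)
  | emitW (a : Ex)
  | emitS (a : Ex)
  | seq (p q : Cmd)
  | ite (b : Tst) (p q : Cmd)
  | loop (b : Tst) (p : Cmd)

variable [LinearOrder α]

/-- Big-step semantics for arrays with `lim` cells. -/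
inductive Exec (T : List α) (lim : ℕ) : Cmd → St α → St α → Prop where
  | set (r a s) : Exec T lim (.set r a) s ((s.set (a.ev s) r).tick a.size)
  | store (r) (a b : Ex) (s : St α) : a.ev s < lim →
      Exec T lim (.store r a b) s
        ((s.setArr (Function.update (s.arr r) (a.ev s) (b.ev s)) r).tick (a.size + b.size))
  | emitW (a : Ex) (s : St α) : Exec T lim (.emitW a) s ((s.emit (.inl (a.ev s))).tick a.size)
  | emitS (a : Ex) (s : St α) (y : α) : T[a.ev s]? = some y →
      Exec T lim (.emitS a) s ((s.emit (.inr y)).tick a.size)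
  | seq {p q s s₁ s₂} : Exec T lim p s s₁ → Exec T lim q s₁ s₂ → Exec T lim (.seq p q) s s₂
  | iteT {b : Tst} {p q s s'} : b.ok T.length s → b.ev T s → Exec T lim p (s.tick b.size) s' →
      Exec T lim (.ite b p q) s s'
  | iteF {b : Tst} {p q s s'} : b.ok T.length s → ¬ b.ev T s → Exec T lim q (s.tick b.size) s' →
      Exec T lim (.ite b p q) s s'
  | loopF {b : Tst} {p s} : b.ok T.length s → ¬ b.ev T s →
      Exec T lim (.loop b p) s (s.tick b.size)
  | loopT {b : Tst} {p s s₁ s₂} : b.ok T.length s → b.ev T s → Exec T lim p (s.tick b.size) s₁ →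
      Exec T lim (.loop b p) s₁ s₂ → Exec T lim (.loop b p) s s₂

end Language

/-! ### Translation of the structured language to the machine -/

section Compiler

/-- The machine register of a register. -/
def Reg.idx : Reg → ℕ
  | .n => 0 | .h => 1 | .al => 2 | .last => 3 | .v => 4 | .c => 5 | .u => 6 | .t => 7 | .r => 8
  | .w => 9 | .x => 10 | .d => 11 | .cur => 12 | .p => 13 | .q => 14 | .cl => 15 | .g => 16
  | .b => 17 | .e => 18 | .i => 19 | .k => 20 | .j => 21 | .m => 22 | .per => 23 | .s => 24
  | .f => 25 | .dol => 26

/-- The residue modulo `16` of the addresses of the cells of an array. -/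
def Arr.idx : Arr → ℕ
  | .HD => 0 | .NX => 1 | .RP => 2 | .NM => 3 | .LEN => 4 | .LNK => 5 | .FST => 6 | .LH => 7
  | .LC => 8 | .RC => 9 | .KEY => 10 | .TG => 11 | .SB => 12 | .F => 13 | .HT => 14

theorem Reg.idx_lt (r : Reg) : r.idx < 40 := by cases r <;> decide
theorem Reg.idx_inj {r r' : Reg} (h : r.idx = r'.idx) : r = r' := by
  cases r <;> cases r' <;> first | rfl | (exact absurd h (by decide))
theorem Arr.idx_lt (r : Arr) : r.idx < 16 := by cases r <;> decide
theorem Arr.idx_inj {r r' : Arr} (h : r.idx = r'.idx) : r = r' := by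
  cases r <;> cases r' <;> first | rfl | (exact absurd h (by decide))

/-- Machine registers `40`, `41`, `42`: the array size, zero, and a scratch register. -/
def addrCode (r : Arr) (d : ℕ) : Program :=
  .seq (.instr (.const 42 16)) (.seq (.instr (.arith .mul (43 + d) (43 + d) 42))
    (.seq (.instr (.const 42 r.idx)) (.instr (.arith .add (43 + d) (43 + d) 42))))

def Ex.comp (d : ℕ) : Ex → Program
  | .reg r => .instr (.arith .add (43 + d) r.idx 41)
  | .const k => .instr (.const (43 + d) k)
  | .succ a => .seq (a.comp d) (.seq (.instr (.const 42 1))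
      (.instr (.arith .add (43 + d) (43 + d) 42)))
  | .sub a b => .seq (a.comp d) (.seq (b.comp (d + 1))
      (.instr (.arith .sub (43 + d) (43 + d) (43 + (d + 1)))))
  | .half a => .seq (a.comp d) (.seq (.instr (.const 42 2))
      (.instr (.arith .div (43 + d) (43 + d) 42)))
  | .par a => .seq (a.comp d) (.seq (.instr (.const 42 2))
      (.instr (.arith .mod (43 + d) (43 + d) 42)))
  -- A load beyond the array limit yields `0` instead of failing, in accordance with `Sim.big`; thus
  -- expressions are total.
  | .ld r a => .seq (a.comp d) (.ite (.wordLt (43 + d) 40)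
      (.seq (addrCode r d) (.instr (.load (43 + d) (43 + d)))) (.instr (.const (43 + d) 0)))

def boolCode (t : Test) (d x y : ℕ) : Program :=
  .ite t (.instr (.const (43 + d) x)) (.instr (.const (43 + d) y))

def Tst.comp (d : ℕ) : Tst → Program
  | .eq a b => .seq (a.comp d) (.seq (b.comp (d + 1))
      (boolCode (.wordEq (43 + d) (43 + (d + 1))) d 1 0))
  | .ne a b => .seq (a.comp d) (.seq (b.comp (d + 1))
      (boolCode (.wordEq (43 + d) (43 + (d + 1))) d 0 1))
  | .lt a b => .seq (a.comp d) (.seq (b.comp (d + 1))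
      (boolCode (.wordLt (43 + d) (43 + (d + 1))) d 1 0))
  | .sl a b => .seq (a.comp d) (.seq (b.comp (d + 1))
      (boolCode (.symLt (43 + d) (43 + (d + 1))) d 1 0))
  | .and a b => .seq (a.comp d) (.seq (b.comp (d + 1))
      (.instr (.arith .mul (43 + d) (43 + d) (43 + (d + 1)))))

def Cmd.comp : Cmd → Program
  | .set r a => .seq (a.comp 0) (.instr (.arith .add r.idx 43 41))
  | .store r a b => .seq (a.comp 0) (.seq (b.comp 1) (.seq (addrCode r 0) (.instr (.store 43 44))))
  | .emitW a => .seq (a.comp 0) (.instr (.emitWord 43))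
  | .emitS a => .seq (a.comp 0) (.instr (.emitSymbol 43))
  | .seq p q => .seq p.comp q.comp
  | .ite b p q => .seq (b.comp 0) (.ite (.wordLt 41 43) p.comp q.comp)
  -- A machine loop tests a register only, so the test is evaluated before the loop and again at the
  -- end of each round.
  | .loop b p => .seq (b.comp 0) (.loop (.wordLt 41 43) (.seq p.comp (b.comp 0)))

variable {α : Type*}

/-- The configuration `c` represents the state `s`. -/
structure Sim (lim : ℕ) (s : St α) (c : Config α) : Prop where
  reg : ∀ r : Reg, c.reg r.idx = s.get r
  limit : c.reg 40 = lim
  zero : c.reg 41 = 0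
  mem : ∀ (r : Arr) (i : ℕ), i < lim → c.mem (i * 16 + r.idx) = s.arr r i
  big : ∀ (r : Arr) (i : ℕ), lim ≤ i → s.arr r i = 0
  out : c.out = s.out

/-- All words in the state are at most `M`. -/
structure St.Below (s : St α) (M : ℕ) : Prop where
  reg : ∀ r : Reg, s.get r ≤ M
  mem : ∀ (r : Arr) (i : ℕ), s.arr r i ≤ M

/-- Only `succ` and constants can produce a value above all stored words, and both are charged for
it. -/
theorem Ex.ev_le {s : St α} {M : ℕ} (h : s.Below M) (a : Ex) : a.ev s ≤ M + a.size := by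
  induction a with
  | reg r => exact (h.reg r).trans (by simp)
  | const k => simp only [Ex.ev, Ex.size]; omega
  | succ a ih => simp only [Ex.ev, Ex.size]; omega
  | sub a b iha ihb => simp only [Ex.ev, Ex.size]; omega
  | half a ih => simp only [Ex.ev, Ex.size]; omega
  | par a ih => simp only [Ex.ev, Ex.size]; omega
  | ld r a ih => exact (h.mem _ _).trans (by simp)

theorem Ex.size_pos (a : Ex) : 1 ≤ a.size := by cases a <;> simp [Ex.size]

theorem Tst.size_pos (a : Tst) : 1 ≤ a.size := by cases a <;> simp [Tst.size]

/-- `c'` agrees with `c` up to the temporary registers from `43 + d` on. -/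
structure Agree (d : ℕ) (c c' : Config α) : Prop where
  reg : ∀ r, r < 43 + d → r ≠ 42 → c'.reg r = c.reg r
  mem : c'.mem = c.mem
  out : c'.out = c.out

theorem Agree.trans {d e : ℕ} {c c' c'' : Config α} (h : Agree d c c') (h' : Agree e c' c'')
    (hde : d ≤ e) : Agree d c c'' :=
  ⟨fun r hr hr' => (h'.reg r (by omega) hr').trans (h.reg r hr hr'), h'.mem.trans h.mem,
    h'.out.trans h.out⟩

theorem Sim.agree {lim : ℕ} {s : St α} {c c' : Config α} {d : ℕ} (h : Sim lim s c)
    (ha : Agree d c c') : Sim lim s c' where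
  reg r := by
    have := r.idx_lt
    rw [ha.reg _ (by omega) (by omega), h.reg]
  limit := by rw [ha.reg _ (by omega) (by omega), h.limit]
  zero := by rw [ha.reg _ (by omega) (by omega), h.zero]
  mem r i hi := by rw [ha.mem, h.mem r i hi]
  big := h.big
  out := by rw [ha.out, h.out]

theorem Sim.tick {lim : ℕ} {s : St α} {c : Config α} (h : Sim lim s c) (k : ℕ) : Sim lim (s.tick k) c where
  reg := by rw [St.get_tick]; exact h.reg
  limit := h.limit
  zero := h.zero
  mem := by rw [St.arr_tick]; exact h.mem
  big := by rw [St.arr_tick]; exact h.big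
  out := h.out

theorem St.Below.tick {s : St α} {M : ℕ} (h : s.Below (M + s.tm)) (k : ℕ) :
    (s.tick k).Below (M + (s.tick k).tm) where
  reg r := by rw [St.get_tick]; exact (h.reg r).trans (by simp [St.tick])
  mem r i := by rw [St.arr_tick]; exact (h.mem r i).trans (by simp [St.tick])

variable [LinearOrder α] {T : List α} {W S lim : ℕ}

theorem runs_const {c : Config α} {r k : ℕ} (h : k < W) :
    Runs T W S (.instr (.const r k)) c 1 { c with reg := Function.update c.reg r k } :=
  .instr (by simp [Instr.exec, Config.setReg, h])

theorem runs_arith {c : Config α} {op : ArithOp} {r x y : ℕ} (h : op.eval (c.reg x) (c.reg y) < W) :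
    Runs T W S (.instr (.arith op r x y)) c 1
      { c with reg := Function.update c.reg r (op.eval (c.reg x) (c.reg y)) } :=
  .instr (by simp [Instr.exec, Config.setReg, h])

theorem runs_addr (r : Arr) (d : ℕ) (c : Config α) {i : ℕ} (hi : c.reg (43 + d) = i)
    (hil : i < lim) (hW : 16 * lim < W) (h16 : 16 < W) :
    ∃ c', Runs T W S (addrCode r d) c 4 c' ∧ (∀ x, x ≠ 42 → x ≠ 43 + d → c'.reg x = c.reg x) ∧
      c'.mem = c.mem ∧ c'.out = c.out ∧ c'.reg (43 + d) = i * 16 + r.idx := by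
  have hr := r.idx_lt
  have h42 : ¬ 43 + d = 42 := by omega
  subst hi
  refine ⟨_, .seq (t₁ := 1) (t₂ := 3) (runs_const h16) (.seq (t₁ := 1) (t₂ := 2) (runs_arith ?_)
    (.seq (t₁ := 1) (t₂ := 1) (runs_const (by omega)) (runs_arith ?_))), ?_, rfl, rfl, ?_⟩
  · simp [ArithOp.eval, h42]; omega
  · simp [ArithOp.eval, h42]; omega
  · intro x hx hx'; simp [Function.update_apply, hx, hx']
  · simp [ArithOp.eval, h42]

/-- The registers from `43` on form an evaluation stack: a second operand is computed one level up
and leaves the first one intact. Register `42` is scratch and is exempt from `Agree`. -/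
theorem Ex.comp_runs {s : St α} {M : ℕ} (hs : s.Below M) (hW : 16 * lim < W) (h16 : 16 < W)
    (hS : 16 * lim ≤ S) (a : Ex) : ∀ (d : ℕ) (c : Config α), Sim lim s c → M + a.size < W →
    ∃ t c', Runs T W S (a.comp d) c t c' ∧ Agree d c c' ∧ c'.reg (43 + d) = a.ev s ∧
      t ≤ 7 * a.size := by
  have h42 : ∀ d, ¬ 43 + d = 42 := fun d => by omega
  have key : ∀ (a : Ex) (d : ℕ) (c : Config α) (op : ArithOp) (k : ℕ), k ≤ 2 →
      (∃ t c', Runs T W S (a.comp d) c t c' ∧ Agree d c c' ∧ c'.reg (43 + d) = a.ev s ∧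
        t ≤ 7 * a.size) → op.eval (a.ev s) k < W →
      ∃ t c', Runs T W S (.seq (a.comp d) (.seq (.instr (.const 42 k))
        (.instr (.arith op (43 + d) (43 + d) 42)))) c t c' ∧ Agree d c c' ∧
        c'.reg (43 + d) = op.eval (a.ev s) k ∧ t ≤ 7 * (a.size + 1) := by
    rintro a d c op k hk ⟨t, c', hr, ha, hv, ht⟩ hop
    refine ⟨_, _, .seq hr (.seq (runs_const (by omega)) (runs_arith ?_)), ⟨?_, ha.mem, ha.out⟩, ?_,
      by omega⟩
    · simpa [Function.update_apply, hv, h42] using hop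
    · intro x hx hx'
      simp only [Function.update_apply]
      rw [if_neg (by omega), if_neg hx', ha.reg x hx hx']
    · simp [hv, h42]
  induction a with
  | reg r =>
    intro d c hc hM
    have h1 := hs.reg r
    have h2 := hc.reg r
    refine ⟨1, _, runs_arith ?_, ⟨?_, rfl, rfl⟩, ?_, by simp [Ex.size]⟩
    · simp [ArithOp.eval, hc.zero]; simp [Ex.size] at hM; omega
    · intro x hx _; exact Function.update_of_ne (by omega) _ _
    · simp [ArithOp.eval, hc.zero, h2, Ex.ev]
  | const k =>
    intro d c hc hM
    simp only [Ex.size] at hM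
    refine ⟨1, _, runs_const (by omega), ⟨?_, rfl, rfl⟩, by simp [Ex.ev], by simp [Ex.size]; omega⟩
    intro x hx _; exact Function.update_of_ne (by omega) _ _
  | succ a ih =>
    intro d c hc hM
    simp only [Ex.size] at hM
    have := a.ev_le hs
    exact key a d c .add 1 (by simp) (ih d c hc (by omega)) (by simp only [ArithOp.eval]; omega)
  | half a ih =>
    intro d c hc hM
    simp only [Ex.size] at hM
    have := a.ev_le hs
    exact key a d c .div 2 (by simp) (ih d c hc (by omega)) (by simp only [ArithOp.eval]; omega)
  | par a ih =>
    intro d c hc hM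
    simp only [Ex.size] at hM
    have := a.ev_le hs
    exact key a d c .mod 2 (by simp) (ih d c hc (by omega)) (by simp only [ArithOp.eval]; omega)
  | sub a b iha ihb =>
    intro d c hc hM
    simp only [Ex.size] at hM
    obtain ⟨t, c', hr, ha, hv, ht⟩ := iha d c hc (by omega)
    obtain ⟨t', c'', hr', ha', hv', ht'⟩ := ihb (d + 1) c' (hc.agree ha) (by omega)
    have := a.ev_le hs
    have e1 : c''.reg (43 + d) = a.ev s := by rw [ha'.reg _ (by omega) (by omega), hv]
    refine ⟨_, _, .seq hr (.seq hr' (runs_arith ?_)), ⟨?_, ha'.mem.trans ha.mem,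
      ha'.out.trans ha.out⟩, ?_, by simp only [Ex.size]; omega⟩
    · simp only [ArithOp.eval, e1]; omega
    · intro x hx hx'
      simp only [Function.update_apply]
      rw [if_neg (by omega), ha'.reg x (by omega) hx', ha.reg x hx hx']
    · simp [ArithOp.eval, e1, hv', Ex.ev]
  | ld r a ih =>
    intro d c hc hM
    simp only [Ex.size] at hM
    obtain ⟨t, c', hr, ha, hv, ht⟩ := ih d c hc (by omega)
    have hc' := hc.agree ha
    by_cases hl : a.ev s < lim
    · obtain ⟨c₂, hr₂, h2, h3, h4, h5⟩ := runs_addr (T := T) (S := S) r d c' hv hl hW h16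
      have hidx := r.idx_lt
      have hmem := hs.mem r (a.ev s)
      have hm2 : c₂.mem (a.ev s * 16 + r.idx) = s.arr r (a.ev s) := by rw [h3, hc'.mem r _ hl]
      refine ⟨_, { c₂ with reg := Function.update c₂.reg (43 + d) (s.arr r (a.ev s)) },
        .seq hr (.iteTrue ?_ (.seq hr₂ (.instr ?_))), ⟨?_, h3.trans ha.mem, h4.trans ha.out⟩, ?_,
        by simp only [Ex.size]; omega⟩
      · simp [Test.eval, hv, hc'.limit, hl]
      · have : a.ev s * 16 + r.idx < S := by omega
        simp only [Instr.exec, h5, Config.setReg, hm2]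
        rw [if_pos this, if_pos (by omega)]
      · intro x hx hx'
        simp only [Function.update_apply]
        rw [if_neg (by omega), h2 x hx' (by omega), ha.reg x hx hx']
      · simp [Ex.ev]
    · refine ⟨_, _, .seq hr (.iteFalse ?_ (runs_const (by omega))), ⟨?_, ha.mem, ha.out⟩, ?_,
        by simp only [Ex.size]; omega⟩
      · simp only [Test.eval, hv, hc'.limit, hl, decide_false]
      · intro x hx hx'
        simp only [Function.update_apply]
        rw [if_neg (by omega), ha.reg x hx hx']
      · simp [Ex.ev, hc.big r _ (not_lt.1 hl)]

theorem runs_bool {c : Config α} {t : Test} {b : Bool} (d : ℕ) {x y : ℕ} (hb : t.eval T c = some b)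
    (hx : x < W) (hy : y < W) :
    ∃ c', Runs T W S (boolCode t d x y) c 2 c' ∧ Agree d c c' ∧
      c'.reg (43 + d) = if b then x else y := by
  cases b
  · exact ⟨_, .iteFalse hb (runs_const hy), ⟨fun r hr _ => by
      simp [Function.update_apply]; omega, rfl, rfl⟩, by simp⟩
  · exact ⟨_, .iteTrue hb (runs_const hx), ⟨fun r hr _ => by
      simp [Function.update_apply]; omega, rfl, rfl⟩, by simp⟩

theorem Tst.comp_runs {s : St α} {M : ℕ} (hs : s.Below M) (hW : 16 * lim < W) (h16 : 16 < W)
    (hS : 16 * lim ≤ S) (a : Tst) : ∀ (d : ℕ) (c : Config α), Sim lim s c → M + a.size < W →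
    a.ok T.length s →
    ∃ t c', Runs T W S (a.comp d) c t c' ∧ Agree d c c' ∧
      ((a.ev T s → c'.reg (43 + d) = 1) ∧ (¬ a.ev T s → c'.reg (43 + d) = 0)) ∧
      t ≤ 7 * a.size := by
  have key : ∀ (a b : Ex) (d : ℕ) (c : Config α), Sim lim s c → M + (a.size + b.size + 1) < W →
    ∀ (t : Test) (v : Bool), (∀ c' : Config α, c'.reg (43 + d) = a.ev s →
      c'.reg (43 + (d + 1)) = b.ev s → t.eval T c' = some v) → ∀ x y, x ≤ 1 → y ≤ 1 →
    ∃ t' c', Runs T W S (.seq (a.comp d) (.seq (b.comp (d + 1)) (boolCode t d x y))) c t' c' ∧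
      Agree d c c' ∧ c'.reg (43 + d) = (if v then x else y) ∧ t' ≤ 7 * (a.size + b.size + 1) := by
    intro a b d c hc hM t v h x y hx hy
    obtain ⟨t1, c1, hr1, ha1, hv1, ht1⟩ := a.comp_runs (T := T) hs hW h16 hS d c hc (by omega)
    obtain ⟨t2, c2, hr2, ha2, hv2, ht2⟩ :=
      b.comp_runs (T := T) hs hW h16 hS (d + 1) c1 (hc.agree ha1) (by omega)
    obtain ⟨c3, hr3, ha3, hv3⟩ := runs_bool (T := T) (W := W) (S := S) d (x := x) (y := y)
      (h c2 (by rw [ha2.reg _ (by omega) (by omega), hv1]) hv2) (by omega) (by omega)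
    exact ⟨_, c3, .seq hr1 (.seq hr2 hr3), (ha1.trans ha2 (by omega)).trans ha3 le_rfl, hv3,
      by omega⟩
  induction a with
  | eq a b =>
    intro d c hc hM _
    obtain ⟨t, c', h1, h2, h3, h4⟩ := key a b d c hc hM (.wordEq (43 + d) (43 + (d + 1)))
      (decide (a.ev s = b.ev s)) (fun c' e1 e2 => by simp only [Test.eval, e1, e2]) 1 0 le_rfl
      (by simp)
    exact ⟨t, c', h1, h2, ⟨fun h => by rw [h3, decide_eq_true (p := a.ev s = b.ev s) h]; rfl,
      fun h => by rw [h3, decide_eq_false (p := a.ev s = b.ev s) h]; rfl⟩, h4⟩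
  | ne a b =>
    intro d c hc hM _
    obtain ⟨t, c', h1, h2, h3, h4⟩ := key a b d c hc hM (.wordEq (43 + d) (43 + (d + 1)))
      (decide (a.ev s = b.ev s)) (fun c' e1 e2 => by simp only [Test.eval, e1, e2]) 0 1 (by simp)
      le_rfl
    exact ⟨t, c', h1, h2, ⟨fun h => by rw [h3, decide_eq_false (p := a.ev s = b.ev s) h]; rfl,
      fun h => by rw [h3, decide_eq_true (p := a.ev s = b.ev s) (not_not.1 h)]; rfl⟩, h4⟩
  | lt a b =>
    intro d c hc hM _
    obtain ⟨t, c', h1, h2, h3, h4⟩ := key a b d c hc hM (.wordLt (43 + d) (43 + (d + 1)))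
      (decide (a.ev s < b.ev s)) (fun c' e1 e2 => by simp only [Test.eval, e1, e2]) 1 0 le_rfl
      (by simp)
    exact ⟨t, c', h1, h2, ⟨fun h => by rw [h3, decide_eq_true (p := a.ev s < b.ev s) h]; rfl,
      fun h => by rw [h3, decide_eq_false (p := a.ev s < b.ev s) h]; rfl⟩, h4⟩
  | sl a b =>
    intro d c hc hM hok
    obtain ⟨hx, hy⟩ := hok
    have hiff : (Tst.sl a b).ev T s ↔ T[a.ev s] < T[b.ev s] := by
      simp [Tst.ev, List.getElem?_eq_getElem hx, List.getElem?_eq_getElem hy]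
    obtain ⟨t, c', h1, h2, h3, h4⟩ := key a b d c hc hM (.symLt (43 + d) (43 + (d + 1)))
      (decide (T[a.ev s] < T[b.ev s]))
      (fun c' e1 e2 => by
        simp only [Test.eval, e1, e2, List.getElem?_eq_getElem hx, List.getElem?_eq_getElem hy,
          Option.bind_some, Option.map_some])
      1 0 le_rfl (by simp)
    exact ⟨t, c', h1, h2, ⟨fun h => by rw [h3, decide_eq_true (hiff.1 h)]; rfl,
      fun h => by rw [h3, decide_eq_false (fun h' => h (hiff.2 h'))]; rfl⟩, h4⟩
  | and a b iha ihb =>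
    intro d c hc hM hok
    simp only [Tst.size] at hM
    obtain ⟨t1, c1, hr1, ha1, hv1, ht1⟩ := iha d c hc (by omega) hok.1
    obtain ⟨t2, c2, hr2, ha2, hv2, ht2⟩ := ihb (d + 1) c1 (hc.agree ha1) (by omega) hok.2
    have e1 := ha2.reg (43 + d) (by omega) (by omega)
    have hx : c1.reg (43 + d) ≤ 1 := by
      by_cases h : a.ev T s
      · rw [hv1.1 h]
      · rw [hv1.2 h]; omega
    have hy : c2.reg (43 + (d + 1)) ≤ 1 := by
      by_cases h : b.ev T s
      · rw [hv2.1 h]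
      · rw [hv2.2 h]; omega
    have hxy := Nat.mul_le_mul hx hy
    refine ⟨_, _, .seq hr1 (.seq hr2 (runs_arith ?_)),
      (ha1.trans ha2 (by omega)).trans (e := d) ⟨?_, rfl, rfl⟩ le_rfl, ⟨?_, ?_⟩,
      by simp only [Tst.size]; omega⟩
    · simp only [ArithOp.eval, e1]; omega
    · intro x hx _; simp only [Function.update_apply]; rw [if_neg (by omega)]
    · rintro ⟨h1, h2⟩
      simp [ArithOp.eval, e1, hv2.1 h2, hv1.1 h1]
    · intro h
      by_cases h1 : a.ev T s
      · have h2 : ¬ b.ev T s := fun h2 => h ⟨h1, h2⟩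
        simp [ArithOp.eval, hv2.2 h2]
      · simp [ArithOp.eval, e1, hv1.2 h1]

theorem Exec.tm_le {p : Cmd} {s s' : St α} (h : Exec T lim p s s') : s.tm ≤ s'.tm := by
  induction h with
  | set => simp [St.tick, St.tm_set]
  | store => simp [St.tick, St.tm_setArr]
  | emitW => simp [St.tick, St.emit]
  | emitS => simp [St.tick, St.emit]
  | seq _ _ h1 h2 => exact h1.trans h2
  | iteT _ _ _ h => exact le_trans (by simp [St.tick]) h
  | iteF _ _ _ h => exact le_trans (by simp [St.tick]) h
  | loopF => simp [St.tick]
  | loopT _ _ _ _ h1 h2 => exact le_trans (le_trans (by simp [St.tick]) h1) h2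

/-- The compiled command simulates the command, with a constant slowdown. -/
theorem Exec.comp_runs {M : ℕ} (hW : 16 * lim < W) (h16 : 16 < W) (hS : 16 * lim ≤ S)
    {p : Cmd} {s s' : St α} (h : Exec T lim p s s') : ∀ c : Config α, Sim lim s c →
    s.Below (M + s.tm) → M + s'.tm < W →
    ∃ t c', Runs T W S p.comp c t c' ∧ Sim lim s' c' ∧ s'.Below (M + s'.tm) ∧
      t + 15 * s.tm ≤ 15 * s'.tm := by
  induction h with
  | set r a s =>
    intro c hc hB hM
    simp only [St.tick, St.tm_set] at hM ⊢
    obtain ⟨t, c', h1, h2, h3, h4⟩ := a.comp_runs (T := T) hB hW h16 hS 0 c hc (by omega)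
    have hc' := hc.agree h2
    have h5 := a.ev_le hB
    have h6 := a.size_pos
    have h7 := r.idx_lt
    simp only [Nat.add_zero] at h3
    refine ⟨_, _, .seq h1 (runs_arith ?_), ⟨?_, ?_, ?_, ?_, ?_, ?_⟩, ⟨?_, ?_⟩, by omega⟩
    · simp only [ArithOp.eval, h3, hc'.zero]; omega
    · intro r'
      change _ = (s.set _ _).get r'
      simp only [Function.update_apply, St.get_set, ArithOp.eval, h3, hc'.zero, hc'.reg, Nat.add_zero]
      by_cases hr : r' = r
      · simp [hr]
      · rw [if_neg (fun h => hr (Reg.idx_inj h)), if_neg hr]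
    · exact (Function.update_of_ne (by omega) _ _).trans hc'.limit
    · exact (Function.update_of_ne (by omega) _ _).trans hc'.zero
    · intro r' i hi
      change _ = (s.set _ _).arr r' i
      rw [St.arr_set]; exact hc'.mem r' i hi
    · intro r' i hi
      change (s.set _ _).arr r' i = _
      rw [St.arr_set]; exact hc'.big r' i hi
    · change _ = (s.set _ _).out
      rw [St.out_set]; exact hc'.out
    · intro r'
      change (s.set _ _).get r' ≤ _
      rw [St.get_set]
      have := hB.reg r'
      split_ifs <;> omega
    · intro r' i
      change (s.set _ _).arr r' i ≤ _
      rw [St.arr_set]; exact (hB.mem r' i).trans (by omega)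
  | store r a b s hlt =>
    intro c hc hB hM
    simp only [St.tick, St.tm_setArr] at hM ⊢
    obtain ⟨t, c', h1, h2, h3, h4⟩ := a.comp_runs (T := T) hB hW h16 hS 0 c hc (by omega)
    obtain ⟨t', c'', h1', h2', h3', h4'⟩ :=
      b.comp_runs (T := T) hB hW h16 hS 1 c' (hc.agree h2) (by omega)
    have hc'' := (hc.agree h2).agree h2'
    have h5 := b.ev_le hB
    have h7 := r.idx_lt
    have h8 : c''.reg 43 = a.ev s := by rw [h2'.reg _ (by omega) (by omega)]; exact h3
    obtain ⟨c₂, g1, g2, g3, g4, g5⟩ := runs_addr (T := T) (S := S) r 0 c'' h8 hlt hW h16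
    have h9 : c₂.reg 44 = b.ev s := by rw [g2 _ (by omega) (by omega)]; exact h3'
    simp only [Nat.add_zero] at g5
    have := a.size_pos
    refine ⟨_, { c₂ with mem := Function.update c₂.mem (a.ev s * 16 + r.idx) (b.ev s) },
      .seq h1 (.seq h1' (.seq g1 (.instr ?_))), ⟨?_, ?_, ?_, ?_, ?_, ?_⟩, ⟨?_, ?_⟩, by omega⟩
    · simp only [Instr.exec, g5, h9]
      rw [if_pos ⟨by omega, by omega⟩]
    · intro r'
      have := r'.idx_lt
      change _ = (s.setArr _ _).get r'
      rw [St.get_setArr, ← hc''.reg]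
      exact g2 _ (by omega) (by omega)
    · exact (g2 _ (by omega) (by omega)).trans hc''.limit
    · exact (g2 _ (by omega) (by omega)).trans hc''.zero
    · intro r' i hi
      change _ = (s.setArr _ _).arr r' i
      have := r'.idx_lt
      simp only [St.arr_setArr, Function.update_apply, g3, hc''.mem r' i hi]
      by_cases hr : r' = r
      · subst hr
        simp only [if_true, Function.update_apply]
        by_cases hi : i = a.ev s
        · simp [hi]
        · rw [if_neg (by omega), if_neg hi]
      · have : r'.idx ≠ r.idx := fun h => hr (Arr.idx_inj h)
        rw [if_neg (by omega), if_neg hr]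
    · intro r' i hi
      change (s.setArr _ _).arr r' i = _
      rw [St.arr_setArr]
      split_ifs with hr
      · subst hr
        rw [Function.update_of_ne (by omega)]; exact hc.big _ i hi
      · exact hc.big r' i hi
    · change _ = (s.setArr _ _).out
      rw [St.out_setArr]; exact g4.trans hc''.out
    · intro r'
      change (s.setArr _ _).get r' ≤ _
      rw [St.get_setArr]; exact (hB.reg r').trans (by omega)
    · intro r' i
      change (s.setArr _ _).arr r' i ≤ _
      rw [St.arr_setArr]
      have h1 := hB.mem r i
      have h2 := hB.mem r' i
      split_ifs
      · rw [Function.update_apply]; split_ifs <;> omega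
      · omega
  | emitW a s =>
    intro c hc hB hM
    simp only [St.tick, St.emit] at hM ⊢
    obtain ⟨t, c', h1, h2, h3, h4⟩ := a.comp_runs (T := T) hB hW h16 hS 0 c hc (by omega)
    have hc' := hc.agree h2
    have := a.size_pos
    refine ⟨_, _, .seq h1 (.instr rfl), ⟨?_, hc'.limit, hc'.zero, ?_, ?_, ?_⟩, ⟨?_, ?_⟩, by omega⟩
    · intro r; exact (hc'.reg r).trans (by cases r <;> rfl)
    · intro r i hi; exact (hc'.mem r i hi).trans (by cases r <;> rfl)
    · intro r i hi; exact Eq.trans (by cases r <;> rfl) (hc'.big r i hi)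
    · rw [← hc'.out, ← h3]
    · intro r; exact le_trans (by cases r <;> exact le_rfl) ((hB.reg r).trans (by omega))
    · intro r i; exact le_trans (by cases r <;> exact le_rfl) ((hB.mem r i).trans (by omega))
  | emitS a s y hy =>
    intro c hc hB hM
    simp only [St.tick, St.emit] at hM ⊢
    obtain ⟨t, c', h1, h2, h3, h4⟩ := a.comp_runs (T := T) hB hW h16 hS 0 c hc (by omega)
    have hc' := hc.agree h2
    have := a.size_pos
    simp only [Nat.add_zero] at h3
    refine ⟨_, { c' with out := c'.out ++ [Sum.inr y] }, .seq h1 (.instr ?_),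
      ⟨?_, hc'.limit, hc'.zero, ?_, ?_, ?_⟩, ⟨?_, ?_⟩, by omega⟩
    · simp only [Instr.exec, h3, hy, Option.map_some]
    · intro r; exact (hc'.reg r).trans (by cases r <;> rfl)
    · intro r i hi; exact (hc'.mem r i hi).trans (by cases r <;> rfl)
    · intro r i hi; exact Eq.trans (by cases r <;> rfl) (hc'.big r i hi)
    · rw [← hc'.out]
    · intro r; exact le_trans (by cases r <;> exact le_rfl) ((hB.reg r).trans (by omega))
    · intro r i; exact le_trans (by cases r <;> exact le_rfl) ((hB.mem r i).trans (by omega))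
  | seq e1 e2 ih1 ih2 =>
    intro c hc hB hM
    have := e2.tm_le
    obtain ⟨t, c', h1, h2, h3, h4⟩ := ih1 c hc hB (by omega)
    obtain ⟨t', c'', h1', h2', h3', h4'⟩ := ih2 c' h2 h3 hM
    exact ⟨_, c'', .seq h1 h1', h2', h3', by omega⟩
  | @iteT b p q s s' hok hev e ih =>
    intro c hc hB hM
    have h0 := e.tm_le
    simp only [St.tick] at h0
    obtain ⟨t, c', h1, h2, h3, h4⟩ := b.comp_runs (T := T) hB hW h16 hS 0 c hc (by omega) hok
    replace h3 := h3.1 hev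
    simp only [Nat.add_zero] at h3
    have hc' := hc.agree h2
    obtain ⟨t', c'', h1', h2', h3', h4'⟩ := ih c' (hc'.tick _) (hB.tick _) hM
    simp only [St.tick] at h4'
    exact ⟨_, c'', .seq h1 (.iteTrue (by simp [Test.eval, h3, hc'.zero]) h1'), h2', h3',
      by have := b.size_pos; omega⟩
  | @iteF b p q s s' hok hev e ih =>
    intro c hc hB hM
    have h0 := e.tm_le
    simp only [St.tick] at h0
    obtain ⟨t, c', h1, h2, h3, h4⟩ := b.comp_runs (T := T) hB hW h16 hS 0 c hc (by omega) hok
    replace h3 := h3.2 hev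
    simp only [Nat.add_zero] at h3
    have hc' := hc.agree h2
    obtain ⟨t', c'', h1', h2', h3', h4'⟩ := ih c' (hc'.tick _) (hB.tick _) hM
    simp only [St.tick] at h4'
    exact ⟨_, c'', .seq h1 (.iteFalse (by simp [Test.eval, h3, hc'.zero]) h1'), h2', h3',
      by have := b.size_pos; omega⟩
  | @loopF b p s hok hev =>
    intro c hc hB hM
    simp only [St.tick] at hM
    obtain ⟨t, c', h1, h2, h3, h4⟩ := b.comp_runs (T := T) hB hW h16 hS 0 c hc (by omega) hok
    replace h3 := h3.2 hev
    simp only [Nat.add_zero] at h3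
    have hc' := hc.agree h2
    exact ⟨_, c', .seq h1 (.loopDone (by simp [Test.eval, h3, hc'.zero])), hc'.tick _, hB.tick _,
      by have := b.size_pos; simp only [St.tick]; omega⟩
  | @loopT b p s s₁ s₂ hok hev e1 e2 ih1 ih2 =>
    intro c hc hB hM
    have h0 := e1.tm_le
    have h00 := e2.tm_le
    simp only [St.tick] at h0
    obtain ⟨t, c', h1, h2, h3, h4⟩ := b.comp_runs (T := T) hB hW h16 hS 0 c hc (by omega) hok
    replace h3 := h3.1 hev
    simp only [Nat.add_zero] at h3
    have hc' := hc.agree h2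
    obtain ⟨t', c'', h1', h2', h3', h4'⟩ := ih1 c' (hc'.tick _) (hB.tick _) (by omega)
    simp only [St.tick] at h4'
    obtain ⟨t3, c3, h5, h6, h7, h8⟩ := ih2 c'' h2' h3' hM
    have hb := b.size_pos
    simp only [Cmd.comp] at h5 ⊢
    -- The run of the remaining loop starts with its own evaluation of the test; this prefix becomes
    -- the end of the current body.
    cases h5 with
    | @seq _ _ _ c4 _ t4 t5 r4 r5 =>
      exact ⟨_, c3, .seq h1 (.loopStep (by simp [Test.eval, h3, hc'.zero]) (.seq h1' r4) r5), h6,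
        h7, by omega⟩

end Compiler

/-! ### Weakest preconditions -/

infixr:60 " ;; " => Cmd.seq

section WeakestPreconditions

variable {α : Type*} [LinearOrder α] {T : List α} {lim : ℕ}

/-- Command `p`, started in state `s`, halts in a state that satisfies `Q`. -/
def WP (T : List α) (lim : ℕ) (p : Cmd) (s : St α) (Q : St α → Prop) : Prop :=
  ∃ s', Exec T lim p s s' ∧ Q s'

theorem WP.mono {p : Cmd} {s : St α} {Q Q' : St α → Prop} (h : WP T lim p s Q)
    (hQ : ∀ s', Q s' → Q' s') : WP T lim p s Q' := by
  obtain ⟨s', h1, h2⟩ := h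
  exact ⟨s', h1, hQ _ h2⟩

theorem wp_set {r : Reg} {a : Ex} {s : St α} {Q : St α → Prop} :
    WP T lim (.set r a) s Q ↔ Q ((s.set (a.ev s) r).tick a.size) :=
  ⟨by rintro ⟨_, ⟨⟩, h⟩; exact h, fun h => ⟨_, .set _ _ _, h⟩⟩

theorem wp_store {r : Arr} {a b : Ex} {s : St α} {Q : St α → Prop} :
    WP T lim (.store r a b) s Q ↔ a.ev s < lim ∧
      Q ((s.setArr (Function.update (s.arr r) (a.ev s) (b.ev s)) r).tick (a.size + b.size)) :=
  ⟨by rintro ⟨_, ⟨⟩, h⟩; exact ⟨‹_›, h⟩, fun h => ⟨_, .store _ _ _ _ h.1, h.2⟩⟩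

theorem wp_emitW {a : Ex} {s : St α} {Q : St α → Prop} :
    WP T lim (.emitW a) s Q ↔ Q ((s.emit (.inl (a.ev s))).tick a.size) :=
  ⟨by rintro ⟨_, ⟨⟩, h⟩; exact h, fun h => ⟨_, .emitW _ _, h⟩⟩

theorem wp_emitS {a : Ex} {s : St α} {Q : St α → Prop} (y : α) (hy : T[a.ev s]? = some y)
    (h : Q ((s.emit (.inr y)).tick a.size)) : WP T lim (.emitS a) s Q :=
  ⟨_, .emitS _ _ _ hy, h⟩

theorem wp_seq {p q : Cmd} {s : St α} {Q : St α → Prop} :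
    WP T lim (p ;; q) s Q ↔ WP T lim p s (fun s₁ => WP T lim q s₁ Q) :=
  ⟨by rintro ⟨_, ⟨⟩, h⟩; exact ⟨_, ‹_›, _, ‹_›, h⟩,
    fun ⟨_, h1, _, h2, h3⟩ => ⟨_, .seq h1 h2, h3⟩⟩

theorem wp_ite {b : Tst} {p q : Cmd} {s : St α} {Q : St α → Prop} :
    WP T lim (.ite b p q) s Q ↔ b.ok T.length s ∧
      (b.ev T s → WP T lim p (s.tick b.size) Q) ∧
      (¬ b.ev T s → WP T lim q (s.tick b.size) Q) := by
  constructor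
  · rintro ⟨_, h, hQ⟩
    cases h with
    | iteT h1 h2 h3 => exact ⟨h1, fun _ => ⟨_, h3, hQ⟩, fun h => absurd h2 h⟩
    | iteF h1 h2 h3 => exact ⟨h1, fun h => absurd h h2, fun _ => ⟨_, h3, hQ⟩⟩
  · rintro ⟨h1, h2, h3⟩
    by_cases h : b.ev T s
    · obtain ⟨_, h4, h5⟩ := h2 h
      exact ⟨_, .iteT h1 h h4, h5⟩
    · obtain ⟨_, h4, h5⟩ := h3 h
      exact ⟨_, .iteF h1 h h4, h5⟩

theorem wp_loop {b : Tst} {p : Cmd} {s : St α} {Q : St α → Prop} (hok : b.ok T.length s)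
    (ht : b.ev T s → WP T lim p (s.tick b.size) (fun s₁ => WP T lim (.loop b p) s₁ Q))
    (hf : ¬ b.ev T s → Q (s.tick b.size)) : WP T lim (.loop b p) s Q := by
  by_cases h : b.ev T s
  · obtain ⟨_, h1, _, h2, h3⟩ := ht h
    exact ⟨_, .loopT hok h h1 h2, h3⟩
  · exact ⟨_, .loopF hok h, hf h⟩

/-- Loops with an invariant that is indexed by a decreasing measure. -/
theorem wp_loop_of {b : Tst} {p : Cmd} {Q : St α → Prop} (I : ℕ → St α → Prop)
    (hok : ∀ k s, I k s → b.ok T.length s)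
    (ht : ∀ k s, I k s → b.ev T s →
      WP T lim p (s.tick b.size) (fun s₁ => ∃ k' < k, I k' s₁))
    (hf : ∀ k s, I k s → ¬ b.ev T s → Q (s.tick b.size)) :
    ∀ k s, I k s → WP T lim (.loop b p) s Q := by
  intro k
  induction k using Nat.strong_induction_on with
  | _ k ih =>
    intro s hI
    refine wp_loop (hok k s hI) (fun h => ?_) (hf k s hI)
    exact (ht k s hI h).mono (fun s₁ ⟨k', h1, h2⟩ => ih k' h1 s₁ h2)

def St.init (α : Type*) (n h : ℕ) : St α where
  n := n
  h := h
  al := 0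
  last := 0
  v := 0
  c := 0
  u := 0
  t := 0
  r := 0
  w := 0
  x := 0
  d := 0
  cur := 0
  p := 0
  q := 0
  cl := 0
  g := 0
  b := 0
  e := 0
  i := 0
  k := 0
  j := 0
  m := 0
  per := 0
  s := 0
  f := 0
  dol := 0
  HD _ := 0
  NX _ := 0
  RP _ := 0
  NM _ := 0
  LEN _ := 0
  LNK _ := 0
  FST _ := 0
  LH _ := 0
  LC _ := 0
  RC _ := 0
  KEY _ := 0
  TG _ := 0
  SB _ := 0
  F _ := 0
  HT _ := 0
  tm := 0
  out := []

/-- The machine program for a command, with arrays of `8 (n + 1)` cells. -/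
def Cmd.program (p : Cmd) : Program :=
  .seq (.instr (.const 42 8)) (.seq (.instr (.arith .mul 40 0 42))
    (.seq (.instr (.arith .add 40 40 42)) p.comp))

/-- Arrays of `8 * n + 8` cells, interleaved with stride 16, occupy `128 * (n + 1)` cells. The three
extra steps compute the array limit. Words never exceed the largest initial word plus the elapsed
time. -/
theorem Cmd.computes {p : Cmd} {h time space W A : ℕ} {E : List (Phrase α)}
    (hp : WP T (8 * T.length + 8) p (St.init α T.length h)
      (fun s => s.out = E.flatMap Phrase.output ∧ s.tm ≤ A))
    (htime : 15 * A + 3 ≤ time) (hspace : 128 * (T.length + 1) ≤ space)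
    (hW : 128 * (T.length + 1) + h + A < W) :
    Computes p.program T h E time space W := by
  obtain ⟨s, hs, hout, ht⟩ := hp
  refine ⟨by omega, by omega, ?_⟩
  have hB : (St.init α T.length h).Below (T.length + h + (St.init α T.length h).tm) :=
    ⟨fun r => by cases r <;> simp [St.init, St.get], fun r i => by cases r <;> simp [St.init, St.arr]⟩
  let c : Config α :=
    ⟨Function.update (Function.update (Function.update (Config.init α T.length h).reg 42 8) 40
      (T.length * 8)) 40 (T.length * 8 + 8), fun _ => 0, []⟩
  have hc : Sim (8 * T.length + 8) (St.init α T.length h) c := by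
    refine ⟨?_, ?_, ?_, ?_, ?_, rfl⟩
    · intro r
      cases r <;> simp [c, Reg.idx, Config.init, St.init, St.get]
    · simp [c]; omega
    · simp [c, Config.init]
    · intro r i _; cases r <;> rfl
    · intro r i _; cases r <;> rfl
  obtain ⟨t, c', h1, h2, -, h4⟩ := hs.comp_runs (W := W) (S := space) (by omega) (by omega)
    (by omega) c hc hB (by omega)
  have h3 : Runs T W space p.program (Config.init α T.length h) (1 + (1 + (1 + t))) c' := by
    refine .seq (runs_const (by omega)) (.seq (runs_arith ?_) (.seq (runs_arith ?_) ?_))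
    · simp [ArithOp.eval, Config.init]; omega
    · simp [ArithOp.eval, Config.init]; omega
    · simpa [c, ArithOp.eval, Config.init] using h1
  simp only [St.init] at h4
  exact ⟨_, c', h3, by rw [h2.out, hout], by omega⟩

end WeakestPreconditions

/-! ### Combinatorics of the suffix automaton -/

section SuffixAutomaton

variable {β : Type*}

theorem infix_iff_exists_prefix {z U : List β} : z <:+: U ↔ ∃ P, P <+: U ∧ z <:+ P := by
  rw [List.infix_iff_suffix_prefix]
  exact ⟨fun ⟨P, h1, h2⟩ => ⟨P, h2, h1⟩, fun ⟨P, h1, h2⟩ => ⟨P, h2, h1⟩⟩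

/-- The words that are the longest in their class of words with the same occurrences in `U`:
prefixes, and factors with two different extensions to the left. -/
def Closed (U x : List β) : Prop :=
  x <+: U ∨ ∃ a b, a ≠ b ∧ (a :: x) <:+: U ∧ (b :: x) <:+: U

theorem Closed.nil (U : List β) : Closed U [] := .inl List.nil_prefix

theorem Closed.isInfix {U x : List β} (h : Closed U x) : x <:+: U := by
  rcases h with h | ⟨a, b, -, h, -⟩
  · exact h.isInfix
  · exact (List.infix_cons (List.infix_refl x)).trans h

theorem Closed.of_prefix {U x y : List β} (h : Closed U y) (hxy : x <+: y) : Closed U x := by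
  rcases h with h | ⟨a, b, hab, h1, h2⟩
  · exact .inl (hxy.trans h)
  · have : ∀ c : β, c :: x <:+: c :: y := fun c =>
      List.IsPrefix.isInfix (by simpa using hxy)
    exact .inr ⟨a, b, hab, (this a).trans h1, (this b).trans h2⟩

/-- `y` is the longest word with the same occurrences in `U` as the factor `z`. -/
structure IsCl (U z y : List β) : Prop where
  closed : Closed U y
  suffix : z <:+ y
  isInfix : z <:+: U
  occ : ∀ P, P <+: U → z <:+ P → y <:+ P

theorem suffix_cases {z P : List β} (h : z <:+ P) : z = P ∨ ∃ a, a :: z <:+ P := by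
  obtain ⟨s, rfl⟩ := h
  rcases List.eq_nil_or_concat s with rfl | ⟨s', a, rfl⟩
  · exact .inl rfl
  · exact .inr ⟨a, s', by simp⟩

theorem suffix_or_lt {x y P : List β} (hx : x <:+ P) (hy : y <:+ P) :
    y <:+ x ∨ ∃ a, a :: x <:+ y := by
  rcases List.suffix_or_suffix_of_suffix hx hy with h | h
  · rcases suffix_cases h with rfl | h
    · exact .inl (List.suffix_refl _)
    · exact .inr h
  · exact .inl h

theorem Closed.isCl {U z : List β} (h : Closed U z) : IsCl U z z :=
  ⟨h, List.suffix_refl _, h.isInfix, fun _ _ h => h⟩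

/-- If `z` is not closed, then each of its occurrences has a left neighbour, always the same letter,
and prepending it keeps the occurrences. This stops because factors are no longer than `U`. -/
theorem exists_isCl {U z : List β} (h : z <:+: U) : ∃ y, IsCl U z y := by
  by_cases hz : Closed U z
  · exact ⟨z, hz.isCl⟩
  · have hnp : ∀ P, P <+: U → z <:+ P → ∃ a, a :: z <:+ P := by
      intro P hP hzP
      rcases suffix_cases hzP with rfl | h
      · exact absurd (.inl hP) hz
      · exact h
    obtain ⟨P, hP, hzP⟩ := infix_iff_exists_prefix.1 h
    obtain ⟨a, ha⟩ := hnp P hP hzP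
    have haU : a :: z <:+: U := infix_iff_exists_prefix.2 ⟨P, hP, ha⟩
    have := haU.length_le
    obtain ⟨y, hy⟩ := exists_isCl haU
    refine ⟨y, hy.closed, (List.suffix_cons a z).trans hy.suffix, h, fun P' hP' hz' => ?_⟩
    obtain ⟨b, hb⟩ := hnp P' hP' hz'
    have hbU : b :: z <:+: U := infix_iff_exists_prefix.2 ⟨P', hP', hb⟩
    by_cases hab : a = b
    · subst hab; exact hy.occ P' hP' hb
    · exact absurd (.inr ⟨a, b, hab, haU, hbU⟩) hz
termination_by U.length - z.length
decreasing_by simp at *; omega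

/-- A letter that precedes all occurrences of `x` contradicts both ways of being closed: a prefix
has an occurrence with nothing before it, and otherwise two different letters precede `x`. -/
theorem Closed.eq_of_occ {U x y : List β} (h : Closed U x) (hxy : x <:+ y)
    (hocc : ∀ P, P <+: U → x <:+ P → y <:+ P) : y = x := by
  rcases suffix_cases hxy with h' | ⟨d, hd⟩
  · exact h'.symm
  · rcases h with h | ⟨a, b, hab, ha, hb⟩
    · exact (List.IsSuffix.eq_of_length_le (hocc x h (List.suffix_refl _))
        hxy.length_le)
    · have key : ∀ c : β, c :: x <:+: U → c = d := by
        intro c hc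
        obtain ⟨P, hP, hcP⟩ := infix_iff_exists_prefix.1 hc
        have h1 := hd.trans (hocc P hP ((List.suffix_cons c x).trans hcP))
        have h2 := List.suffix_of_suffix_length_le hcP h1 (by simp)
        have := h2.eq_of_length (by simp)
        simpa using this
      exact absurd ((key a ha).trans (key b hb).symm) hab

theorem IsCl.mid {U z z' y : List β} (h : IsCl U z y) (h1 : z <:+ z') (h2 : z' <:+ y) :
    IsCl U z' y :=
  ⟨h.closed, h2, h2.isInfix.trans h.closed.isInfix, fun P hP hz => h.occ P hP (h1.trans hz)⟩

/-- At a common occurrence `x` and `y` are comparable, and a closed `x` between `z` and `y` has the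
same occurrences as `y`. So the closure is the least closed word that ends with `z`. -/
theorem IsCl.le_closed {U z y x : List β} (h : IsCl U z y) (hx : Closed U x) (hzx : z <:+ x) :
    y <:+ x := by
  obtain ⟨P, hP, hxP⟩ := infix_iff_exists_prefix.1 hx.isInfix
  rcases List.suffix_or_suffix_of_suffix hxP (h.occ P hP (hzx.trans hxP)) with h1 | h1
  · rw [hx.eq_of_occ h1 (h.mid hzx h1).occ]
  · exact h1

theorem IsCl.unique {U z y y' : List β} (h : IsCl U z y) (h' : IsCl U z y') : y = y' :=
  List.IsSuffix.eq_of_length_le (h.le_closed h'.closed h'.suffix)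
    (h'.le_closed h.closed h.suffix).length_le

/-- Words with the same occurrences have the same closure. -/
theorem IsCl.congr {U z z' y : List β} (h : IsCl U z y)
    (hzz : ∀ P, P <+: U → (z <:+ P ↔ z' <:+ P)) : IsCl U z' y := by
  obtain ⟨P, hP, hzP⟩ := infix_iff_exists_prefix.1 h.isInfix
  have hz' : z' <:+: U := infix_iff_exists_prefix.2 ⟨P, hP, (hzz P hP).1 hzP⟩
  obtain ⟨y', hy'⟩ := exists_isCl hz'
  have h1 : y' <:+ P := hy'.occ P hP ((hzz P hP).1 hzP)
  have h2 : y <:+ P := h.occ P hP hzP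
  have : y = y' := by
    rcases List.suffix_or_suffix_of_suffix h1 h2 with h3 | h3
    · exact hy'.closed.eq_of_occ h3 (fun Q hQ hQ' =>
        h.occ Q hQ ((hzz Q hQ).2 (hy'.suffix.trans hQ')))
    · exact (h.closed.eq_of_occ h3 (fun Q hQ hQ' =>
        hy'.occ Q hQ ((hzz Q hQ).1 (h.suffix.trans hQ')))).symm
  rw [this]; exact hy'

/-- `y` is the longest suffix of `U c` that occurs in `U`. -/
structure IsRep (U : List β) (c : β) (y : List β) : Prop where
  suffix : y <:+ U ++ [c]
  isInfix : y <:+: U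
  max : ∀ z, z <:+ U ++ [c] → z <:+: U → z <:+ y

theorem exists_isRep (U : List β) (c : β) : ∃ y, IsRep U c y := by
  have key : ∀ W : List β, W <:+ U ++ [c] → ∃ y, y <:+ U ++ [c] ∧ y <:+: U ∧
      ∀ z, z <:+ W → z <:+: U → z <:+ y := by
    intro W
    induction W with
    | nil => exact fun _ => ⟨[], List.nil_suffix, List.nil_infix, fun z hz _ => hz⟩
    | cons a W ih =>
      intro hW
      by_cases h : a :: W <:+: U
      · exact ⟨_, hW, h, fun z hz _ => hz⟩
      · obtain ⟨y, h1, h2, h3⟩ := ih ((List.suffix_cons a W).trans hW)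
        refine ⟨y, h1, h2, fun z hz hzU => ?_⟩
        rcases List.suffix_cons_iff.1 hz with rfl | hz
        · exact absurd hzU h
        · exact h3 z hz hzU
  obtain ⟨y, h1, h2, h3⟩ := key _ (List.suffix_refl _)
  exact ⟨y, h1, h2, h3⟩

variable {U y : List β} {c : β}

theorem not_isInfix_self_concat (U : List β) (c : β) : ¬ U ++ [c] <:+: U := fun h => by
  simpa using h.length_le

theorem IsRep.ne (h : IsRep U c y) : y ≠ U ++ [c] := fun h' =>
  not_isInfix_self_concat U c (h' ▸ h.isInfix)

theorem isInfix_concat_of (c : β) {z : List β} (h : z <:+: U) : z <:+: U ++ [c] :=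
  h.trans (List.prefix_append U [c]).isInfix

theorem Closed.concat {x : List β} (h : Closed U x) (c : β) : Closed (U ++ [c]) x := by
  rcases h with h | ⟨a, b, hab, h1, h2⟩
  · exact .inl (h.trans (List.prefix_append U [c]))
  · exact .inr ⟨a, b, hab, isInfix_concat_of c h1, isInfix_concat_of c h2⟩

theorem closed_self (U : List β) : Closed U U := .inl (List.prefix_refl U)

/-- The occurrence at the end of `Uc` is preceded by a letter `a`, and `ay` does not occur in `U` by
maximality. So an occurrence inside `U` is a prefix or has a different letter before it. -/
theorem IsRep.closed (h : IsRep U c y) : Closed (U ++ [c]) y := by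
  rcases suffix_cases h.suffix with h' | ⟨a, ha⟩
  · exact absurd h' h.ne
  · have haU : ¬ a :: y <:+: U := fun h' => by
      have := (h.max _ ha h').length_le; simp at this
    obtain ⟨P, hP, hyP⟩ := infix_iff_exists_prefix.1 h.isInfix
    rcases suffix_cases hyP with rfl | ⟨b, hb⟩
    · exact .inl (hP.trans (List.prefix_append U [c]))
    · have hbU : b :: y <:+: U := infix_iff_exists_prefix.2 ⟨P, hP, hb⟩
      refine .inr ⟨a, b, ?_, ha.isInfix, isInfix_concat_of c hbU⟩
      rintro rfl
      exact haU hbU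

/-- If `x` becomes left-branching only now, then some `ax` is new, hence a suffix of `Uc`, while
some `bx` is old. Then `x` is a suffix of `y` and `ax` is not, which leaves only `x = y`. -/
theorem closed_concat_iff (h : IsRep U c y) {x : List β} :
    Closed (U ++ [c]) x ↔ Closed U x ∨ x = U ++ [c] ∨ x = y := by
  refine ⟨fun hx => ?_, ?_⟩
  · rcases hx with hx | ⟨a, b, hab, ha, hb⟩
    · rcases List.prefix_concat_iff.1 hx with rfl | hx
      · exact .inr (.inl rfl)
      · exact .inl (.inl hx)
    · have key : ∀ a b : β, a ≠ b → a :: x <:+ U ++ [c] → ¬ a :: x <:+: U → b :: x <:+: U →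
          x = y := by
        intro a b hab ha ha' hb
        have hxy : x <:+ y := h.max x ((List.suffix_cons a x).trans ha)
          ((List.infix_cons (List.infix_refl x)).trans hb)
        rcases suffix_or_lt ha h.suffix with h1 | ⟨d, h1⟩
        · rcases List.suffix_cons_iff.1 h1 with h2 | h2
          · exact absurd (h2 ▸ h.isInfix) ha'
          · exact hxy.eq_of_length_le h2.length_le
        · exact absurd (((List.suffix_cons d _).trans h1).isInfix.trans h.isInfix) ha'
      by_cases haU : a :: x <:+: U <;> by_cases hbU : b :: x <:+: U
      · exact .inl (.inr ⟨a, b, hab, haU, hbU⟩)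
      · have := (List.infix_concat_iff.1 hb).resolve_right hbU
        exact .inr (.inr (key b a hab.symm this hbU haU))
      · have := (List.infix_concat_iff.1 ha).resolve_right haU
        exact .inr (.inr (key a b hab this haU hbU))
      · have h1 := (List.infix_concat_iff.1 hb).resolve_right hbU
        have h2 := (List.infix_concat_iff.1 ha).resolve_right haU
        have h3 := (List.suffix_of_suffix_length_le h1 h2 (by simp)).eq_of_length (by simp)
        simp only [List.cons.injEq] at h3
        exact absurd h3.1.symm hab
  · rintro (hx | rfl | rfl)
    · exact hx.concat c
    · exact closed_self _
    · exact h.closed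

/-- The only new occurrence is at the end of `Uc`, and a factor of `U` that ends there is a suffix
of `y`. This and the next three lemmas determine all closures in `Uc`; only the class of `q` can be
split. -/
theorem IsCl.concat_of_not_suffix (h : IsRep U c y) {z w : List β} (hz : IsCl U z w)
    (hzy : ¬ z <:+ y) : IsCl (U ++ [c]) z w := by
  refine ⟨hz.closed.concat c, hz.suffix, isInfix_concat_of c hz.isInfix, fun P hP hzP => ?_⟩
  rcases List.prefix_concat_iff.1 hP with rfl | hP
  · exact absurd (h.max z hzP hz.isInfix) hzy
  · exact hz.occ P hP hzP

/-- If `z` is a suffix of `y`, then its closure is one too: a longer closure would lie between `y`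
and `q`, and would therefore be `q`. -/
theorem IsCl.concat_of_ne (h : IsRep U c y) {z w q : List β} (hq : IsCl U y q) (hz : IsCl U z w)
    (hwq : w ≠ q) : IsCl (U ++ [c]) z w := by
  by_cases hzy : z <:+ y
  · refine ⟨hz.closed.concat c, hz.suffix, isInfix_concat_of c hz.isInfix, fun P hP hzP => ?_⟩
    rcases List.prefix_concat_iff.1 hP with rfl | hP
    · have h1 : w <:+ q := hz.le_closed hq.closed (hzy.trans hq.suffix)
      rcases List.suffix_or_suffix_of_suffix h1 hq.suffix with h2 | h2
      · exact h2.trans h.suffix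
      · exact absurd (hz.closed.isCl.unique
          ((hz.closed.isCl).mid (List.suffix_refl _) (List.suffix_refl _)) |>.trans
            ((hz.mid hzy h2).unique hq)) hwq
    · exact hz.occ P hP hzP
  · exact hz.concat_of_not_suffix h hzy

theorem IsCl.concat_of_eq (h : IsRep U c y) {z q : List β} (hq : IsCl U y q) (hz : IsCl U z q)
    (hzy : z <:+ y) : IsCl (U ++ [c]) z y := by
  refine ⟨h.closed, hzy, isInfix_concat_of c hz.isInfix, fun P hP hzP => ?_⟩
  rcases List.prefix_concat_iff.1 hP with rfl | hP
  · exact h.suffix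
  · exact hq.suffix.trans (hz.occ P hP hzP)

theorem isCl_concat_self {z : List β} (hz : z <:+ U ++ [c]) (hzU : ¬ z <:+: U) :
    IsCl (U ++ [c]) z (U ++ [c]) := by
  refine ⟨closed_self _, hz, hz.isInfix, fun P hP hzP => ?_⟩
  rcases List.prefix_concat_iff.1 hP with rfl | hP
  · exact List.suffix_refl _
  · exact absurd (infix_iff_exists_prefix.2 ⟨P, hP, hzP⟩) hzU

theorem concat_suffix_concat {z w : List β} {a b : β} :
    z ++ [a] <:+ w ++ [b] ↔ a = b ∧ z <:+ w := by
  rw [List.suffix_concat_iff]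
  constructor
  · rintro (h | ⟨t, h, h2⟩)
    · simp at h
    · simp only [List.append_singleton_inj] at h
      exact ⟨h.2, h.1 ▸ h2⟩
  · rintro ⟨rfl, h⟩
    exact .inr ⟨z, rfl, h⟩

/-- In `U c`, the extensions of a word to the right have the same occurrences as those of its
closure in `U`. -/
theorem IsCl.occ_concat {z q : List β} (h : IsCl U z q) (c' : β) {P : List β}
    (hP : P <+: U ++ [c]) : z ++ [c'] <:+ P ↔ q ++ [c'] <:+ P := by
  constructor
  · intro hz
    rcases List.eq_nil_or_concat' P with rfl | ⟨P', a, rfl⟩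
    · simp at hz
    · obtain ⟨rfl, hz'⟩ := concat_suffix_concat.1 hz
      refine concat_suffix_concat.2 ⟨rfl, h.occ P' ?_ hz'⟩
      rcases List.prefix_concat_iff.1 hP with h1 | h1
      · rw [List.append_singleton_inj.1 h1 |>.1]
      · exact (List.prefix_append P' [c']).trans h1
  · intro hq
    exact (concat_suffix_concat.2 ⟨rfl, h.suffix⟩).trans hq

theorem IsCl.concat_isInfix_iff {z q : List β} (h : IsCl U z q) (c' : β) :
    z ++ [c'] <:+: U ++ [c] ↔ q ++ [c'] <:+: U ++ [c] := by
  simp only [infix_iff_exists_prefix]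
  exact exists_congr fun P => and_congr_right fun hP => h.occ_concat c' hP

theorem IsCl.isCl_concat_iff {z q w : List β} (h : IsCl U z q) (c' : β) :
    IsCl (U ++ [c]) (z ++ [c']) w ↔ IsCl (U ++ [c]) (q ++ [c']) w :=
  ⟨fun h' => h'.congr fun _ hP => h.occ_concat c' hP,
    fun h' => h'.congr fun _ hP => (h.occ_concat c' hP).symm⟩

/-- `l` is the longest proper suffix of `x` that is closed. -/
structure IsLink (U x l : List β) : Prop where
  closed : Closed U l
  suffix : l <:+ x
  ne : l ≠ x
  max : ∀ z, Closed U z → z <:+ x → z ≠ x → z <:+ l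

theorem exists_isLink (U : List β) {x : List β} (hx : x ≠ []) : ∃ l, IsLink U x l := by
  induction x with
  | nil => exact absurd rfl hx
  | cons a x ih =>
    by_cases h : Closed U x
    · refine ⟨x, h, List.suffix_cons a x, by simp, fun z _ hz hne => ?_⟩
      exact (List.suffix_cons_iff.1 hz).resolve_left hne
    · have hx : x ≠ [] := fun h' => h (h' ▸ Closed.nil U)
      obtain ⟨l, h1, h2, h3, h4⟩ := ih hx
      refine ⟨l, h1, h2.trans (List.suffix_cons a x), ?_, fun z hz hzx hne => ?_⟩
      · intro h'; have := h2.length_le; rw [h'] at this; simp at this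
      · have hzx := (List.suffix_cons_iff.1 hzx).resolve_left hne
        exact h4 z hz hzx (fun h' => h (h' ▸ hz))

theorem IsLink.unique {x l l' : List β} (h : IsLink U x l) (h' : IsLink U x l') : l = l' :=
  List.IsSuffix.eq_of_length_le (h'.max l h.closed h.suffix h.ne)
    (h.max l' h'.closed h'.suffix h'.ne).length_le

theorem IsRep.isLink_self (h : IsRep U c y) : IsLink (U ++ [c]) (U ++ [c]) y := by
  refine ⟨h.closed, h.suffix, h.ne, fun z hz hzU hne => ?_⟩
  rcases (closed_concat_iff h).1 hz with hz | hz | hz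
  · exact h.max z hzU hz.isInfix
  · exact absurd hz hne
  · rw [hz]

/-- Among the new closed words only `y` can be a suffix of an old one, and it intervenes only
between `q` and the old link of `q`: any other closed word ending with `y` also ends with `q`. -/
theorem IsLink.concat (h : IsRep U c y) {q x l : List β} (hq : IsCl U y q) (hx : Closed U x)
    (hl : IsLink U x l) (hxq : x ≠ q ∨ y = q) : IsLink (U ++ [c]) x l := by
  refine ⟨hl.closed.concat c, hl.suffix, hl.ne, fun z hz hzx hne => ?_⟩
  rcases (closed_concat_iff h).1 hz with hz | hz | hz
  · exact hl.max z hz hzx hne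
  · exact absurd (hz ▸ hzx.isInfix.trans hx.isInfix) (not_isInfix_self_concat U c)
  · subst hz
    rcases hxq with hxq | rfl
    · have h1 := hq.le_closed hx hzx
      exact hq.suffix.trans (hl.max q hq.closed h1 hxq.symm)
    · exact hl.max z hq.closed hzx hne

theorem IsLink.concat_cl (h : IsRep U c y) {q : List β} (hq : IsCl U y q) (hyq : y ≠ q) :
    IsLink (U ++ [c]) q y := by
  refine ⟨h.closed, hq.suffix, hyq, fun z hz hzq hne => ?_⟩
  rcases (closed_concat_iff h).1 hz with hz | hz | hz
  · rcases List.suffix_or_suffix_of_suffix hzq hq.suffix with h1 | h1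
    · exact h1
    · exact absurd (hzq.eq_of_length_le (hq.le_closed hz h1).length_le) hne
  · exact absurd (hz ▸ hzq.isInfix.trans hq.closed.isInfix) (not_isInfix_self_concat U c)
  · rw [hz]

/-- No old closed word lies between `y` and `q`, so the clone takes over the old link of `q`. -/
theorem IsLink.concat_rep (h : IsRep U c y) {q l : List β} (hq : IsCl U y q) (hyq : y ≠ q)
    (hl : IsLink U q l) : IsLink (U ++ [c]) y l := by
  have hyU : ¬ Closed U y := fun hy => hyq (hy.isCl.unique hq)
  have h1 : l <:+ y := by
    rcases List.suffix_or_suffix_of_suffix hl.suffix hq.suffix with h1 | h1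
    · exact h1
    · exact absurd (hl.suffix.eq_of_length_le (hq.le_closed hl.closed h1).length_le) hl.ne
  refine ⟨hl.closed.concat c, h1, fun h' => hyU (h' ▸ hl.closed), fun z hz hzy hne => ?_⟩
  rcases (closed_concat_iff h).1 hz with hz | hz | hz
  · refine hl.max z hz (hzy.trans hq.suffix) (fun h' => hyq ?_)
    exact hq.suffix.eq_of_length_le (h' ▸ hzy.length_le)
  · exact absurd (hz ▸ hzy.isInfix.trans h.isInfix) (not_isInfix_self_concat U c)
  · exact absurd hz hne

/-- If the repeat `y` is nonempty, then it extends a closed suffix of `U`. -/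
theorem IsRep.closed_init {y' : List β} (h : IsRep U c (y' ++ [c])) : y' <:+ U ∧ Closed U y' := by
  have hs := (concat_suffix_concat.1 h.suffix).2
  refine ⟨hs, ?_⟩
  rcases suffix_cases hs with rfl | ⟨a, ha⟩
  · exact closed_self _
  · have hac : ¬ a :: (y' ++ [c]) <:+: U := fun h' => by
      have h1 : a :: (y' ++ [c]) <:+ U ++ [c] := by
        have := (concat_suffix_concat (a := c) (b := c)).2 ⟨rfl, ha⟩
        simpa using this
      have := (h.max _ h1 h').length_le
      simp at this
    obtain ⟨P, hP, hyP⟩ := infix_iff_exists_prefix.1 h.isInfix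
    rcases suffix_cases hyP with rfl | ⟨b, hb⟩
    · exact .inl ((List.prefix_append _ _).trans hP)
    · refine .inr ⟨a, b, ?_, ha.isInfix, ?_⟩
      · rintro rfl
        exact hac (infix_iff_exists_prefix.2 ⟨P, hP, hb⟩)
      · refine List.IsInfix.trans ?_ (infix_iff_exists_prefix.2 ⟨P, hP, hb⟩)
        exact List.IsPrefix.isInfix ⟨[c], by simp⟩

theorem IsRep.eq_nil_or {y : List β} (h : IsRep U c y) : y = [] ∨ ∃ y', y = y' ++ [c] := by
  rcases List.suffix_concat_iff.1 h.suffix with h | ⟨t, h, -⟩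
  · exact .inl h
  · exact .inr ⟨t, h⟩

/-! ### Numbers of states, edges and closed suffixes -/

section Counting

/-- The number of closed suffixes of `x`. -/
noncomputable def closedSuffixes (U x : List β) : ℕ := {z | z <:+ x ∧ Closed U z}.ncard

theorem finite_suffixes (x : List β) : {z | z <:+ x}.Finite :=
  (List.finite_toSet x.tails).subset fun z hz => by simpa using hz

theorem finite_closed_suffixes (U x : List β) : {z | z <:+ x ∧ Closed U z}.Finite :=
  (finite_suffixes x).subset fun _ hz => hz.1

theorem closedSuffixes_nil (U : List β) : closedSuffixes U [] = 1 := by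
  have : {z | z <:+ [] ∧ Closed U z} = {[]} := by
    ext z; simp only [List.suffix_nil, Set.mem_ofPred_eq, Set.mem_singleton_iff]
    exact ⟨fun h => h.1, fun h => ⟨h, h ▸ Closed.nil U⟩⟩
  rw [closedSuffixes, this, Set.ncard_singleton]

/-- The source of the amortization. With `S` the part of the link chain of `U` that a walk has not
left behind, dropping the last letter maps the closed suffixes of `Uc`, up to three exceptions, into
`S`. -/
theorem closedSuffixes_concat_le (y : List β) (S : Set (List β)) (hS : S.Finite)
    (h : ∀ z, Closed (U ++ [c]) z → z <:+ U ++ [c] → z ≠ [] → z ≠ U ++ [c] → z ≠ y →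
      ∃ x ∈ S, z = x ++ [c]) :
    closedSuffixes (U ++ [c]) (U ++ [c]) ≤ S.ncard + 3 := by
  have hsub : {z | z <:+ U ++ [c] ∧ Closed (U ++ [c]) z} ⊆
      insert [] (insert (U ++ [c]) (insert y ((· ++ [c]) '' S))) := by
    rintro z ⟨h1, h2⟩
    simp only [Set.mem_insert_iff, Set.mem_image]
    by_contra! hcon
    obtain ⟨h3, h4, h5, h6⟩ := hcon
    obtain ⟨x, hx, rfl⟩ := h z h2 h1 h3 h4 h5
    exact h6 x hx rfl
  have hfin := hS.image (· ++ [c])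
  refine (Set.ncard_le_ncard hsub (by simp [hfin])).trans ?_
  have h1 := Set.ncard_image_le hS (f := (· ++ [c]))
  have h2 := Set.ncard_insert_le y ((· ++ [c]) '' S)
  have h3 := Set.ncard_insert_le (U ++ [c]) (insert y ((· ++ [c]) '' S))
  have h4 := Set.ncard_insert_le [] (insert (U ++ [c]) (insert y ((· ++ [c]) '' S)))
  omega

theorem closed_finite_ncard (U : List β) :
    {x | Closed U x}.Finite ∧ {x | Closed U x}.ncard ≤ 2 * U.length + 1 := by
  induction U using List.reverseRecOn with
  | nil =>
    have : {x : List β | Closed [] x} = {[]} := by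
      ext x
      simp only [Set.mem_ofPred_eq, Set.mem_singleton_iff]
      exact ⟨fun h => by simpa using h.isInfix, by rintro rfl; exact Closed.nil _⟩
    simp [this]
  | append_singleton U c ih =>
    obtain ⟨y, hy⟩ := exists_isRep U c
    have : {x | Closed (U ++ [c]) x} = insert (U ++ [c]) (insert y {x | Closed U x}) := by
      ext x
      simp only [Set.mem_ofPred_eq, Set.mem_insert_iff, closed_concat_iff hy]
      tauto
    rw [this]
    refine ⟨(ih.1.insert y).insert _, ?_⟩
    have h1 := Set.ncard_insert_le y {x | Closed U x}
    have h2 := Set.ncard_insert_le (U ++ [c]) (insert y {x | Closed U x})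
    have h3 := ih.2
    simp only [List.length_append, List.length_singleton]
    omega

/-- The words that label edges of the automaton. -/
def edges (U : List β) : Set (List β) := {z | ∃ x c, z = x ++ [c] ∧ Closed U x ∧ z <:+: U}

/-- An edge word that is not closed is determined by the start of one of its occurrences: of two
such words with the same start, the shorter would be a prefix of the closed source of the longer,
hence closed. So at most `U.length` edge words are not closed, and the others are counted as closed
words. -/
theorem edges_finite_ncard (U : List β) :
    (edges U).Finite ∧ (edges U).ncard ≤ 3 * U.length + 1 := by
  classical
  have hstart : ∀ z ∈ edges U, ∃ i, i < U.length ∧ z <+: U.drop i := by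
    rintro z ⟨x, c, rfl, -, h⟩
    obtain ⟨s, t, h⟩ := h
    have hl := congrArg List.length h
    simp only [List.length_append, List.length_singleton] at hl
    refine ⟨s.length, by omega, t, ?_⟩
    rw [← h, List.append_assoc s, List.drop_left, List.append_assoc]
  choose! f hf using hstart
  have hinj : Set.InjOn f (edges U \ {x | Closed U x}) := by
    have key : ∀ z z', z ∈ edges U → z' ∈ edges U → ¬ Closed U z → f z = f z' →
        z.length ≤ z'.length → z = z' := by
      intro z z' hz hz' hc hff hlen
      have h1 := (hf z hz).2
      have h2 := (hf z' hz').2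
      rw [hff] at h1
      have h3 := List.prefix_of_prefix_length_le h1 h2 hlen
      obtain ⟨x, c, rfl, hx, -⟩ := hz'
      rcases List.prefix_concat_iff.1 h3 with h4 | h4
      · exact h4
      · exact absurd (hx.of_prefix h4) hc
    rintro z ⟨hz, hzc⟩ z' ⟨hz', hzc'⟩ hff
    rcases le_total z.length z'.length with h | h
    · exact key z z' hz hz' hzc hff h
    · exact (key z' z hz' hz hzc' hff.symm h).symm
  have hmaps : Set.MapsTo f (edges U \ {x | Closed U x}) (Finset.range U.length : Set ℕ) := by
    rintro z ⟨hz, -⟩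
    simpa using (hf z hz).1
  have hfin1 : (edges U \ {x | Closed U x}).Finite :=
    Set.Finite.of_injOn hmaps hinj (Finset.finite_toSet _)
  have hcard1 : (edges U \ {x | Closed U x}).ncard ≤ U.length := by
    have := Set.ncard_le_ncard_of_injOn f hmaps hinj (Finset.finite_toSet _)
    simpa [Set.ncard_coe_finset] using this
  obtain ⟨hfin2, hcard2⟩ := closed_finite_ncard U
  have hsub : edges U ⊆ (edges U \ {x | Closed U x}) ∪ {x | Closed U x} := by
    intro z hz; by_cases h : Closed U z
    · exact .inr h
    · exact .inl ⟨hz, h⟩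
  refine ⟨(hfin1.union hfin2).subset hsub, ?_⟩
  have h1 := Set.ncard_le_ncard hsub (hfin1.union hfin2)
  have h2 := Set.ncard_union_le (edges U \ {x | Closed U x}) {x | Closed U x}
  omega

end Counting

end SuffixAutomaton

/-! ### Dictionaries: digital search trees with a common pool of nodes -/

section Dictionary

/-- The list of the nodes that are linked from `a` on. -/
def LChain (NX : ℕ → ℕ) : ℕ → List ℕ → Prop
  | a, [] => a = 0
  | a, x :: l => a = x ∧ x ≠ 0 ∧ LChain NX (NX x) l

theorem LChain.congr {NX NX' : ℕ → ℕ} {l : List ℕ} : ∀ {a : ℕ}, LChain NX a l →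
    (∀ x ∈ l, NX' x = NX x) → LChain NX' a l := by
  induction l with
  | nil => exact fun h _ => h
  | cons x l ih =>
    rintro a ⟨h1, h2, h3⟩ h
    refine ⟨h1, h2, ?_⟩
    rw [h x (by simp)]
    exact ih h3 fun y hy => h y (by simp [hy])

/-- The child of `t` for the low bit of `r`. -/
def child (LC RC : ℕ → ℕ) (t r : ℕ) : ℕ := if r % 2 = 0 then LC t else RC t

/-- The node at depth `d` on the path of the key `c` in the tree of `v`. -/
def walk (LC RC : ℕ → ℕ) (v c : ℕ) : ℕ → ℕ
  | 0 => v
  | d + 1 => child LC RC (walk LC RC v c d) (c / 2 ^ d)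

/-- The trees rooted at the elements of `S`, all nodes being below `al`. The node of `v` with key
`c` is `ent v c` (`0` if there is none). -/
structure DictE (LC RC KEY SB LH : ℕ → ℕ) (al B : ℕ) (S : Set ℕ) (ent : ℕ → ℕ → ℕ)
    (dep : ℕ → ℕ) : Prop where
  zero : ∀ t, t = 0 ∨ al ≤ t → LC t = 0 ∧ RC t = 0
  LH_zero : ∀ t, al ≤ t → LH t = 0
  mem_lt : ∀ v ∈ S, 0 < v ∧ v < al
  al_pos : 0 < al
  ent_spec : ∀ v c, ent v c ≠ 0 → v ∈ S ∧ ent v c < al ∧ ent v c ∉ S ∧ KEY (ent v c) = c ∧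
    c < 2 ^ B ∧ ∃ d, walk LC RC v c (d + 1) = ent v c
  walk_spec : ∀ v ∈ S, ∀ c d u, u = walk LC RC v c (d + 1) → u ≠ 0 →
    ent v (KEY u) = u ∧ KEY u % 2 ^ (d + 1) = c % 2 ^ (d + 1) ∧ dep u = d + 1
  inj : ∀ v c v' c', ent v c ≠ 0 → ent v c = ent v' c' → v = v'
  list : ∀ v ∈ S, ∃ l, LChain SB (LH v) l ∧ l.Nodup ∧ ∀ u, u ∈ l ↔ u ≠ 0 ∧ ∃ c, ent v c = u
  cover : ∀ u, 0 < u → u < al → u ∈ S ∨ ∃ v c, ent v c = u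

/-- A free slot for the key `c` in the tree of `v`. -/
def Slot (LC RC : ℕ → ℕ) (v c t r : ℕ) : Prop :=
  ∃ d, walk LC RC v c d = t ∧ r = c / 2 ^ d ∧ walk LC RC v c (d + 1) = 0 ∧ t ≠ 0

def upd (tr : ℕ → ℕ → ℕ) (v c w : ℕ) (v' c' : ℕ) : ℕ := if v' = v ∧ c' = c then w else tr v' c'

/-- The dictionaries store the partial function `tr`, where `0` means undefined. -/
def Dict (LC RC KEY TG SB LH : ℕ → ℕ) (al B : ℕ) (S : Set ℕ) (tr : ℕ → ℕ → ℕ) : Prop :=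
  ∃ ent dep, DictE LC RC KEY SB LH al B S ent dep ∧
    ∀ v c, (ent v c = 0 → tr v c = 0) ∧ (ent v c ≠ 0 → TG (ent v c) = tr v c ∧ tr v c ≠ 0)

section Pure

variable {LC RC KEY TG SB LH : ℕ → ℕ} {al B : ℕ} {S : Set ℕ} {ent : ℕ → ℕ → ℕ} {dep : ℕ → ℕ}
  {tr : ℕ → ℕ → ℕ}

theorem DictE.child_zero (h : DictE LC RC KEY SB LH al B S ent dep) {t : ℕ} (ht : t = 0 ∨ al ≤ t)
    (r : ℕ) : child LC RC t r = 0 := by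
  simp [child, h.zero t ht]

theorem DictE.walk_zero (h : DictE LC RC KEY SB LH al B S ent dep) {v c d d' : ℕ}
    (h0 : walk LC RC v c d = 0) (hd : d ≤ d') : walk LC RC v c d' = 0 := by
  induction d', hd using Nat.le_induction with
  | base => exact h0
  | succ d' _ ih => rw [walk, ih]; exact h.child_zero (.inl rfl) _

theorem DictE.walk_lt (h : DictE LC RC KEY SB LH al B S ent dep) {v c : ℕ} (hv : v ∈ S) (d : ℕ) :
    walk LC RC v c d < al := by
  cases d with
  | zero => exact (h.mem_lt v hv).2
  | succ d =>
    by_cases h0 : walk LC RC v c (d + 1) = 0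
    · rw [h0]; exact h.al_pos
    · have h1 := (h.walk_spec v hv c d _ rfl h0).1
      have := (h.ent_spec v _ (h1.trans_ne h0)).2.1
      rwa [h1] at this

theorem DictE.not_mem_of_walk (h : DictE LC RC KEY SB LH al B S ent dep) {v c d : ℕ} (hv : v ∈ S)
    (h0 : walk LC RC v c (d + 1) ≠ 0) : walk LC RC v c (d + 1) ∉ S := by
  have h1 := (h.walk_spec v hv c d _ rfl h0).1
  have := (h.ent_spec v _ (h1.trans_ne h0)).2.2.1
  rwa [h1] at this

theorem child_update (t r al t' r' : ℕ) :
    child (if r % 2 = 0 then Function.update LC t al else LC)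
      (if r % 2 = 0 then RC else Function.update RC t al) t' r' =
      if t' = t ∧ r' % 2 = r % 2 then al else child LC RC t' r' := by
  rcases Nat.mod_two_eq_zero_or_one r with hr | hr <;>
  rcases Nat.mod_two_eq_zero_or_one r' with hr' | hr' <;>
  simp [child, hr, hr', Function.update_apply]

/-- A walk changes only if it passes the slot. A node determines its tree (`inj`), its depth (`dep`)
and the low bits of the keys that pass through it; so such a walk starts at `v`, and its key agrees
with `c` in `d + 1` bits. It visits `al` and then leaves the tree. -/
theorem DictE.walk_insert (h : DictE LC RC KEY SB LH al B S ent dep) {v c d t r : ℕ} (hv : v ∈ S)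
    (ht : walk LC RC v c d = t) (hr : r = c / 2 ^ d) (h0 : walk LC RC v c (d + 1) = 0)
    (ht0 : t ≠ 0) (LC' RC' : ℕ → ℕ) (hch : ∀ t' r', child LC' RC' t' r' =
      if t' = t ∧ r' % 2 = r % 2 then al else child LC RC t' r') (v' : ℕ) (hv' : v' ∈ S) (c' : ℕ) :
    ∀ d', walk LC' RC' v' c' d' = walk LC RC v' c' d' ∨
      (v' = v ∧ d + 1 ≤ d' ∧ c' % 2 ^ (d + 1) = c % 2 ^ (d + 1) ∧ walk LC RC v' c' d' = 0 ∧
        walk LC' RC' v' c' d' = if d' = d + 1 then al else 0) := by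
  have htal : t < al := ht ▸ h.walk_lt hv d
  intro d'
  induction d' with
  | zero => exact .inl rfl
  | succ d' ih =>
    rcases ih with ih | ⟨h1, h2, h3, h4, h5⟩
    · by_cases hc : walk LC RC v' c' d' = t ∧ c' / 2 ^ d' % 2 = r % 2
      · right
        obtain ⟨hx, hb⟩ := hc
        -- Roots are not edge nodes, so `t` is the root in both walks or in neither.
        have key : v' = v ∧ d' = d ∧ c' % 2 ^ d = c % 2 ^ d := by
          rcases d' with _ | d' <;> rcases d with _ | d
          · exact ⟨hx.trans ht.symm, rfl, by simp [Nat.mod_one]⟩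
          · exact absurd (hx ▸ hv' : t ∈ S) (ht ▸ h.not_mem_of_walk hv (ht ▸ ht0))
          · rw [walk] at ht
            exact absurd (ht ▸ hv : t ∈ S) (hx ▸ h.not_mem_of_walk hv' (hx ▸ ht0))
          · have g1 := h.walk_spec v hv c d t ht.symm ht0
            have g2 := h.walk_spec v' hv' c' d' t hx.symm ht0
            have g3 : d' = d := by have := g1.2.2.symm.trans g2.2.2; omega
            subst g3
            refine ⟨(h.inj v _ v' _ (g1.1.trans_ne ht0) (g1.1.trans g2.1.symm)).symm, rfl, ?_⟩
            exact g2.2.1.symm.trans g1.2.1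
        obtain ⟨rfl, rfl, hm⟩ := key
        have hmod : c' % 2 ^ (d' + 1) = c % 2 ^ (d' + 1) := by
          rw [Nat.mod_pow_succ, Nat.mod_pow_succ, hm, hb, hr]
        refine ⟨rfl, le_rfl, hmod, ?_, by rw [walk, ih, hch, if_pos ⟨hx, hb⟩, if_pos rfl]⟩
        rw [walk] at h0 ⊢
        rw [hx]
        rw [ht] at h0
        rw [← h0, child, child, hb, hr]
      · left; rw [walk, ih, hch, if_neg hc, walk]
    · right
      refine ⟨h1, by omega, h3, by rw [walk, h4]; exact h.child_zero (.inl rfl) _, ?_⟩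
      rw [if_neg (by omega), walk, h5, hch]
      split_ifs with h6 h7 h8
      · exact absurd h7.1 (by omega)
      · exact h.child_zero (.inr le_rfl) _
      · exact absurd h8.1.symm ht0
      · exact h.child_zero (.inl rfl) _

theorem DictE.add_node (h : DictE LC RC KEY SB LH al B S ent dep) {v c t r : ℕ} (hv : v ∈ S)
    (hc : c < 2 ^ B) (he : ent v c = 0) (hslot : Slot LC RC v c t r) (LC' RC' : ℕ → ℕ)
    (hch : ∀ t' r', child LC' RC' t' r' =
      if t' = t ∧ r' % 2 = r % 2 then al else child LC RC t' r')
    (hz : ∀ x, x ≠ t → LC' x = LC x ∧ RC' x = RC x) :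
    ∃ dep', DictE LC' RC' (Function.update KEY al c) (Function.update SB al (LH v))
      (Function.update LH v al) (al + 1) B S (upd ent v c al) dep' := by
  obtain ⟨d, ht, hr, h0, ht0⟩ := hslot
  have hw := h.walk_insert hv ht hr h0 ht0 LC' RC' hch
  have htal : t < al := ht ▸ h.walk_lt hv d
  have hnew : walk LC' RC' v c (d + 1) = al := by
    rw [walk]
    rcases hw v hv c d with h1 | h1
    · rw [h1, ht, hch, hr]; simp
    · omega
  have hvm := h.mem_lt v hv
  have hal := h.al_pos
  have hentlt : ∀ v c, ent v c < al := fun v c => by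
    by_cases h0 : ent v c = 0
    · omega
    · exact (h.ent_spec v c h0).2.1
  refine ⟨Function.update dep al (d + 1), ?_, ?_, ?_, by omega, ?_, ?_, ?_, ?_, ?_⟩
  · intro x hx
    rw [(hz x (by omega)).1, (hz x (by omega)).2]
    exact h.zero x (by omega)
  · intro x hx
    rw [Function.update_of_ne (by omega)]
    exact h.LH_zero x (by omega)
  · intro x hx
    have := h.mem_lt x hx; omega
  · intro v' c' hne
    simp only [upd] at hne ⊢
    split_ifs at hne ⊢ with hcc
    · obtain ⟨rfl, rfl⟩ := hcc
      refine ⟨hv, by omega, fun hS => ?_, by simp, hc, d, hnew⟩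
      have := h.mem_lt _ hS; omega
    · obtain ⟨h1, h2, h3, h4, h5, e, h6⟩ := h.ent_spec v' c' hne
      refine ⟨h1, by omega, h3, by rw [Function.update_of_ne (by omega), h4], h5, e, ?_⟩
      rcases hw v' h1 c' (e + 1) with h7 | ⟨_, _, _, h7, _⟩
      · rw [h7, h6]
      · exact absurd (h6.symm.trans h7) hne
  · intro v' hv' c' d' u hu hu0
    rcases hw v' hv' c' (d' + 1) with h7 | ⟨g1, g2, g3, g4, g5⟩
    · rw [h7] at hu
      obtain ⟨h1, h2, h3⟩ := h.walk_spec v' hv' c' d' u hu hu0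
      have hlt : u < al := by rw [← h1]; exact hentlt _ _
      rw [Function.update_of_ne (by omega), Function.update_of_ne (by omega)]
      refine ⟨?_, h2, h3⟩
      rw [upd, if_neg, h1]
      rintro ⟨rfl, hk⟩
      rw [hk, he] at h1
      exact hu0 h1.symm
    · rw [g5] at hu
      split_ifs at hu with hd
      · subst hu
        have hd' : d' = d := by omega
        subst hd'
        subst g1
        simp only [Function.update_self, upd, true_and]
        exact ⟨by simp, g3.symm, trivial⟩
      · exact absurd hu hu0
  · intro v1 c1 v2 c2 hne heq
    have e1 := hentlt v1 c1
    have e2 := hentlt v2 c2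
    simp only [upd] at hne heq
    split_ifs at hne heq with k1 k2 k3
    · exact k1.1.trans k2.1.symm
    · omega
    · omega
    · exact h.inj _ _ _ _ hne heq
  · intro v' hv'
    obtain ⟨l, hl, hnd, hmem⟩ := h.list v' hv'
    have hlal : ∀ x ∈ l, x ≠ al := by
      intro x hx
      obtain ⟨_, c, rfl⟩ := (hmem x).1 hx
      exact (hentlt _ _).ne
    by_cases hvv : v' = v
    · subst hvv
      refine ⟨al :: l, ⟨by simp, by omega, ?_⟩, ?_, ?_⟩
      · rw [Function.update_self]
        exact hl.congr fun x hx => Function.update_of_ne (hlal x hx) _ _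
      · exact List.nodup_cons.2 ⟨fun hx => hlal _ hx rfl, hnd⟩
      · intro u
        rw [List.mem_cons, hmem]
        constructor
        · rintro (rfl | ⟨h1, c', rfl⟩)
          · exact ⟨by omega, c, by simp [upd]⟩
          · refine ⟨h1, c', ?_⟩
            rw [upd, if_neg]
            rintro ⟨-, rfl⟩
            exact h1 he
        · rintro ⟨h1, c', rfl⟩
          by_cases hcc : c' = c
          · left; simp [upd, hcc]
          · right; refine ⟨h1, c', ?_⟩; simp [upd, hcc]
    · refine ⟨l, ?_, hnd, ?_⟩
      · rw [Function.update_of_ne hvv]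
        exact hl.congr fun x hx => Function.update_of_ne (hlal x hx) _ _
      · intro u; rw [hmem]; simp [upd, hvv]
  · intro u hu hual
    by_cases hua : u = al
    · exact .inr ⟨v, c, by simp [upd, hua]⟩
    · rcases h.cover u hu (by omega) with h1 | ⟨v', c', h1⟩
      · exact .inl h1
      · refine .inr ⟨v', c', ?_⟩
        rw [upd, if_neg, h1]
        rintro ⟨rfl, rfl⟩
        omega

/-- Cells from `al` on have no children and no list, so a fresh index already represents an empty
dictionary. -/
theorem DictE.new (h : DictE LC RC KEY SB LH al B S ent dep) :
    DictE LC RC KEY SB LH (al + 1) B (insert al S) ent dep := by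
  have hal := h.al_pos
  have hw : ∀ c d, walk LC RC al c (d + 1) = 0 := by
    intro c d
    induction d with
    | zero => exact h.child_zero (.inr le_rfl) _
    | succ d ih => rw [walk, ih]; exact h.child_zero (.inl rfl) _
  have hent : ∀ c, ent al c = 0 := by
    intro c
    by_contra h0
    exact absurd (h.mem_lt _ (h.ent_spec al c h0).1).2 (lt_irrefl _)
  refine ⟨fun t ht => h.zero t (by omega), fun t ht => h.LH_zero t (by omega), ?_, by omega, ?_, ?_,
    h.inj, ?_, ?_⟩
  · rintro v (rfl | hv)
    · omega
    · have := h.mem_lt v hv; omega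
  · intro v c h0
    obtain ⟨h1, h2, h3, h4⟩ := h.ent_spec v c h0
    refine ⟨.inr h1, by omega, ?_, h4⟩
    rintro (h5 | h5)
    · omega
    · exact h3 h5
  · rintro v (rfl | hv) c d u hu hu0
    · exact absurd (hu.trans (hw c d)) hu0
    · exact h.walk_spec v hv c d u hu hu0
  · rintro v (rfl | hv)
    · refine ⟨[], h.LH_zero _ le_rfl, List.nodup_nil, fun u => ?_⟩
      simp only [List.not_mem_nil, false_iff]
      rintro ⟨h1, c, rfl⟩
      exact h1 (hent c)
    · exact h.list v hv
  · intro u h1 h2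
    by_cases hu : u = al
    · exact .inl (.inl hu)
    · rcases h.cover u h1 (by omega) with h3 | h3
      · exact .inl (.inr h3)
      · exact .inr h3

theorem Dict.new (h : Dict LC RC KEY TG SB LH al B S tr) :
    Dict LC RC KEY TG SB LH (al + 1) B (insert al S) tr := by
  obtain ⟨ent, dep, h1, h2⟩ := h
  exact ⟨ent, dep, h1.new, h2⟩

theorem Dict.mem_lt (h : Dict LC RC KEY TG SB LH al B S tr) {v : ℕ} (hv : v ∈ S) :
    0 < v ∧ v < al := by
  obtain ⟨ent, dep, h1, -⟩ := h
  exact h1.mem_lt v hv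

theorem Dict.mem_of_tr (h : Dict LC RC KEY TG SB LH al B S tr) {v c : ℕ} (hv : tr v c ≠ 0) :
    v ∈ S := by
  obtain ⟨ent, dep, h1, h2⟩ := h
  exact (h1.ent_spec v c (fun h0 => hv ((h2 v c).1 h0))).1

/-- The states and the edge nodes exhaust the indices between `0` and `al`, so counting edges bounds
the pool. The extra unit is the index `0`, which serves as null. -/
theorem Dict.al_le (h : Dict LC RC KEY TG SB LH al B S tr)
    (hE : {p : ℕ × ℕ | tr p.1 p.2 ≠ 0}.Finite) :
    al ≤ S.ncard + {p : ℕ × ℕ | tr p.1 p.2 ≠ 0}.ncard + 1 := by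
  obtain ⟨ent, dep, h1, h2⟩ := h
  have hS : S.Finite := (Set.finite_Iio al).subset fun v hv => (h1.mem_lt v hv).2
  have hsub : (Finset.Ioo 0 al : Set ℕ) ⊆
      S ∪ (fun p : ℕ × ℕ => ent p.1 p.2) '' {p : ℕ × ℕ | tr p.1 p.2 ≠ 0} := by
    intro u hu
    simp only [Finset.coe_Ioo, Set.mem_Ioo] at hu
    rcases h1.cover u hu.1 hu.2 with h3 | ⟨v, c, rfl⟩
    · exact .inl h3
    · exact .inr ⟨(v, c), ((h2 v c).2 (by omega)).2, rfl⟩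
  have h3 := Set.ncard_le_ncard hsub (hS.union (hE.image _))
  rw [Set.ncard_coe_finset, Nat.card_Ioo] at h3
  have h4 := Set.ncard_union_le S
    ((fun p : ℕ × ℕ => ent p.1 p.2) '' {p : ℕ × ℕ | tr p.1 p.2 ≠ 0})
  have h5 := Set.ncard_image_le hE (f := fun p : ℕ × ℕ => ent p.1 p.2)
  omega

theorem Dict.add_node (h : Dict LC RC KEY TG SB LH al B S tr) {v c t r w : ℕ} (hv : v ∈ S)
    (hc : c < 2 ^ B) (he : tr v c = 0) (hw : w ≠ 0) (hslot : Slot LC RC v c t r) :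
    Dict (if r % 2 = 0 then Function.update LC t al else LC)
      (if r % 2 = 0 then RC else Function.update RC t al) (Function.update KEY al c)
      (Function.update TG al w) (Function.update SB al (LH v)) (Function.update LH v al) (al + 1)
      B S (upd tr v c w) := by
  obtain ⟨ent, dep, h1, h2⟩ := h
  have he' : ent v c = 0 := by
    by_contra h0
    exact ((h2 v c).2 h0).2 he
  obtain ⟨dep', h3⟩ := h1.add_node hv hc he' hslot _ _ (child_update t r al) (fun x hx => by
    constructor <;> split_ifs <;> simp [Function.update_of_ne hx])
  refine ⟨_, dep', h3, fun v' c' => ?_⟩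
  have hal := h1.al_pos
  simp only [upd]
  split_ifs with hcc
  · simp [hw]; omega
  · refine ⟨(h2 v' c').1, fun h0 => ?_⟩
    have := (h1.ent_spec v' c' h0).2.1
    rw [Function.update_of_ne (by omega)]
    exact (h2 v' c').2 h0

theorem Dict.list (h : Dict LC RC KEY TG SB LH al B S tr) {v : ℕ} (hv : v ∈ S) :
    ∃ l, LChain SB (LH v) l ∧ (∀ u ∈ l, u < al ∧ TG u = tr v (KEY u) ∧ tr v (KEY u) ≠ 0 ∧
      KEY u < 2 ^ B) ∧ (l.map KEY).Nodup ∧ ∀ c, tr v c ≠ 0 → ∃ u ∈ l, KEY u = c := by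
  obtain ⟨ent, dep, h1, h2⟩ := h
  obtain ⟨l, hl, hnd, hmem⟩ := h1.list v hv
  have hk : ∀ u ∈ l, ent v (KEY u) = u ∧ u ≠ 0 := by
    intro u hu
    obtain ⟨h0, c, rfl⟩ := (hmem u).1 hu
    rw [(h1.ent_spec v c h0).2.2.2.1]
    exact ⟨rfl, h0⟩
  refine ⟨l, hl, fun u hu => ?_, ?_, fun c hc => ?_⟩
  · obtain ⟨h3, h4⟩ := hk u hu
    have h5 := h1.ent_spec v (KEY u) (h3.trans_ne h4)
    have h6 := (h2 v (KEY u)).2 (h3.trans_ne h4)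
    rw [h3] at h5 h6
    exact ⟨h5.2.1, h6.1, h6.2, h5.2.2.2.2.1⟩
  · refine List.Nodup.map_on (fun x hx y hy hxy => ?_) hnd
    rw [← (hk x hx).1, ← (hk y hy).1, hxy]
  · have h0 : ent v c ≠ 0 := fun h0 => hc ((h2 v c).1 h0)
    exact ⟨ent v c, (hmem _).2 ⟨h0, c, rfl⟩, (h1.ent_spec v c h0).2.2.2.1⟩

end Pure

/-! ### Programs for searching, inserting and copying -/

/-- One step down in a digital search tree, controlled by the low bit of `r`. -/
def childCmd : Cmd :=
  .ite (.eq (.par (.reg .r)) (.const 0)) (.set .u (.ld .LC (.reg .t))) (.set .u (.ld .RC (.reg .t)))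

/-- Search the key `c` in the dictionary of `v`: the node is returned in `u`. -/
def findCmd : Cmd :=
  .set .t (.reg .v) ;; .set .r (.reg .c) ;; childCmd ;;
  .loop (.and (.ne (.reg .u) (.const 0)) (.ne (.ld .KEY (.reg .u)) (.reg .c)))
    (.set .t (.reg .u) ;; .set .r (.half (.reg .r)) ;; childCmd)

/-- After an unsuccessful search, add a node with target `w`. -/
def insertCmd : Cmd :=
  .set .u (.reg .al) ;; .set .al (.succ (.reg .al)) ;; .store .KEY (.reg .u) (.reg .c) ;;
  .store .TG (.reg .u) (.reg .w) ;; .store .SB (.reg .u) (.ld .LH (.reg .v)) ;;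
  .store .LH (.reg .v) (.reg .u) ;;
  .ite (.eq (.par (.reg .r)) (.const 0)) (.store .LC (.reg .t) (.reg .u))
    (.store .RC (.reg .t) (.reg .u))

/-- Copy the dictionary of `q` to the empty dictionary of `cl`. -/
def copyCmd : Cmd :=
  .set .v (.reg .cl) ;; .set .x (.ld .LH (.reg .q)) ;;
  .loop (.ne (.reg .x) (.const 0))
    (.set .c (.ld .KEY (.reg .x)) ;; .set .w (.ld .TG (.reg .x)) ;; findCmd ;; insertCmd ;;
      .set .x (.ld .SB (.reg .x)))

variable {α : Type*} [LinearOrder α] {T : List α} {lim : ℕ}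

theorem wp_child {s : St α} {Q : St α → Prop}
    (h : Q { s with u := child s.LC s.RC s.t s.r, tm := s.tm + 6 }) :
    WP T lim childCmd s Q := by
  simp only [childCmd, wp_ite, wp_set, Tst.ok, Tst.ev, Ex.ev, St.get, St.set, St.tick, St.arr,
    Ex.size, Tst.size]
  simp only [child] at h
  refine ⟨trivial, fun h0 => ?_, fun h0 => ?_⟩
  · simpa [h0] using h
  · simpa [h0] using h

/-- A node at depth `d + 1` agrees with the key sought in `d + 1` bits, so mismatches occur only
down to depth `B`. An unsuccessful search ends at a free slot for the key, where `insertCmd`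
attaches a node. -/
theorem wp_find_ent {s : St α} {Q : St α → Prop} {B : ℕ} {S : Set ℕ} {ent : ℕ → ℕ → ℕ}
    {dep : ℕ → ℕ} (h : DictE s.LC s.RC s.KEY s.SB s.LH s.al B S ent dep) (hv : s.v ∈ S)
    (hc : s.c < 2 ^ B)
    (hQ : ∀ t r u tm, u = ent s.v s.c → (u = 0 → Slot s.LC s.RC s.v s.c t r) →
      tm ≤ s.tm + 20 * (B + 1) → Q { s with t := t, r := r, u := u, tm := tm }) :
    WP T lim findCmd s Q := by
  simp only [findCmd, wp_seq, wp_set, Ex.ev, St.get, St.set, St.tick, Ex.size]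
  refine wp_child ?_
  dsimp only
  refine wp_loop_of (fun k s' => ∃ d t r u tm, d + k = B ∧
      s' = { s with t := t, r := r, u := u, tm := tm } ∧ t = walk s.LC s.RC s.v s.c d ∧
      r = s.c / 2 ^ d ∧ u = walk s.LC s.RC s.v s.c (d + 1) ∧ t ≠ 0 ∧ tm ≤ s.tm + 8 + 20 * d ∧
      ∀ e < d, s.KEY (walk s.LC s.RC s.v s.c (e + 1)) ≠ s.c) ?_ ?_ ?_ B _ ?_
  · rintro k s' ⟨d, t, r, u, tm, hd, rfl, -⟩
    simp [Tst.ok]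
  · rintro k s' ⟨d, t, r, u, tm, hd, rfl, ht, hr, hu, ht0, htm, hne⟩ hev
    simp only [Tst.ev, Ex.ev, St.get, St.arr] at hev
    obtain ⟨hu0, hk⟩ := hev
    obtain ⟨h1, h2, -⟩ := h.walk_spec s.v hv s.c d u hu hu0
    have h3 := (h.ent_spec s.v _ (h1.trans_ne hu0)).2.2.2.2.1
    -- Two numbers below `2 ^ B` that agree in `B` low bits are equal, which excludes a mismatch.
    have hdB : d < B := by
      by_contra hdB
      have hle : 2 ^ B ≤ 2 ^ (d + 1) := Nat.pow_le_pow_right (by simp) (by omega)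
      rw [Nat.mod_eq_of_lt (by omega), Nat.mod_eq_of_lt (by omega)] at h2
      exact hk h2
    simp only [wp_seq, wp_set, Ex.ev, St.get, St.set, St.tick, Ex.size, Tst.size]
    refine wp_child ?_
    refine ⟨k - 1, by omega, d + 1, u, r / 2, child s.LC s.RC u (r / 2), _, by omega, rfl, hu, ?_,
      ?_, hu0, ?_, ?_⟩
    · rw [hr, Nat.div_div_eq_div_mul, pow_succ]
    · rw [walk, ← hu, hr, Nat.div_div_eq_div_mul, pow_succ]
    · simp only; omega
    · intro e he
      by_cases hed : e = d
      · rw [hed, ← hu]; exact hk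
      · exact hne e (by omega)
  · rintro k s' ⟨d, t, r, u, tm, hd, rfl, ht, hr, hu, ht0, htm, hne⟩ hev
    simp only [Tst.ev, Ex.ev, St.get, St.arr, not_and, not_not] at hev
    simp only [St.tick]
    refine hQ t r u _ ?_ (fun h0 => ⟨d, ht.symm, hr, hu.symm.trans h0, ht0⟩) ?_
    · by_cases hu0 : u = 0
      · by_contra hne'
        have hent : ent s.v s.c ≠ 0 := fun h0 => hne' (hu0.trans h0.symm)
        obtain ⟨-, -, -, h4, -, e, h5⟩ := h.ent_spec s.v s.c hent
        by_cases hed : e < d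
        · exact hne e hed (by rw [h5, h4])
        · exact hent (h5.symm.trans (h.walk_zero (hu.symm.trans hu0) (by omega)))
      · have := (h.walk_spec s.v hv s.c d u hu hu0).1
        rw [← this, hev hu0]
    · simp only [Tst.size, Ex.size]; omega
  · refine ⟨0, s.v, s.c, child s.LC s.RC s.v s.c, _, by omega, rfl, rfl, by simp, by simp [walk],
      ?_, ?_, by simp⟩
    · exact (h.mem_lt _ hv).1.ne'
    · omega

/-- On success the target may be overwritten in place; this is how edges are redirected to a clone.
-/
theorem wp_find {s : St α} {Q : St α → Prop} {B : ℕ} {S : Set ℕ} {tr : ℕ → ℕ → ℕ}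
    (h : Dict s.LC s.RC s.KEY s.TG s.SB s.LH s.al B S tr) (hv : s.v ∈ S) (hc : s.c < 2 ^ B)
    (hfail : ∀ t r tm, tr s.v s.c = 0 → Slot s.LC s.RC s.v s.c t r →
      tm ≤ s.tm + 20 * (B + 1) → Q { s with t := t, r := r, u := 0, tm := tm })
    (hsucc : ∀ t r u tm, u ≠ 0 → u < s.al → s.TG u = tr s.v s.c → tr s.v s.c ≠ 0 →
      (∀ w, w ≠ 0 → Dict s.LC s.RC s.KEY (Function.update s.TG u w) s.SB s.LH s.al B S
        (upd tr s.v s.c w)) →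
      tm ≤ s.tm + 20 * (B + 1) → Q { s with t := t, r := r, u := u, tm := tm }) :
    WP T lim findCmd s Q := by
  obtain ⟨ent, dep, h1, h2⟩ := h
  refine wp_find_ent h1 hv hc fun t r u tm hu hs ht => ?_
  by_cases h0 : u = 0
  · have := hfail t r tm ((h2 _ _).1 (hu.symm.trans h0)) (hs h0) ht
    rw [h0]; exact this
  · have h3 := (h2 s.v s.c).2 (hu ▸ h0)
    refine hsucc t r u tm h0 (hu ▸ (h1.ent_spec _ _ (hu ▸ h0)).2.1) (hu ▸ h3.1) h3.2
      (fun w hw => ⟨ent, dep, h1, fun v' c' => ?_⟩) ht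
    simp only [upd]
    split_ifs with hcc
    · obtain ⟨rfl, rfl⟩ := hcc
      exact ⟨fun h4 => absurd (hu.trans h4) h0, fun _ => ⟨by rw [← hu]; simp, hw⟩⟩
    · refine ⟨(h2 v' c').1, fun h4 => ?_⟩
      rw [Function.update_of_ne]
      · exact (h2 v' c').2 h4
      · intro h5
        refine hcc ⟨h1.inj _ _ _ _ h4 (h5.trans hu), ?_⟩
        rw [← (h1.ent_spec _ _ h4).2.2.2.1, h5, hu, (h1.ent_spec _ _ (hu ▸ h0)).2.2.2.1]

theorem wp_insert {s : St α} {Q : St α → Prop} {B : ℕ} {S : Set ℕ} {tr : ℕ → ℕ → ℕ}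
    (h : Dict s.LC s.RC s.KEY s.TG s.SB s.LH s.al B S tr) (hv : s.v ∈ S) (hc : s.c < 2 ^ B)
    (h0 : tr s.v s.c = 0) (hs : Slot s.LC s.RC s.v s.c s.t s.r) (hw : s.w ≠ 0) (hal : s.al < lim)
    (hQ : ∀ LC RC LH tm,
      Dict LC RC (Function.update s.KEY s.al s.c) (Function.update s.TG s.al s.w)
        (Function.update s.SB s.al (s.LH s.v)) LH (s.al + 1) B S (upd tr s.v s.c s.w) →
      tm ≤ s.tm + 30 →
      Q { s with u := s.al, al := s.al + 1, LC := LC, RC := RC, KEY := Function.update s.KEY s.al s.c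
                 TG := Function.update s.TG s.al s.w
                 SB := Function.update s.SB s.al (s.LH s.v), LH := LH, tm := tm }) :
    WP T lim insertCmd s Q := by
  have h1 := h.add_node hv hc h0 hw hs
  have hvl := h.mem_lt hv
  have htl : s.t < s.al := by
    obtain ⟨ent, dep, h2, -⟩ := h
    obtain ⟨d, h3, -⟩ := hs
    exact h3 ▸ h2.walk_lt hv d
  simp only [insertCmd, wp_seq, wp_set, wp_store, wp_ite, Ex.ev, Tst.ok, Tst.ev, St.get, St.set,
    St.arr, St.setArr, St.tick, Ex.size, Tst.size]
  refine ⟨hal, hal, hal, by omega, trivial, fun hr => ⟨by omega, ?_⟩, fun hr => ⟨by omega, ?_⟩⟩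
  · simp only [hr, if_true] at h1
    exact hQ _ _ _ _ h1 (by omega)
  · simp only [hr, if_false] at h1
    exact hQ _ _ _ _ h1 (by omega)

/-- Each copied edge allocates one node, so the time is charged to the growth of `al`. The premise
`hal` concerns every dictionary that can arise midway, because each single allocation needs room. -/
theorem wp_copy {s : St α} {Q : St α → Prop} {B : ℕ} {S : Set ℕ} {tr : ℕ → ℕ → ℕ}
    (h : Dict s.LC s.RC s.KEY s.TG s.SB s.LH s.al B S tr) (hq : s.q ∈ S) (hcl : s.cl ∈ S)
    (h0 : ∀ c, tr s.cl c = 0)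
    (hal : ∀ LC RC KEY TG SB LH al tr', Dict LC RC KEY TG SB LH al B S tr' →
      (∀ v c, tr' v c ≠ 0 → tr v c ≠ 0 ∨ (v = s.cl ∧ tr s.q c ≠ 0)) → al < lim)
    (hQ : ∀ v x c w t r u al LC RC KEY TG SB LH tm,
      Dict LC RC KEY TG SB LH al B S (fun v c => if v = s.cl then tr s.q c else tr v c) →
      s.al ≤ al → tm + 80 * (B + 1) * s.al ≤ s.tm + 80 * (B + 1) * al + 10 →
      Q { s with v := v, x := x, c := c, w := w, t := t, r := r, u := u, al := al, LC := LC
                 RC := RC, KEY := KEY, TG := TG, SB := SB, LH := LH, tm := tm }) :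
    WP T lim copyCmd s Q := by
  obtain ⟨L, hL, hmem, hnd, hall⟩ := h.list hq
  simp only [copyCmd, wp_seq, wp_set, Ex.ev, St.get, St.set, St.arr, St.tick, Ex.size]
  refine wp_loop_of (fun k s' => ∃ l₁ l₂ x c w t r u al LC RC KEY TG SB LH tm, l₁ ++ l₂ = L ∧
      l₂.length = k ∧ LChain SB x l₂ ∧ s.al ≤ al ∧
      (∀ i < s.al, KEY i = s.KEY i ∧ TG i = s.TG i ∧ SB i = s.SB i) ∧
      Dict LC RC KEY TG SB LH al B S (fun v c => if v = s.cl then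
        (if c ∈ l₁.map s.KEY then tr s.q c else 0) else tr v c) ∧
      s' = { s with v := s.cl, x := x, c := c, w := w, t := t, r := r, u := u, al := al, LC := LC
                    RC := RC, KEY := KEY, TG := TG, SB := SB, LH := LH, tm := tm } ∧
      tm + 80 * (B + 1) * s.al ≤ s.tm + 80 * (B + 1) * al + 3)
    ?_ ?_ ?_ L.length _ ?_
  · rintro k s' ⟨l₁, l₂, x, c, w, t, r, u, al, LC, RC, KEY, TG, SB, LH, tm, -, -, -, -, -, -, rfl, -⟩
    simp [Tst.ok]
  · rintro k s' ⟨l₁, l₂, x, c, w, t, r, u, al, LC, RC, KEY, TG, SB, LH, tm, hl, hk, hch, hle, hag,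
      hD, rfl, htm⟩ hev
    simp only [Tst.ev, Ex.ev, St.get] at hev
    rcases l₂ with _ | ⟨y, l₂⟩
    · exact absurd hch hev
    · obtain ⟨rfl, hx0, hch⟩ := hch
      have hxL : x ∈ L := by rw [← hl]; simp
      obtain ⟨hx1, hx2, hx3, hx4⟩ := hmem x hxL
      obtain ⟨hag1, hag2, hag3⟩ := hag x hx1
      have hkey : s.KEY x ∉ l₁.map s.KEY := by
        rw [← hl, List.map_append, List.map_cons] at hnd
        intro hx
        exact (List.nodup_append.1 hnd).2.2 _ hx _ (by simp) rfl
      have htr0 : (fun v c => if v = s.cl then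
        (if c ∈ l₁.map s.KEY then tr s.q c else 0) else tr v c) s.cl (s.KEY x) = 0 := by
        simp only [if_true]
        rw [if_neg hkey]
      simp only [wp_seq, wp_set, Ex.ev, St.get, St.set, St.arr, St.tick, Ex.size, Tst.size]
      rw [hag1, hag2]
      have hallt : al < lim := by
        refine hal _ _ _ _ _ _ _ _ hD fun v c hvc => ?_
        split_ifs at hvc with h1 h2
        · exact .inr ⟨h1, hvc⟩
        · exact absurd rfl hvc
        · exact .inl hvc
      refine wp_find (tr := _) hD hcl hx4 (fun t r tm' _ hslot htm' => ?_) ?_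
      · refine wp_insert (tr := _) hD hcl hx4 htr0 hslot ?_ hallt ?_
        · rw [hx2]; exact hx3
        · intro LC' RC' LH' tm'' hD' htm''
          dsimp only at hD' htm'' htm' ⊢
          -- An insertion writes a sibling pointer only into the fresh cell, so the list of `q` that
          -- is being traversed stays intact.
          have hup : Function.update SB al (LH s.cl) x = SB x := Function.update_of_ne (by omega) _ _
          refine ⟨l₂.length, by simp at hk; omega, l₁ ++ [x], l₂, SB x, s.KEY x, s.TG x, t, r, al,
            al + 1, LC', RC', Function.update KEY al (s.KEY x), Function.update TG al (s.TG x),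
            Function.update SB al (LH s.cl), LH', tm'' + 2, by simpa using hl, rfl, ?_, by omega, ?_, ?_, ?_, ?_⟩
          · refine hch.congr fun y hy => Function.update_of_ne ?_ _ _
            have := (hmem y (by rw [← hl]; simp [hy])).1
            omega
          · intro i hi
            have hi' : i ≠ al := by omega
            simp only [Function.update_of_ne hi']
            exact hag i hi
          · convert hD' using 1
            funext v c
            simp only [upd]
            by_cases hv : v = s.cl
            · by_cases hc : c = s.KEY x
              · simp only [hv, hc, and_self, if_true]
                rw [if_pos (by simp), hx2]
              · simp only [hv, hc, and_false, if_true, if_false]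
                simp only [List.map_append, List.mem_append, List.map_cons, List.map_nil,
                  List.mem_singleton, hc, or_false]
            · simp [hv]
          · rw [hup]
          · nlinarith
      · intro t r u tm' _ _ _ hbad
        exact absurd htr0 hbad
  · rintro k s' ⟨l₁, l₂, x, c, w, t, r, u, al, LC, RC, KEY, TG, SB, LH, tm, hl, hk, hch, hle, hag,
      hD, rfl, htm⟩ hev
    simp only [Tst.ev, Ex.ev, St.get, not_not] at hev
    rcases l₂ with _ | ⟨y, l₂⟩
    · simp only [List.append_nil] at hl
      subst hl
      simp only [St.tick, Tst.size, Ex.size]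
      refine hQ _ _ _ _ _ _ _ _ _ _ _ _ _ _ _ ?_ hle (by omega)
      convert hD using 1
      funext v c
      split_ifs with h1 h2
      · rfl
      · by_contra h3
        obtain ⟨u, hu, rfl⟩ := hall c h3
        exact h2 (List.mem_map_of_mem hu)
      · rfl
    · obtain ⟨h1, h2, -⟩ := hch
      exact absurd (h1.symm.trans hev) h2
  · refine ⟨[], L, s.LH s.q, s.c, s.w, s.t, s.r, s.u, s.al, s.LC, s.RC, s.KEY, s.TG, s.SB, s.LH,
      s.tm + 1 + 2, rfl, rfl, hL, le_rfl, fun _ _ => ⟨rfl, rfl, rfl⟩, ?_, rfl, by omega⟩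
    convert h using 1
    funext v c
    by_cases hv : v = s.cl
    · simp [hv, h0]
    · simp [hv]

end Dictionary

/-! ### Online construction of the suffix automaton -/

section Automaton

/-- The least end of an occurrence of `x` in `U`. -/
def IsFirst (U x : List ℕ) (e : ℕ) : Prop :=
  (∃ P, P <+: U ∧ x <:+ P ∧ P.length = e) ∧ ∀ P, P <+: U → x <:+ P → e ≤ P.length

/-- The automaton of `U`: the closed word `x` is represented by the state `ν x`. -/
structure Sam (LEN LNK FST : ℕ → ℕ) (tr : ℕ → ℕ → ℕ) (S : Set ℕ) (U : List ℕ)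
    (ν : List ℕ → ℕ) : Prop where
  states : S = ν '' {x | Closed U x}
  inj : Set.InjOn ν {x | Closed U x}
  pos : ∀ x, Closed U x → ν x ≠ 0
  len : ∀ x, Closed U x → LEN (ν x) = x.length
  fst : ∀ x, Closed U x → IsFirst U x (FST (ν x))
  lnk : ∀ x l, Closed U x → IsLink U x l → LNK (ν x) = ν l
  lnk_nil : LNK (ν []) = 0
  tr_cl : ∀ x c w, Closed U x → IsCl U (x ++ [c]) w → tr (ν x) c = ν w
  tr_none : ∀ x c, Closed U x → ¬ x ++ [c] <:+: U → tr (ν x) c = 0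

variable {LEN LNK FST : ℕ → ℕ} {tr : ℕ → ℕ → ℕ} {S : Set ℕ} {U : List ℕ} {ν : List ℕ → ℕ}

theorem IsCl.isFirst {U z y : List ℕ} {e : ℕ} (h : IsCl U z y) (hy : IsFirst U y e) :
    IsFirst U z e := by
  obtain ⟨⟨P, h1, h2, h3⟩, h4⟩ := hy
  exact ⟨⟨P, h1, h.suffix.trans h2, h3⟩, fun P' hP' hz => h4 P' hP' (h.occ P' hP' hz)⟩

theorem IsFirst.concat {U x : List ℕ} {e : ℕ} (h : IsFirst U x e) (c : ℕ) :
    IsFirst (U ++ [c]) x e := by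
  obtain ⟨⟨P, h1, h2, h3⟩, h4⟩ := h
  refine ⟨⟨P, h1.trans (List.prefix_append U [c]), h2, h3⟩, fun P' hP' hz => ?_⟩
  rcases List.prefix_concat_iff.1 hP' with rfl | hP'
  · have := h1.length_le
    simp only [List.length_append]; omega
  · exact h4 P' hP' hz

theorem isFirst_self_concat (U : List ℕ) (c : ℕ) : IsFirst (U ++ [c]) (U ++ [c]) (U.length + 1) :=
  ⟨⟨_, List.prefix_refl _, List.suffix_refl _, by simp⟩, fun P _ h => by simpa using h.length_le⟩

theorem Sam.tr_ne_zero_iff (h : Sam LEN LNK FST tr S U ν) {x : List ℕ} {c : ℕ} (hx : Closed U x) :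
    tr (ν x) c ≠ 0 ↔ x ++ [c] <:+: U := by
  constructor
  · intro h0; by_contra h1; exact h0 (h.tr_none x c hx h1)
  · intro h1
    obtain ⟨w, hw⟩ := exists_isCl h1
    rw [h.tr_cl x c w hx hw]
    exact h.pos w hw.closed

theorem Sam.mem (h : Sam LEN LNK FST tr S U ν) {x : List ℕ} (hx : Closed U x) : ν x ∈ S := by
  rw [h.states]; exact ⟨x, hx, rfl⟩

/-- The states of the automaton of `U c`. -/
noncomputable def extendStates (U : List ℕ) (c : ℕ) (y : List ℕ) (ν : List ℕ → ℕ) (cur yid : ℕ)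
    (x : List ℕ) : ℕ :=
  open Classical in if x = U ++ [c] then cur else if x = y then yid else ν x

/-- Both ways of adding a letter at once: `yid` is a fresh clone if `y ≠ q`, and the old state of
`y` if `y = q`. The premises on `tr'` follow the description of the closures in `Uc`: edges labelled
`c` at closed suffixes of `U` lead to `cur`, to `yid` or to their old target, the other edges stay,
and `yid` shares the edges of `q`. -/
theorem Sam.concat (h : Sam LEN LNK FST tr S U ν) {c : ℕ} {y q : List ℕ} (hy : IsRep U c y)
    (hq : IsCl U y q) {cur yid : ℕ} {LEN' LNK' FST' : ℕ → ℕ} {tr' : ℕ → ℕ → ℕ}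
    (hcur : cur ∉ S) (hcur0 : cur ≠ 0) (hyid0 : yid ≠ 0) (hcy : cur ≠ yid)
    (hyid : (yid ∉ S ∧ y ≠ q) ∨ (yid = ν y ∧ y = q))
    (hlen : ∀ v ∈ S, LEN' v = LEN v) (hlen1 : LEN' cur = U.length + 1) (hlen2 : LEN' yid = y.length)
    (hfst : ∀ v ∈ S, FST' v = FST v) (hfst1 : FST' cur = U.length + 1)
    (hfst2 : FST' yid = FST (ν q))
    (hlnk : ∀ v ∈ S, v ≠ ν q → LNK' v = LNK v) (hlnk1 : LNK' cur = yid)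
    (hlnk2 : LNK' yid = LNK (ν q)) (hlnk3 : y ≠ q → LNK' (ν q) = yid)
    (h1 : ∀ x c', Closed U x → (c' ≠ c ∨ ¬ x <:+ U) → tr' (ν x) c' = tr (ν x) c')
    (h2 : ∀ x, Closed U x → x <:+ U → ¬ x ++ [c] <:+: U → tr' (ν x) c = cur)
    (h3 : ∀ x w, Closed U x → x <:+ U → IsCl U (x ++ [c]) w → w = q → tr' (ν x) c = yid)
    (h3' : ∀ x w, Closed U x → x <:+ U → IsCl U (x ++ [c]) w → w ≠ q → tr' (ν x) c = ν w)
    (h4 : ∀ c', tr' cur c' = 0) (h5 : ∀ c', tr' yid c' = tr' (ν q) c') :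
    Sam LEN' LNK' FST' tr' (insert cur (insert yid S)) (U ++ [c])
      (extendStates U c y ν cur yid) := by
  have hyV := hy.ne
  have hnc : ∀ x, Closed U x → x ≠ U ++ [c] := by
    rintro x hx rfl
    exact not_isInfix_self_concat U c hx.isInfix
  have nV : extendStates U c y ν cur yid (U ++ [c]) = cur := by simp [extendStates]
  have ny : extendStates U c y ν cur yid y = yid := by simp [extendStates, hyV]
  have yq : Closed U y → y = q := fun hy => hy.isCl.unique hq
  have nU : ∀ x, Closed U x → extendStates U c y ν cur yid x = ν x := by
    intro x hx
    by_cases hxy : x = y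
    · subst hxy
      rw [ny]
      rcases hyid with ⟨_, h⟩ | ⟨h, _⟩
      · exact absurd (yq hx) h
      · exact h
    · simp [extendStates, hnc x hx, hxy]
  have key : ∀ x, Closed (U ++ [c]) x → Closed U x ∨ x = U ++ [c] ∨ (x = y ∧ y ≠ q ∧ yid ∉ S) := by
    intro x hx
    rcases (closed_concat_iff hy).1 hx with h | h | h
    · exact .inl h
    · exact .inr (.inl h)
    · rcases hyid with ⟨h6, h7⟩ | ⟨_, h6⟩
      · exact .inr (.inr ⟨h, h7, h6⟩)
      · left; rw [h, h6]; exact hq.closed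
  refine ⟨?_, ?_, ?_, ?_, ?_, ?_, ?_, ?_, ?_⟩
  · rw [h.states]
    ext v
    simp only [Set.mem_insert_iff, Set.mem_image, Set.mem_ofPred_eq]
    constructor
    · rintro (rfl | rfl | ⟨x, hx, rfl⟩)
      · exact ⟨_, closed_self _, nV⟩
      · exact ⟨_, hy.closed, ny⟩
      · exact ⟨x, hx.concat c, nU x hx⟩
    · rintro ⟨x, hx, rfl⟩
      rcases key x hx with hx | rfl | ⟨rfl, -⟩
      · exact .inr (.inr ⟨x, hx, (nU x hx).symm⟩)
      · exact .inl nV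
      · exact .inr (.inl ny)
  · intro x hx x' hx' heq
    rcases key x hx with g | rfl | ⟨rfl, g, g'⟩ <;> rcases key x' hx' with k | rfl | ⟨rfl, k, k'⟩
    · rw [nU x g, nU x' k] at heq; exact h.inj g k heq
    · rw [nU x g, nV] at heq; exact absurd (heq ▸ h.mem g) hcur
    · rw [nU x g, ny] at heq; exact absurd (heq ▸ h.mem g) k'
    · rw [nU x' k, nV] at heq; exact absurd (heq ▸ h.mem k) hcur
    · rfl
    · rw [nV, ny] at heq; exact absurd heq hcy
    · rw [nU x' k, ny] at heq; exact absurd (heq ▸ h.mem k) g'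
    · rw [nV, ny] at heq; exact absurd heq.symm hcy
    · rfl
  · intro x hx
    rcases key x hx with g | rfl | ⟨rfl, g, g'⟩
    · rw [nU x g]; exact h.pos x g
    · rwa [nV]
    · rwa [ny]
  · intro x hx
    rcases key x hx with g | rfl | ⟨rfl, g, g'⟩
    · rw [nU x g, hlen _ (h.mem g), h.len x g]
    · rw [nV, hlen1]; simp
    · rw [ny, hlen2]
  · intro x hx
    rcases key x hx with g | rfl | ⟨rfl, g, g'⟩
    · rw [nU x g, hfst _ (h.mem g)]; exact (h.fst x g).concat c
    · rw [nV, hfst1]; exact isFirst_self_concat U c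
    · rw [ny, hfst2]; exact (hq.isFirst (h.fst q hq.closed)).concat c
  · intro x l hx hl
    rcases key x hx with g | rfl | ⟨rfl, g, g'⟩
    · have hx0 : x ≠ [] := by
        rintro rfl
        exact hl.ne (List.suffix_nil.1 hl.suffix)
      obtain ⟨l', hl'⟩ := exists_isLink U hx0
      rw [nU x g]
      by_cases hxq : x = q ∧ y ≠ q
      · obtain ⟨rfl, hyq⟩ := hxq
        rw [hlnk3 hyq, hl.unique (IsLink.concat_cl hy hq hyq), ny]
      · have hll : l = l' := hl.unique (hl'.concat hy hq g (by tauto))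
        subst hll
        rw [nU _ hl'.closed, ← h.lnk x l g hl']
        by_cases hxq' : x = q
        · subst hxq'
          have : y = x := by tauto
          subst this
          rcases hyid with ⟨_, h6⟩ | ⟨h6, _⟩
          · exact absurd rfl h6
          · rw [← h6, hlnk2, h6]
        · exact hlnk _ (h.mem g) fun h6 => hxq' (h.inj g hq.closed h6)
    · rw [nV, hlnk1, hl.unique hy.isLink_self, ny]
    · have hq0 : q ≠ [] := by
        rintro rfl
        exact g (List.suffix_nil.1 hq.suffix)
      obtain ⟨l', hl'⟩ := exists_isLink U hq0
      rw [ny, hlnk2, hl.unique (hl'.concat_rep hy hq g), nU _ hl'.closed, h.lnk q l' hq.closed hl']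
  · rw [nU [] (Closed.nil U)]
    by_cases hq0 : [] = q
    · subst hq0
      have : y = [] := List.suffix_nil.1 hq.suffix
      rcases hyid with ⟨_, h6⟩ | ⟨h6, h7⟩
      · exact absurd this h6
      · rw [← h7, ← h6, hlnk2, h.lnk_nil]
    · rw [hlnk _ (h.mem (Closed.nil U)) fun h6 => hq0 (h.inj (Closed.nil U) hq.closed h6), h.lnk_nil]
  -- The edges of the old states come first. The clone inherits the result from `q`, because right
  -- extensions of `y` and of `q` have the same closures in `Uc`.
  · have main : ∀ x c' w, Closed U x → IsCl (U ++ [c]) (x ++ [c']) w →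
        tr' (ν x) c' = extendStates U c y ν cur yid w := by
      intro x c' w hx hw
      by_cases hin : x ++ [c'] <:+: U
      · obtain ⟨w', hw'⟩ := exists_isCl hin
        by_cases hcc : c' = c ∧ x <:+ U
        · obtain ⟨rfl, hxU⟩ := hcc
          have hxV : x ++ [c'] <:+ U ++ [c'] := concat_suffix_concat.2 ⟨rfl, hxU⟩
          by_cases hwq : w' = q
          · subst hwq
            rw [h3 x _ hx hxU hw' rfl,
              hw.unique (IsCl.concat_of_eq hy hq hw' (hy.max _ hxV hin)), ny]
          · rw [h3' x _ hx hxU hw' hwq, hw.unique (IsCl.concat_of_ne hy hq hw' hwq),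
              nU _ hw'.closed]
        · rw [h1 x c' hx (by tauto), h.tr_cl x c' w' hx hw', hw.unique
            (hw'.concat_of_not_suffix hy fun h6 => hcc (concat_suffix_concat.1 (h6.trans hy.suffix))),
            nU _ hw'.closed]
      · have hxV := (List.infix_concat_iff.1 hw.isInfix).resolve_right hin
        obtain ⟨rfl, hxU⟩ := concat_suffix_concat.1 hxV
        rw [h2 x hx hxU hin, hw.unique (isCl_concat_self hxV hin), nV]
    intro x c' w hx hw
    rcases key x hx with g | rfl | ⟨rfl, g, g'⟩
    · rw [nU x g]; exact main x c' w g hw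
    · exact absurd hw.isInfix (not_isInfix_self_concat _ _)
    · rw [ny, h5]
      exact main q c' w hq.closed ((hq.isCl_concat_iff c').1 hw)
  · have main : ∀ x c', Closed U x → ¬ x ++ [c'] <:+: U ++ [c] → tr' (ν x) c' = 0 := by
      intro x c' hx hn
      rw [h1 x c' hx, h.tr_none x c' hx fun h6 => hn (isInfix_concat_of c h6)]
      by_contra! hcc
      exact hn (concat_suffix_concat.2 ⟨hcc.1, hcc.2⟩).isInfix
    intro x c' hx hn
    rcases key x hx with g | rfl | ⟨rfl, g, g'⟩
    · rw [nU x g]; exact main x c' g hn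
    · rw [nV, h4]
    · rw [ny, h5]
      exact main q c' hq.closed fun h6 => hn ((hq.concat_isInfix_iff c').2 h6)

/-- There are `2n + 1` states, `3n + 1` edges and the index `0`. The numbering `ν` is arbitrary, so
that the bound applies to half-updated automata as well. -/
theorem Dict.al_le_of_words {LC RC KEY TG SB LH : ℕ → ℕ} {al B : ℕ}
    (h : Dict LC RC KEY TG SB LH al B S tr) {V : List ℕ} (ν : List ℕ → ℕ)
    (hS : ∀ v ∈ S, ∃ x, Closed V x ∧ v = ν x)
    (hE : ∀ v c, tr v c ≠ 0 → ∃ x, Closed V x ∧ v = ν x ∧ x ++ [c] <:+: V) :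
    al ≤ 5 * V.length + 3 := by
  obtain ⟨f1, c1⟩ := closed_finite_ncard V
  obtain ⟨f2, c2⟩ := edges_finite_ncard V
  have hS' : S ⊆ ν '' {x | Closed V x} := by
    intro v hv
    obtain ⟨x, hx, rfl⟩ := hS v hv
    exact ⟨x, hx, rfl⟩
  -- An edge is recovered from its word by splitting off the last letter; edge words are nonempty,
  -- so the default `0` plays no role.
  have hE' : {p : ℕ × ℕ | tr p.1 p.2 ≠ 0} ⊆
      (fun z : List ℕ => (ν z.dropLast, z.getLastD 0)) '' edges V := by
    rintro ⟨v, c⟩ hvc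
    obtain ⟨x, hx, rfl, hxc⟩ := hE v c hvc
    exact ⟨x ++ [c], ⟨x, c, rfl, hx, hxc⟩, by simp⟩
  have h1 := h.al_le ((f2.image _).subset hE')
  have h2 := (Set.ncard_le_ncard hS' (f1.image _)).trans (Set.ncard_image_le f1)
  have h3 := (Set.ncard_le_ncard hE' (f2.image _)).trans (Set.ncard_image_le f2)
  omega

/-- A position `p` in the chain of the suffix links that starts at `U`; `R` are the closed
suffixes that have not been visited. -/
def Cursor (U : List ℕ) (ν : List ℕ → ℕ) (p : ℕ) (R : Set (List ℕ)) : Prop :=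
  (p = 0 ∧ R = ∅) ∨ ∃ z, Closed U z ∧ z <:+ U ∧ p = ν z ∧ R = {x | x <:+ z ∧ Closed U x}

theorem Cursor.sub {p : ℕ} {R : Set (List ℕ)} (h : Cursor U ν p R) :
    R ⊆ {x | x <:+ U ∧ Closed U x} := by
  rcases h with ⟨-, rfl⟩ | ⟨z, hz, hzU, -, rfl⟩
  · simp
  · exact fun x hx => ⟨hx.1.trans hzU, hx.2⟩

theorem Sam.cursor_next (h : Sam LEN LNK FST tr S U ν) {z : List ℕ} (hz : Closed U z)
    (hzU : z <:+ U) :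
    Cursor U ν (LNK (ν z)) ({x | x <:+ z ∧ Closed U x} \ {z}) ∧
      ({x | x <:+ z ∧ Closed U x} \ {z}).ncard + 1 = {x | x <:+ z ∧ Closed U x}.ncard := by
  refine ⟨?_, Set.ncard_sdiff_singleton_add_one ⟨List.suffix_refl z, hz⟩
    (finite_closed_suffixes U z)⟩
  by_cases hz0 : z = []
  · subst hz0
    refine .inl ⟨h.lnk_nil, ?_⟩
    ext x; simp +contextual
  · obtain ⟨l, hl⟩ := exists_isLink U hz0
    refine .inr ⟨l, hl.closed, hl.suffix.trans hzU, h.lnk z l hz hl, ?_⟩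
    ext x
    simp only [Set.mem_sdiff, Set.mem_ofPred_eq, Set.mem_singleton_iff]
    constructor
    · rintro ⟨⟨h1, h2⟩, h3⟩; exact ⟨hl.max x h2 h1 h3, h2⟩
    · rintro ⟨h1, h2⟩
      refine ⟨⟨h1.trans hl.suffix, h2⟩, ?_⟩
      rintro rfl
      exact hl.ne (hl.suffix.eq_of_length_le h1.length_le)

/-- The transition function `tr`, with the target `w` for the key `c` at the words of `A`. -/
noncomputable def redirect (tr : ℕ → ℕ → ℕ) (ν : List ℕ → ℕ) (c w : ℕ) (A : Set (List ℕ))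
    (v c' : ℕ) : ℕ :=
  open Classical in if c' = c ∧ v ∈ ν '' A then w else tr v c'

theorem redirect_empty (tr : ℕ → ℕ → ℕ) (ν : List ℕ → ℕ) (c w : ℕ) :
    redirect tr ν c w ∅ = tr := by
  funext v c'; simp [redirect]

theorem redirect_insert (tr : ℕ → ℕ → ℕ) (ν : List ℕ → ℕ) (c w : ℕ) (A : Set (List ℕ))
    (z : List ℕ) : upd (redirect tr ν c w A) (ν z) c w = redirect tr ν c w (insert z A) := by
  funext v c'
  have h : v ∈ ν '' insert z A ↔ v = ν z ∨ v ∈ ν '' A := by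
    rw [Set.image_insert_eq, Set.mem_insert_iff]
  by_cases h1 : c' = c
  · by_cases h2 : v = ν z
    · rw [upd, if_pos ⟨h2, h1⟩, redirect, if_pos ⟨h1, h.2 (.inl h2)⟩]
    · by_cases h3 : v ∈ ν '' A
      · rw [upd, if_neg (by tauto), redirect, redirect, if_pos ⟨h1, h3⟩, if_pos ⟨h1, h.2 (.inr h3)⟩]
      · rw [upd, if_neg (by tauto), redirect, redirect, if_neg (by tauto), if_neg (by tauto)]
  · rw [upd, if_neg (by tauto), redirect, redirect, if_neg (by tauto), if_neg (by tauto)]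

end Automaton

/-! ### Walks along the suffix links -/

section Extension

variable {LEN LNK FST : ℕ → ℕ} {tr : ℕ → ℕ → ℕ} {S : Set ℕ} {U : List ℕ} {ν : List ℕ → ℕ}

/-- By `IsRep.closed_init`, a nonempty repeat extends a closed suffix of `U`; so only the words on
the link chain need to be tested. -/
theorem isRep_nil_of {c : ℕ} (h : ∀ x, x <:+ U → Closed U x → ¬ x ++ [c] <:+: U) :
    IsRep U c [] := by
  obtain ⟨y, hy⟩ := exists_isRep U c
  rcases hy.eq_nil_or with rfl | ⟨y', rfl⟩
  · exact hy
  · exact absurd hy.isInfix (h y' hy.closed_init.1 hy.closed_init.2)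

theorem isRep_of {c : ℕ} {z : List ℕ} (hz : z <:+ U) (hzc : z ++ [c] <:+: U)
    (h : ∀ x, x <:+ U → Closed U x → x ++ [c] <:+: U → x <:+ z) : IsRep U c (z ++ [c]) := by
  obtain ⟨y, hy⟩ := exists_isRep U c
  have h1 := hy.max _ (concat_suffix_concat.2 ⟨rfl, hz⟩) hzc
  rcases hy.eq_nil_or with rfl | ⟨y', rfl⟩
  · simp at h1
  · have h2 := h y' hy.closed_init.1 hy.closed_init.2 hy.isInfix
    have h3 := (concat_suffix_concat.1 h1).2
    rw [h3.eq_of_length_le h2.length_le]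
    exact hy

/-- The closed suffixes of `U` that cannot be extended by `c`. -/
def newEdges (U : List ℕ) (c : ℕ) : Set (List ℕ) :=
  {x | (x <:+ U ∧ Closed U x) ∧ ¬ x ++ [c] <:+: U}

/-- The closed suffixes of `U` whose extension by `c` has closure `q`. -/
def movedEdges (U : List ℕ) (c : ℕ) (q : List ℕ) : Set (List ℕ) :=
  {x | (x <:+ U ∧ Closed U x) ∧ IsCl U (x ++ [c]) q}

theorem Sam.image_iff (h : Sam LEN LNK FST tr S U ν) {A : Set (List ℕ)}
    (hA : A ⊆ {x | Closed U x}) {x : List ℕ} (hx : Closed U x) : ν x ∈ ν '' A ↔ x ∈ A := by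
  constructor
  · rintro ⟨x', hx', heq⟩
    rwa [← h.inj (hA hx') hx heq]
  · exact fun h => ⟨x, h, rfl⟩

theorem newEdges_sub (U : List ℕ) (c : ℕ) : newEdges U c ⊆ {x | Closed U x} := fun _ h => h.1.2
theorem movedEdges_sub (U : List ℕ) (c : ℕ) (q : List ℕ) : movedEdges U c q ⊆ {x | Closed U x} :=
  fun _ h => h.1.2

theorem redirect_of_not_mem {c w v c' : ℕ} {A : Set (List ℕ)} (h : c' ≠ c ∨ v ∉ ν '' A) :
    redirect tr ν c w A v c' = tr v c' := by
  rw [redirect, if_neg (by tauto)]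

theorem redirect_of_mem {c w v : ℕ} {A : Set (List ℕ)} (h : v ∈ ν '' A) :
    redirect tr ν c w A v c = w := by
  rw [redirect, if_pos ⟨rfl, h⟩]

/-- The repeat is a state already, so no class is split and only edges to `cur` are added. -/
theorem Sam.concat_closed (h : Sam LEN LNK FST tr S U ν) {c : ℕ} {y : List ℕ} (hy : IsRep U c y)
    (hyU : Closed U y) {cur : ℕ} (hcur : cur ∉ S) (hcur0 : cur ≠ 0) (htr : ∀ c', tr cur c' = 0) :
    Sam (Function.update LEN cur (U.length + 1)) (Function.update LNK cur (ν y))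
      (Function.update FST cur (U.length + 1)) (redirect tr ν c cur (newEdges U c))
      (insert cur S) (U ++ [c]) (extendStates U c y ν cur (ν y)) := by
  have hS : insert cur (insert (ν y) S) = insert cur S := by rw [Set.insert_eq_of_mem (h.mem hyU)]
  have hne : ∀ v ∈ S, v ≠ cur := fun v hv h' => hcur (h' ▸ hv)
  have hcurI : ∀ A : Set (List ℕ), A ⊆ {x | Closed U x} → cur ∉ ν '' A := by
    rintro A hA ⟨x, hx, rfl⟩
    exact hcur (h.mem (hA hx))
  rw [← hS]
  refine h.concat hy hyU.isCl hcur hcur0 (h.pos y hyU) (hne _ (h.mem hyU)).symm (.inr ⟨rfl, rfl⟩)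
    ?_ ?_ ?_ ?_ ?_ ?_ ?_ ?_ ?_ ?_ ?_ ?_ ?_ ?_ ?_ ?_
  · intro v hv; rw [Function.update_of_ne (hne v hv)]
  · simp
  · rw [Function.update_of_ne (hne _ (h.mem hyU)), h.len y hyU]
  · intro v hv; rw [Function.update_of_ne (hne v hv)]
  · simp
  · rw [Function.update_of_ne (hne _ (h.mem hyU))]
  · intro v hv _; rw [Function.update_of_ne (hne v hv)]
  · simp
  · rw [Function.update_of_ne (hne _ (h.mem hyU))]
  · intro h'; exact absurd rfl h'
  · intro x c' hx hcc
    refine redirect_of_not_mem ?_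
    rw [h.image_iff (newEdges_sub U c) hx]
    rcases hcc with hcc | hcc
    · exact .inl hcc
    · exact .inr fun h' => hcc h'.1.1
  · intro x hx hxU hn
    exact redirect_of_mem ⟨x, ⟨⟨hxU, hx⟩, hn⟩, rfl⟩
  · intro x w hx hxU hw hwq
    rw [redirect_of_not_mem, h.tr_cl x c w hx hw, hwq]
    rw [h.image_iff (newEdges_sub U c) hx]
    exact .inr fun h' => h'.2 hw.isInfix
  · intro x w hx hxU hw hwq
    rw [redirect_of_not_mem, h.tr_cl x c w hx hw]
    rw [h.image_iff (newEdges_sub U c) hx]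
    exact .inr fun h' => h'.2 hw.isInfix
  · intro c'
    rw [redirect_of_not_mem (.inr (hcurI _ (newEdges_sub U c))), htr]
  · intro c'; rfl

/-- The nested updates follow the order of the stores in `extendCmd`; in particular, the edges of
`q` are copied before any edge is redirected. -/
theorem Sam.concat_clone (h : Sam LEN LNK FST tr S U ν) {c : ℕ} {y q : List ℕ} (hy : IsRep U c y)
    (hq : IsCl U y q) (hyq : y ≠ q) {cur cl : ℕ} (hcur : cur ∉ S) (hcur0 : cur ≠ 0)
    (htr : ∀ c', tr cur c' = 0) (hcl : cl ∉ S) (hcl0 : cl ≠ 0) (hcc : cur ≠ cl) :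
    Sam (Function.update (Function.update LEN cur (U.length + 1)) cl y.length)
      (Function.update (Function.update (Function.update LNK cl (LNK (ν q))) (ν q) cl) cur cl)
      (Function.update (Function.update FST cur (U.length + 1)) cl (FST (ν q)))
      (redirect (fun v c' => if v = cl then redirect tr ν c cur (newEdges U c) (ν q) c' else
        redirect tr ν c cur (newEdges U c) v c') ν c cl (movedEdges U c q))
      (insert cur (insert cl S)) (U ++ [c]) (extendStates U c y ν cur cl) := by
  have hne : ∀ v ∈ S, v ≠ cur := fun v hv h' => hcur (h' ▸ hv)
  have hne' : ∀ v ∈ S, v ≠ cl := fun v hv h' => hcl (h' ▸ hv)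
  have hqS := h.mem hq.closed
  have hnotin : ∀ {v} (A : Set (List ℕ)), v ∉ S → A ⊆ {x | Closed U x} → v ∉ ν '' A := by
    rintro v A hv hA ⟨x, hx, rfl⟩
    exact hv (h.mem (hA hx))
  -- Otherwise `qc` would be a suffix of `q`. Hence the redirection does not touch the edges of `q`,
  -- which the clone has to share.
  have hqm : q ∉ movedEdges U c q := fun h' => by
    have := h'.2.suffix.length_le
    simp at this
  refine h.concat hy hq hcur hcur0 hcl0 hcc (.inl ⟨hcl, hyq⟩)
    ?_ ?_ ?_ ?_ ?_ ?_ ?_ ?_ ?_ ?_ ?_ ?_ ?_ ?_ ?_ ?_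
  · intro v hv; rw [Function.update_of_ne (hne' v hv), Function.update_of_ne (hne v hv)]
  · rw [Function.update_of_ne hcc, Function.update_self]
  · simp
  · intro v hv; rw [Function.update_of_ne (hne' v hv), Function.update_of_ne (hne v hv)]
  · rw [Function.update_of_ne hcc, Function.update_self]
  · simp
  · intro v hv hvq
    rw [Function.update_of_ne (hne v hv), Function.update_of_ne hvq,
      Function.update_of_ne (hne' v hv)]
  · simp
  · rw [Function.update_of_ne hcc.symm, Function.update_of_ne (hne' _ hqS).symm,
      Function.update_self]
  · intro _
    rw [Function.update_of_ne (hne _ hqS), Function.update_self]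
  · intro x c' hx hxc
    have hxS := h.mem hx
    rw [redirect_of_not_mem, if_neg (hne' _ hxS), redirect_of_not_mem]
    · rw [h.image_iff (newEdges_sub U c) hx]
      rcases hxc with hxc | hxc
      · exact .inl hxc
      · exact .inr fun h' => hxc h'.1.1
    · rw [h.image_iff (movedEdges_sub U c q) hx]
      rcases hxc with hxc | hxc
      · exact .inl hxc
      · exact .inr fun h' => hxc h'.1.1
  · intro x hx hxU hn
    have hxA : ν x ∈ ν '' newEdges U c := ⟨x, ⟨⟨hxU, hx⟩, hn⟩, rfl⟩
    rw [redirect_of_not_mem, if_neg (hne' _ (h.mem hx)), redirect_of_mem hxA]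
    rw [h.image_iff (movedEdges_sub U c q) hx]
    exact .inr fun h' => hn h'.2.isInfix
  · intro x w hx hxU hw hwq
    exact redirect_of_mem ⟨x, ⟨⟨hxU, hx⟩, hwq ▸ hw⟩, rfl⟩
  · intro x w hx hxU hw hwq
    rw [redirect_of_not_mem, if_neg (hne' _ (h.mem hx)), redirect_of_not_mem,
      h.tr_cl x c w hx hw]
    · rw [h.image_iff (newEdges_sub U c) hx]
      exact .inr fun h' => h'.2 hw.isInfix
    · rw [h.image_iff (movedEdges_sub U c q) hx]
      exact .inr fun h' => hwq (hw.unique h'.2)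
  · intro c'
    rw [redirect_of_not_mem (.inr (hnotin _ hcur (movedEdges_sub U c q))), if_neg hcc,
      redirect_of_not_mem (.inr (hnotin _ hcur (newEdges_sub U c))), htr]
  · intro c'
    rw [redirect_of_not_mem (.inr (hnotin _ hcl (movedEdges_sub U c q))), if_pos rfl]
    refine Eq.symm ((redirect_of_not_mem (.inr ?_)).trans (if_neg (hne' _ hqS)))
    rw [h.image_iff (movedEdges_sub U c q) hq.closed]
    exact hqm

/-- Add edges to `cur` along the suffix links from `p` on, up to a state with an edge for `d`. -/
def chainCmd : Cmd :=
  .loop (.and (.ne (.reg .p) (.const 0)) (.eq (.reg .u) (.const 0)))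
    (.set .v (.reg .p) ;; .set .c (.reg .d) ;; findCmd ;;
      .ite (.eq (.reg .u) (.const 0))
        (.set .w (.reg .cur) ;; insertCmd ;; .set .u (.const 0) ;;
          .set .p (.ld .LNK (.reg .p)))
        (.set .g (.const 0)))

/-- Redirect edges from `q` to `cl` along the suffix links from `p` on. -/
def redirectCmd : Cmd :=
  .loop (.and (.ne (.reg .p) (.const 0)) (.ne (.reg .g) (.const 0)))
    (.set .v (.reg .p) ;; .set .c (.reg .d) ;; findCmd ;;
      .ite (.eq (.ld .TG (.reg .u)) (.reg .q))
        (.store .TG (.reg .u) (.reg .cl) ;; .set .p (.ld .LNK (.reg .p)))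
        (.set .g (.const 0)))

/-- Extend the automaton by the symbol `d`. -/
def extendCmd : Cmd :=
  .set .cur (.reg .al) ;; .set .al (.succ (.reg .al)) ;;
  .store .LEN (.reg .cur) (.succ (.ld .LEN (.reg .last))) ;;
  .store .FST (.reg .cur) (.succ (.ld .LEN (.reg .last))) ;;
  .set .p (.reg .last) ;; .set .u (.const 0) ;; chainCmd ;;
  .ite (.eq (.reg .p) (.const 0))
    (.store .LNK (.reg .cur) (.const 1))
    (.set .q (.ld .TG (.reg .u)) ;;
      .ite (.eq (.ld .LEN (.reg .q)) (.succ (.ld .LEN (.reg .p))))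
        (.store .LNK (.reg .cur) (.reg .q))
        (.set .cl (.reg .al) ;; .set .al (.succ (.reg .al)) ;;
          .store .LEN (.reg .cl) (.succ (.ld .LEN (.reg .p))) ;;
          .store .FST (.reg .cl) (.ld .FST (.reg .q)) ;;
          .store .LNK (.reg .cl) (.ld .LNK (.reg .q)) ;;
          copyCmd ;;
          .store .LNK (.reg .q) (.reg .cl) ;; .store .LNK (.reg .cur) (.reg .cl) ;;
          .set .g (.const 1) ;; redirectCmd)) ;;
  .set .last (.reg .cur)

variable {α : Type*} [LinearOrder α] {T : List α} {lim : ℕ}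

/-- The words left behind, `R₀ \ R`, cannot be extended by the letter and receive an edge to `cur`.
Each of them is paid for by one unit of `R₀.ncard`, and the additional unit pays for the search that
succeeds. -/
theorem wp_chain {s : St α} {Q : St α → Prop} {B : ℕ} {S₀ : Set ℕ} {R₀ : Set (List ℕ)}
    (hSam : Sam LEN s.LNK FST tr S₀ U ν) (hS : S₀ ⊆ S)
    (hD : Dict s.LC s.RC s.KEY s.TG s.SB s.LH s.al B S tr) (hp : Cursor U ν s.p R₀)
    (hu : s.u = 0) (hd : s.d < 2 ^ B) (hcur : s.cur ≠ 0)
    (hal : ∀ LC RC KEY TG SB LH al A, Dict LC RC KEY TG SB LH al B S (redirect tr ν s.d s.cur A) →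
      A ⊆ {x | x <:+ U ∧ Closed U x} → al < lim)
    (hQ : ∀ v c u t r w p g al LC RC KEY TG SB LH tm R, Cursor U ν p R → R ⊆ R₀ →
      Dict LC RC KEY TG SB LH al B S (redirect tr ν s.d s.cur (R₀ \ R)) →
      (∀ x ∈ R₀ \ R, ¬ x ++ [s.d] <:+: U) →
      (p ≠ 0 → u < al ∧ TG u = tr p s.d ∧ tr p s.d ≠ 0) → s.al ≤ al →
      tm + 100 * (B + 1) * R.ncard ≤ s.tm + 100 * (B + 1) * (R₀.ncard + 1) + 10 →
      Q { s with v := v, c := c, u := u, t := t, r := r, w := w, p := p, g := g, al := al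
                 LC := LC, RC := RC, KEY := KEY, TG := TG, SB := SB, LH := LH, tm := tm }) :
    WP T lim chainCmd s Q := by
  have hR₀ := hp.sub
  -- The successful search ends the loop without moving `p`; the summand for `u = 0` makes the
  -- measure drop in this round too.
  refine wp_loop_of (fun k s' => ∃ v c u t r w p g al LC RC KEY TG SB LH tm R,
    Cursor U ν p R ∧ R ⊆ R₀ ∧ Dict LC RC KEY TG SB LH al B S (redirect tr ν s.d s.cur (R₀ \ R)) ∧
      (∀ x ∈ R₀ \ R, ¬ x ++ [s.d] <:+: U) ∧
      (u ≠ 0 → p ≠ 0 ∧ u < al ∧ TG u = tr p s.d ∧ tr p s.d ≠ 0) ∧ s.al ≤ al ∧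
      k = R.ncard + (if u = 0 then 1 else 0) ∧
      tm + 100 * (B + 1) * k ≤ s.tm + 100 * (B + 1) * (R₀.ncard + 1) ∧
      s' = { s with v := v, c := c, u := u, t := t, r := r, w := w, p := p, g := g, al := al
                    LC := LC, RC := RC, KEY := KEY, TG := TG, SB := SB, LH := LH, tm := tm })
    ?_ ?_ ?_ (R₀.ncard + 1) _ ?_
  · rintro k s' ⟨v, c, u, t, r, w, p, g, al, LC, RC, KEY, TG, SB, LH, tm, R, -, -, -, -, -, -, -, -, rfl⟩
    simp [Tst.ok]
  · rintro k s' ⟨v, c, u, t, r, w, p, g, al, LC, RC, KEY, TG, SB, LH, tm, R, hpR, hRR, hD, hA, huu,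
      hale, hk, htm, rfl⟩ hev
    simp only [Tst.ev, Ex.ev, St.get] at hev
    obtain ⟨hp0, rfl⟩ := hev
    rcases hpR with ⟨h0, -⟩ | ⟨z, hz, hzU, rfl, hRz⟩
    · exact absurd h0 hp0
    have hzS : ν z ∈ S := hS (hSam.mem hz)
    have hzR : z ∈ R := by rw [hRz]; exact ⟨List.suffix_refl z, hz⟩
    have htz : redirect tr ν s.d s.cur (R₀ \ R) (ν z) s.d = tr (ν z) s.d := by
      refine redirect_of_not_mem (.inr ?_)
      rw [hSam.image_iff (fun x hx => (hR₀ hx.1).2) hz]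
      exact fun h' => h'.2 hzR
    obtain ⟨hnext, hcard⟩ := hSam.cursor_next hz hzU
    rw [← hRz] at hnext hcard
    simp only [wp_seq, wp_set, Ex.ev, St.get, St.set, St.tick, Ex.size, Tst.size]
    refine wp_find (tr := _) hD hzS hd (fun t r tm' h0 hslot htm' => ?_)
      (fun t r u tm' hu0 hual hTG hne _ htm' => ?_)
    · rw [wp_ite]
      refine ⟨trivial, fun _ => ?_, fun h => absurd rfl h⟩
      simp only [wp_seq, wp_set, Ex.ev, St.get, St.set, St.tick, Ex.size, Tst.size]
      refine wp_insert (tr := _) hD hzS hd h0 hslot hcur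
        (hal _ _ _ _ _ _ _ _ hD fun x hx => hR₀ hx.1) ?_
      intro LC' RC' LH' tm'' hD' htm''
      rw [redirect_insert] at hD'
      have hset : insert z (R₀ \ R) = R₀ \ (R \ {z}) := by
        ext x
        simp only [Set.mem_insert_iff, Set.mem_sdiff, Set.mem_singleton_iff]
        constructor
        · rintro (rfl | ⟨h1, h2⟩)
          · exact ⟨hRR hzR, by simp⟩
          · exact ⟨h1, by tauto⟩
        · rintro ⟨h1, h2⟩
          by_cases hxz : x = z
          · exact .inl hxz
          · exact .inr ⟨h1, by tauto⟩
      rw [hset] at hD'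
      simp only [St.arr]
      refine ⟨k - 1, ?_, ν z, s.d, 0, t, r, s.cur, s.LNK (ν z), g, al + 1, LC', RC', _, _, _, LH',
        _, R \ {z}, hnext, Set.sdiff_subset.trans hRR, hD', ?_, fun h => absurd rfl h, by omega, ?_,
        ?_, rfl⟩
      · simp at hk; omega
      · intro x hx
        rw [← hset] at hx
        rcases hx with rfl | hx
        · intro hin
          rw [htz] at h0
          exact (hSam.tr_ne_zero_iff hz).2 hin h0
        · exact hA x hx
      · simp at hk ⊢; omega
      · obtain ⟨k, rfl⟩ : ∃ k', k = k' + 1 := ⟨k - 1, by simp at hk; omega⟩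
        simp only [Nat.add_sub_cancel]
        simp only at htm' htm''
        nlinarith
    · rw [wp_ite]
      refine ⟨trivial, fun h => absurd h hu0, fun _ => ?_⟩
      simp only [wp_set, Ex.ev, St.set, St.tick, Ex.size, Tst.size]
      simp only at hTG hne hual htm'
      rw [htz] at hTG hne
      refine ⟨k - 1, ?_, ν z, s.d, u, t, r, w, ν z, 0, al, LC, RC, KEY, TG, SB, LH,
        _, R, .inr ⟨z, hz, hzU, rfl, hRz⟩, hRR, hD, hA, fun _ => ⟨hp0, hual, hTG, hne⟩, hale, ?_,
        ?_, rfl⟩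
      · simp at hk; omega
      · simp [hu0] at hk ⊢; omega
      · obtain ⟨k, rfl⟩ : ∃ k', k = k' + 1 := ⟨k - 1, by simp at hk; omega⟩
        simp only [Nat.add_sub_cancel]
        nlinarith
  · rintro k s' ⟨v, c, u, t, r, w, p, g, al, LC, RC, KEY, TG, SB, LH, tm, R, hpR, hRR, hD, hA, huu,
      hale, hk, htm, rfl⟩ hev
    simp only [Tst.ev, Ex.ev, St.get] at hev
    simp only [St.tick, Ex.size, Tst.size]
    refine hQ _ _ _ _ _ _ _ _ _ _ _ _ _ _ _ _ R hpR hRR hD hA (fun hp0 => ?_) hale ?_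
    · exact (huu fun h => hev ⟨hp0, h⟩).2
    · have : 100 * (B + 1) * R.ncard ≤ 100 * (B + 1) * k := Nat.mul_le_mul_left _ (by omega)
      omega
  · refine ⟨s.v, s.c, s.u, s.t, s.r, s.w, s.p, s.g, s.al, s.LC, s.RC, s.KEY, s.TG, s.SB, s.LH, s.tm,
      R₀, hp, subset_rfl, ?_, by simp, fun h => absurd hu h, le_rfl, by simp [hu], le_rfl, rfl⟩
    rw [sdiff_self, Set.bot_eq_empty, redirect_empty]
    exact hD

/-- The links are compared on `R₀` only, since the links of `q` and of the new states are
overwritten before this loop runs. All words of the chain have an edge for the letter, so no search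
fails. -/
theorem wp_redirect {s : St α} {Q : St α → Prop} {B : ℕ} {S₀ : Set ℕ} {R₀ : Set (List ℕ)}
    {tr₀ : ℕ → ℕ → ℕ} {S' : Set ℕ}
    (hSam : Sam LEN LNK FST tr₀ S₀ U ν) (hS : S₀ ⊆ S')
    (hD : Dict s.LC s.RC s.KEY s.TG s.SB s.LH s.al B S' tr) (hp : Cursor U ν s.p R₀)
    (hg : s.g ≠ 0) (hd : s.d < 2 ^ B) (hcl : s.cl ≠ 0) (hal : s.al ≤ lim)
    (hne : ∀ x ∈ R₀, tr (ν x) s.d ≠ 0) (hLNK : ∀ x ∈ R₀, s.LNK (ν x) = LNK (ν x))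
    (hQ : ∀ v c u t r p g TG tm R, Cursor U ν p R → R ⊆ R₀ →
      Dict s.LC s.RC s.KEY TG s.SB s.LH s.al B S' (redirect tr ν s.d s.cl (R₀ \ R)) →
      (∀ x ∈ R₀ \ R, tr (ν x) s.d = s.q) →
      (∀ z, z ∈ R → (∀ x ∈ R, x <:+ z) → tr (ν z) s.d ≠ s.q) →
      tm + 100 * (B + 1) * R.ncard ≤ s.tm + 100 * (B + 1) * (R₀.ncard + 1) + 10 →
      Q { s with v := v, c := c, u := u, t := t, r := r, p := p, g := g, TG := TG, tm := tm }) :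
    WP T lim redirectCmd s Q := by
  have hR₀ := hp.sub
  refine wp_loop_of (fun k s' => ∃ v c u t r p g TG tm R,
    Cursor U ν p R ∧ R ⊆ R₀ ∧
      Dict s.LC s.RC s.KEY TG s.SB s.LH s.al B S' (redirect tr ν s.d s.cl (R₀ \ R)) ∧
      (∀ x ∈ R₀ \ R, tr (ν x) s.d = s.q) ∧
      (g = 0 → ∀ z, z ∈ R → (∀ x ∈ R, x <:+ z) → tr (ν z) s.d ≠ s.q) ∧
      k = R.ncard + (if g ≠ 0 then 1 else 0) ∧
      tm + 100 * (B + 1) * k ≤ s.tm + 100 * (B + 1) * (R₀.ncard + 1) ∧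
      s' = { s with v := v, c := c, u := u, t := t, r := r, p := p, g := g, TG := TG, tm := tm })
    ?_ ?_ ?_ (R₀.ncard + 1) _ ?_
  · rintro k s' ⟨v, c, u, t, r, p, g, TG, tm, R, -, -, -, -, -, -, -, rfl⟩
    simp [Tst.ok]
  · rintro k s' ⟨v, c, u, t, r, p, g, TG, tm, R, hpR, hRR, hD, hA, hgg, hk, htm, rfl⟩ hev
    simp only [Tst.ev, Ex.ev, St.get] at hev
    obtain ⟨hp0, hg0⟩ := hev
    rcases hpR with ⟨h0, -⟩ | ⟨z, hz, hzU, rfl, hRz⟩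
    · exact absurd h0 hp0
    have hzS : ν z ∈ S' := hS (hSam.mem hz)
    have hzR : z ∈ R := by rw [hRz]; exact ⟨List.suffix_refl z, hz⟩
    have htz : redirect tr ν s.d s.cl (R₀ \ R) (ν z) s.d = tr (ν z) s.d := by
      refine redirect_of_not_mem (.inr ?_)
      rw [hSam.image_iff (fun x hx => (hR₀ hx.1).2) hz]
      exact fun h' => h'.2 hzR
    obtain ⟨hnext, hcard⟩ := hSam.cursor_next hz hzU
    rw [← hRz] at hnext hcard
    simp only [wp_seq, wp_set, Ex.ev, St.get, St.set, St.tick, Ex.size, Tst.size]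
    refine wp_find (tr := _) hD hzS hd (fun t r tm' h0 hslot htm' => ?_)
      (fun t r u tm' hu0 hual hTG hne' hDu htm' => ?_)
    · simp only at h0
      rw [htz] at h0
      exact absurd h0 (hne z (hRR hzR))
    · simp only at hTG hne' hual htm' hDu
      rw [htz] at hTG hne'
      rw [wp_ite]
      refine ⟨trivial, fun hev => ?_, fun hev => ?_⟩
      · simp only [Tst.ev, Ex.ev, St.get, St.arr] at hev
        simp only [wp_seq, wp_store, wp_set, Ex.ev, St.get, St.set, St.arr, St.setArr, St.tick,
          Ex.size, Tst.size]
        refine ⟨by omega, ?_⟩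
        have hD' := hDu s.cl hcl
        rw [redirect_insert] at hD'
        have hset : insert z (R₀ \ R) = R₀ \ (R \ {z}) := by
          ext x
          simp only [Set.mem_insert_iff, Set.mem_sdiff, Set.mem_singleton_iff]
          constructor
          · rintro (rfl | ⟨h1, h2⟩)
            · exact ⟨hRR hzR, by simp⟩
            · exact ⟨h1, by tauto⟩
          · rintro ⟨h1, h2⟩
            by_cases hxz : x = z
            · exact .inl hxz
            · exact .inr ⟨h1, by tauto⟩
        rw [hset] at hD'
        refine ⟨k - 1, ?_, ν z, s.d, u, t, r, s.LNK (ν z), g, _, _, R \ {z}, ?_,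
          Set.sdiff_subset.trans hRR, hD', ?_, fun h => absurd h hg0, ?_, ?_, rfl⟩
        · simp [hg0] at hk; omega
        · rw [hLNK z (hRR hzR)]; exact hnext
        · intro x hx
          rw [← hset] at hx
          rcases hx with rfl | hx
          · rw [← hTG, hev]
          · exact hA x hx
        · simp [hg0] at hk ⊢; omega
        · obtain ⟨k, rfl⟩ : ∃ k', k = k' + 1 := ⟨k - 1, by simp [hg0] at hk; omega⟩
          simp only [Nat.add_sub_cancel]
          nlinarith
      · simp only [Tst.ev, Ex.ev, St.get, St.arr] at hev
        simp only [wp_set, Ex.ev, St.set, St.tick, Ex.size, Tst.size]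
        refine ⟨k - 1, ?_, ν z, s.d, u, t, r, ν z, 0, TG, _, R, .inr ⟨z, hz, hzU, rfl, hRz⟩, hRR, hD,
          hA, ?_, ?_, ?_, rfl⟩
        · simp [hg0] at hk; omega
        · intro _ z' hz' hall
          rw [hRz] at hz'
          have : z' = z := hz'.1.eq_of_length_le (hall z hzR).length_le
          rw [this, ← hTG]; exact hev
        · simp [hg0] at hk ⊢; omega
        · obtain ⟨k, rfl⟩ : ∃ k', k = k' + 1 := ⟨k - 1, by simp [hg0] at hk; omega⟩
          simp only [Nat.add_sub_cancel]
          nlinarith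
  · rintro k s' ⟨v, c, u, t, r, p, g, TG, tm, R, hpR, hRR, hD, hA, hgg, hk, htm, rfl⟩ hev
    simp only [Tst.ev, Ex.ev, St.get] at hev
    simp only [St.tick, Ex.size, Tst.size]
    refine hQ _ _ _ _ _ _ _ _ _ R hpR hRR hD hA ?_ ?_
    · by_cases hg0 : g = 0
      · exact hgg hg0
      · have hp0 : p = 0 := by tauto
        rcases hpR with ⟨-, rfl⟩ | ⟨z, hz, -, h0, -⟩
        · intro z hz; exact absurd hz (Set.notMem_empty z)
        · exact absurd (h0.symm.trans hp0) (hSam.pos z hz)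
    · have : 100 * (B + 1) * R.ncard ≤ 100 * (B + 1) * k := Nat.mul_le_mul_left _ (by omega)
      omega
  · refine ⟨s.v, s.c, s.u, s.t, s.r, s.p, s.g, s.TG, s.tm,
      R₀, hp, subset_rfl, ?_, by simp, fun h => absurd h hg, by simp [hg], le_rfl, rfl⟩
    rw [sdiff_self, Set.bot_eq_empty, redirect_empty]
    exact hD

end Extension

/-! ### Correctness and amortized cost of an extension -/

section Extension

variable {LEN LNK FST : ℕ → ℕ} {tr : ℕ → ℕ → ℕ} {S : Set ℕ} {U : List ℕ} {ν : List ℕ → ℕ}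

/-- Even between two insertions, all edges spell factors of the extended word. So the bounds on its
states and edges also apply midway. -/
theorem Sam.redirect_ne_zero (h : Sam LEN LNK FST tr S U ν) (hmem : ∀ v c, tr v c ≠ 0 → v ∈ S)
    {d cur : ℕ} {A : Set (List ℕ)} (hA : A ⊆ {x | x <:+ U ∧ Closed U x}) {v c : ℕ}
    (hvc : redirect tr ν d cur A v c ≠ 0) :
    ∃ x, Closed U x ∧ v = ν x ∧ x ++ [c] <:+: U ++ [d] := by
  rw [redirect] at hvc
  split_ifs at hvc with h1
  · obtain ⟨rfl, x, hx, rfl⟩ := h1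
    exact ⟨x, (hA hx).2, rfl, (concat_suffix_concat.2 ⟨rfl, (hA hx).1⟩).isInfix⟩
  · have hv := hmem v c hvc
    rw [h.states] at hv
    obtain ⟨x, hx, rfl⟩ := hv
    exact ⟨x, hx, rfl, isInfix_concat_of d ((h.tr_ne_zero_iff hx).1 hvc)⟩

theorem extendStates_of_closed {U : List ℕ} {c : ℕ} {y : List ℕ} {ν : List ℕ → ℕ} {cur yid : ℕ}
    {x : List ℕ} (hx : Closed U x) (hxy : x ≠ y) : extendStates U c y ν cur yid x = ν x := by
  have : x ≠ U ++ [c] := by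
    rintro rfl
    exact not_isInfix_self_concat U c hx.isInfix
  simp [extendStates, this, hxy]

theorem Sam.al_le_of_redirect (h : Sam LEN LNK FST tr S U ν) (hmem : ∀ v c, tr v c ≠ 0 → v ∈ S)
    {d cur : ℕ} {A : Set (List ℕ)} (hA : A ⊆ {x | x <:+ U ∧ Closed U x})
    {LC RC KEY TG SB LH : ℕ → ℕ} {al B : ℕ}
    (hD : Dict LC RC KEY TG SB LH al B (insert cur S) (redirect tr ν d cur A)) :
    al ≤ 5 * (U.length + 1) + 3 := by
  -- With `U ++ [d]` in the role of the repeat, `extendStates` adds `cur` as the only new state.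
  -- This is the numbering before a clone exists.
  have hν : ∀ x, Closed U x → ν x = extendStates U d (U ++ [d]) ν cur cur x := fun x hx =>
    (extendStates_of_closed hx fun h' => by
      have := hx.isInfix.length_le
      rw [h'] at this
      simp at this).symm
  have := hD.al_le_of_words (V := U ++ [d]) (extendStates U d (U ++ [d]) ν cur cur) ?_ ?_
  · simpa using this
  · rintro v (rfl | hv)
    · exact ⟨_, closed_self _, by simp [extendStates]⟩
    · rw [h.states] at hv
      obtain ⟨x, hx, rfl⟩ := hv
      exact ⟨x, hx.concat d, hν x hx⟩
  · intro v c hvc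
    obtain ⟨x, hx, rfl, h1⟩ := h.redirect_ne_zero hmem hA hvc
    exact ⟨x, hx.concat d, hν x hx, h1⟩

theorem Sam.al_le_of_copy (h : Sam LEN LNK FST tr S U ν) (hmem : ∀ v c, tr v c ≠ 0 → v ∈ S)
    {d cur cl : ℕ} {A : Set (List ℕ)} (hA : A ⊆ {x | x <:+ U ∧ Closed U x}) {y q : List ℕ}
    (hy : IsRep U d y) (hq : IsCl U y q) (hyq : y ≠ q)
    {LC RC KEY TG SB LH : ℕ → ℕ} {al B : ℕ} {tr' : ℕ → ℕ → ℕ}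
    (hD : Dict LC RC KEY TG SB LH al B (insert cl (insert cur S)) tr')
    (htr : ∀ v c, tr' v c ≠ 0 → redirect tr ν d cur A v c ≠ 0 ∨
      (v = cl ∧ redirect tr ν d cur A (ν q) c ≠ 0)) :
    al ≤ 5 * (U.length + 1) + 3 := by
  have hyU : ¬ Closed U y := fun hy => hyq (hy.isCl.unique hq)
  have hν : ∀ x, Closed U x → ν x = extendStates U d y ν cur cl x := fun x hx =>
    (extendStates_of_closed hx (by rintro rfl; exact hyU hx)).symm
  have hyν : cl = extendStates U d y ν cur cl y := by simp [extendStates, hy.ne]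
  have := hD.al_le_of_words (V := U ++ [d]) (extendStates U d y ν cur cl) ?_ ?_
  · simpa using this
  · rintro v (rfl | rfl | hv)
    · exact ⟨y, hy.closed, hyν⟩
    · exact ⟨_, closed_self _, by simp [extendStates]⟩
    · rw [h.states] at hv
      obtain ⟨x, hx, rfl⟩ := hv
      exact ⟨x, hx.concat d, hν x hx⟩
  · intro v c hvc
    rcases htr v c hvc with h1 | ⟨rfl, h1⟩
    · obtain ⟨x, hx, rfl, h2⟩ := h.redirect_ne_zero hmem hA h1
      exact ⟨x, hx.concat d, hν x hx, h2⟩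
    · obtain ⟨x, hx, hxq, h2⟩ := h.redirect_ne_zero hmem hA h1
      have := h.inj hq.closed hx hxq
      subst this
      exact ⟨y, hy.closed, hyν, (hq.concat_isInfix_iff c).2 h2⟩

/-- The remaining closed suffixes bound the closed suffixes of the extended word. -/
theorem closedSuffixes_le_of_rest {d : ℕ} (y : List ℕ) {R : Set (List ℕ)}
    (hR : R ⊆ {x | x <:+ U ∧ Closed U x}) (hy : IsRep U d y)
    (h : ∀ x, x <:+ U → Closed U x → Closed U (x ++ [d]) → x ∈ R) :
    closedSuffixes (U ++ [d]) (U ++ [d]) ≤ R.ncard + 3 := by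
  refine closedSuffixes_concat_le y R ((finite_closed_suffixes U U).subset hR) ?_
  intro z hz hzV hz0 hzV' hzy
  rcases List.suffix_concat_iff.1 hzV with rfl | ⟨x, rfl, hxU⟩
  · exact absurd rfl hz0
  · have hzU : Closed U (x ++ [d]) := by
      rcases (closed_concat_iff hy).1 hz with h1 | h1 | h1
      · exact h1
      · exact absurd h1 hzV'
      · exact absurd h1 hzy
    exact ⟨x, h x hxU (hzU.of_prefix (List.prefix_append x [d])) hzU, rfl⟩

/-- The automaton of `U` is stored in the state `s`. -/
def SamInv {α : Type*} (B : ℕ) (U : List ℕ) (s : St α) : Prop :=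
  ∃ S tr ν, Dict s.LC s.RC s.KEY s.TG s.SB s.LH s.al B S tr ∧
    Sam s.LEN s.LNK s.FST tr S U ν ∧ s.last = ν U ∧ ν [] = 1

variable {α : Type*} [LinearOrder α] {T : List α} {lim : ℕ}

/-- The potential is the number of closed suffixes, that is, the length of the link chain from
`last`. Each step of the two walks lowers the bound on its new value, which exceeds the unvisited
rest by at most three (`closedSuffixes_le_of_rest`). Copying is paid for by the growth of `al`. -/
theorem wp_extend {s : St α} {Q : St α → Prop} {B : ℕ} (h : SamInv B U s) (hd : s.d < 2 ^ B)
    (hlim : 5 * (U.length + 1) + 4 ≤ lim)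
    (hQ : ∀ al last v c u t r w x cur p q cl g LEN LNK FST LH LC RC KEY TG SB tm, ∀ s' : St α,
      s' = { s with al := al, last := last, v := v, c := c, u := u, t := t, r := r, w := w, x := x
                    cur := cur, p := p, q := q, cl := cl, g := g, LEN := LEN, LNK := LNK, FST := FST
                    LH := LH, LC := LC, RC := RC, KEY := KEY, TG := TG, SB := SB, tm := tm } →
      SamInv B (U ++ [s.d]) s' → s.al ≤ al →
      tm + 100 * (B + 1) * (closedSuffixes (U ++ [s.d]) (U ++ [s.d]) + s.al) ≤
        s.tm + 100 * (B + 1) * (closedSuffixes U U + al + 8) → Q s') :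
    WP T lim extendCmd s Q := by
  obtain ⟨S, tr, ν, hD, hS, hlast, hnil⟩ := h
  have hmem : ∀ v c, tr v c ≠ 0 → v ∈ S := fun v c => hD.mem_of_tr
  have hcur : s.al ∉ S := fun h => (hD.mem_lt h).2.ne rfl
  have hal0 : s.al ≠ 0 := by
    have := (hD.mem_lt (hS.mem (Closed.nil U))).2; omega
  have hD1 := hD.new
  have hall : s.al + 1 ≤ 5 * (U.length + 1) + 3 := by
    have := hS.al_le_of_redirect (d := s.d) (cur := s.al) (A := ∅) hmem (by simp)
      (by rw [redirect_empty]; exact hD1)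
    exact this
  have hlen := hS.len U (closed_self U)
  have htrcur : ∀ c', tr s.al c' = 0 := fun c' => by
    by_contra h0
    exact hcur (hmem _ _ h0)
  have hne : ∀ x, Closed U x → ν x ≠ s.al := fun x hx h' => hcur (h' ▸ hS.mem hx)
  simp only [extendCmd, wp_seq, wp_set, wp_store, Ex.ev, St.get, St.set, St.arr, St.setArr, St.tick,
    Ex.size]
  refine ⟨by omega, by omega, ?_⟩
  refine wp_chain (tr := tr) (ν := ν) (U := U) (R₀ := {x | x <:+ U ∧ Closed U x}) (S₀ := S)
    (B := B) hS (Set.subset_insert s.al S) hD1 (.inr ⟨U, closed_self U, List.suffix_refl U, hlast, rfl⟩)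
    rfl hd hal0 ?_ ?_
  · intro LC RC KEY TG SB LH al A hDA hA
    have := hS.al_le_of_redirect hmem hA hDA
    omega
  intro v c u t r w p g al LC RC KEY TG SB LH tm R hp hRR hD2 hnew hu hale htm
  dsimp only at hp hRR hD2 hnew hu hale htm ⊢
  rw [hlast, Function.update_of_ne (hne U (closed_self U)), hlen]
  rw [show {x | x <:+ U ∧ Closed U x}.ncard = closedSuffixes U U from rfl] at htm
  have hal2 := hS.al_le_of_redirect hmem Set.sdiff_subset hD2
  have hneweq : (∀ x ∈ R, x ++ [s.d] <:+: U) → {x | x <:+ U ∧ Closed U x} \ R = newEdges U s.d := by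
    intro hR
    ext x
    constructor
    · exact fun hx => ⟨hx.1, hnew x hx⟩
    · exact fun hx => ⟨hx.1, fun h' => hx.2 (hR x h')⟩
  rw [wp_ite]
  refine ⟨trivial, fun hev => ?_, fun hev => ?_⟩
  · simp only [Tst.ev, Ex.ev, St.get] at hev
    subst hev
    have hR0 : R = ∅ := by
      rcases hp with ⟨-, h⟩ | ⟨z, hz, -, h, -⟩
      · exact h
      · exact absurd h.symm (hS.pos z hz)
    subst hR0
    have hy : IsRep U s.d [] := isRep_nil_of fun x h1 h2 => hnew x ⟨⟨h1, h2⟩, id⟩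
    have hSam := hS.concat_closed hy (Closed.nil U) hcur hal0 htrcur
    rw [hneweq (by simp)] at hD2
    simp only [wp_store, Ex.ev, St.get, St.arr, St.setArr, St.tick,
      Ex.size, Tst.size]
    refine ⟨by omega, hQ _ _ _ _ _ _ _ _ _ _ _ _ _ _ _ _ _ _ _ _ _ _ _ _ _ rfl ?_
      (by omega) ?_⟩
    · refine ⟨_, _, _, hD2, by rw [hnil] at hSam; exact hSam, ?_, ?_⟩
      · simp [extendStates]
      · simp [extendStates]
    · have := closedSuffixes_le_of_rest (d := s.d) (U := U) [] (R := ∅) (by simp) hy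
        fun x h1 h2 h3 => absurd h3.isInfix (hnew x ⟨⟨h1, h2⟩, id⟩)
      simp only [Set.ncard_empty, mul_zero] at this htm
      have h6 := Nat.mul_le_mul_left (100 * (B + 1)) this
      nlinarith
  · simp only [Tst.ev, Ex.ev, St.get] at hev
    obtain ⟨z, hz, hzU, rfl, hRz⟩ := hp.resolve_left fun h => hev h.1
    obtain ⟨hu1, hu2, hu3⟩ := hu hev
    have hzc : z ++ [s.d] <:+: U := (hS.tr_ne_zero_iff hz).1 hu3
    have hRin : ∀ x ∈ R, x ++ [s.d] <:+: U := by
      intro x hx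
      rw [hRz] at hx
      exact (concat_suffix_concat.2 ⟨rfl, hx.1⟩).isInfix.trans hzc
    have hmax : ∀ x, x <:+ U → Closed U x → x ++ [s.d] <:+: U → x ∈ R := by
      intro x h1 h2 h3
      by_contra h4
      exact hnew x ⟨⟨h1, h2⟩, h4⟩ h3
    -- The walk stops at the longest closed suffix that has an edge for the letter, and its
    -- extension is the repeat.
    have hy : IsRep U s.d (z ++ [s.d]) := isRep_of hzU hzc fun x h1 h2 h3 => by
      have := hmax x h1 h2 h3
      rw [hRz] at this
      exact this.1
    obtain ⟨q, hq⟩ := exists_isCl hzc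
    have htq : TG u = ν q := hu2.trans (hS.tr_cl z s.d q hz hq)
    rw [hneweq hRin] at hD2
    simp only [wp_seq, wp_set, Ex.ev, St.get, St.set, St.arr, St.tick, Ex.size, Tst.size]
    rw [wp_ite]
    simp only [Tst.ev, Ex.ev, St.get, St.arr, htq]
    rw [Function.update_of_ne (hne q hq.closed), Function.update_of_ne (hne z hz),
      hS.len q hq.closed, hS.len z hz]
    refine ⟨trivial, fun hev2 => ?_, fun hev2 => ?_⟩
    -- The comparison of lengths decides whether the repeat is its own closure.
    · have hqy : z ++ [s.d] = q := hq.suffix.eq_of_length (by simp [hev2])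
      subst hqy
      have hSam := hS.concat_closed hy hq.closed hcur hal0 htrcur
      simp only [wp_store, Ex.ev, St.get, St.arr, St.setArr, St.tick, Ex.size, Tst.size]
      refine ⟨by omega, hQ _ _ _ _ _ _ _ _ _ _ _ _ _ _ _ _ _ _ _ _ _ _ _ _ _ rfl ?_
        (by omega) ?_⟩
      · refine ⟨_, _, _, hD2, hSam, ?_, ?_⟩
        · simp [extendStates]
        · rw [extendStates_of_closed (Closed.nil U) (by simp), hnil]
      · have := closedSuffixes_le_of_rest (d := s.d) (U := U) _ (hp.sub) hy
          fun x h1 h2 h3 => hmax x h1 h2 h3.isInfix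
        have h6 := Nat.mul_le_mul_left (100 * (B + 1)) this
        nlinarith
    · have hyq : z ++ [s.d] ≠ q := fun h => hev2 (by rw [← h]; simp)
      have hqS := hS.mem hq.closed
      have hcl : al ∉ S := fun h => absurd (hD.mem_lt h).2 (by omega)
      have hSam := hS.concat_clone hy hq hyq hcur hal0 htrcur hcl (by omega)
        (show s.al ≠ al by omega)
      have hclne : ∀ x, Closed U x → ν x ≠ al := fun x hx h' => hcl (h' ▸ hS.mem hx)
      have hD3 := hD2.new
      have hsub := fun x (hx : x ∈ newEdges U s.d) => hx.1
      have hnotin : ∀ {v} (A : Set (List ℕ)), v ∉ S → A ⊆ {x | Closed U x} → v ∉ ν '' A := by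
        rintro v A hv hA ⟨x, hx, rfl⟩
        exact hv (hS.mem (hA hx))
      have hclr : ∀ c', redirect tr ν s.d s.al (newEdges U s.d) al c' = 0 := fun c' => by
        rw [redirect_of_not_mem (.inr (hnotin _ hcl (newEdges_sub U s.d)))]
        by_contra h0
        exact hcl (hmem _ _ h0)
      have hclal : ∀ {LC RC KEY TG SB LH : ℕ → ℕ} {al' : ℕ} {tr' : ℕ → ℕ → ℕ},
          Dict LC RC KEY TG SB LH al' B (insert al (insert s.al S)) tr' →
          (∀ v c, tr' v c ≠ 0 → redirect tr ν s.d s.al (newEdges U s.d) v c ≠ 0 ∨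
          (v = al ∧ redirect tr ν s.d s.al (newEdges U s.d) (ν q) c ≠ 0)) →
          al' ≤ 5 * (U.length + 1) + 3 := fun h1 h2 =>
        hS.al_le_of_copy hmem hsub hy hq hyq h1 h2
      have hal3 := hclal hD3 fun v c h => .inl h
      simp only [wp_seq, wp_set, wp_store, Ex.ev, St.get, St.set, St.arr, St.setArr, St.tick,
        Ex.size, Tst.size]
      refine ⟨by omega, by omega, by omega, ?_⟩
      rw [Function.update_of_ne (hne z hz), Function.update_of_ne (hne q hq.closed), hS.len z hz]
      refine wp_copy (tr := _) hD3 (.inr (.inr hqS)) (.inl rfl) hclr ?_ ?_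
      · intro LC RC KEY TG SB LH al' tr' h1 h2
        have := hclal h1 h2
        omega
      intro v x c w t r u al' LC RC KEY TG SB LH tm' hD4 hale' htm'
      dsimp only at hD4 hale' htm' ⊢
      have hal4 := hclal hD4 (fun v c h => by
        split_ifs at h with hv
        · exact .inr ⟨hv, h⟩
        · exact .inl h)
      have hqlt : ν q < al := (hD.mem_lt hqS).2.trans_le (by omega)
      have htrC : ∀ x ∈ R, (if ν x = al then redirect tr ν s.d s.al (newEdges U s.d) (ν q) s.d
          else redirect tr ν s.d s.al (newEdges U s.d) (ν x) s.d) = tr (ν x) s.d := by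
        intro x hx
        have hxc := (hp.sub hx).2
        rw [if_neg (hclne x hxc), redirect_of_not_mem (.inr ?_)]
        rw [hS.image_iff (newEdges_sub U s.d) hxc]
        exact fun h => h.2 (hRin x hx)
      refine ⟨by omega, by omega, ?_⟩
      refine wp_redirect (U := U) (ν := ν) (tr₀ := tr) (S₀ := S) (B := B) (R₀ := R)
        (S' := insert al (insert s.al S)) hS ?_ hD4 hp one_ne_zero hd ?_ ?_ ?_ ?_ ?_
      · exact (Set.subset_insert _ _).trans (Set.subset_insert _ _)
      · dsimp only; omega
      · dsimp only; omega
      · intro x hx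
        dsimp only
        rw [htrC x hx]
        exact (hS.tr_ne_zero_iff (hp.sub hx).2).2 (hRin x hx)
      · intro x hx
        have hxc := (hp.sub hx).2
        dsimp only
        rw [Function.update_of_ne (hne x hxc), Function.update_of_ne, Function.update_of_ne
          (hclne x hxc)]
        -- `q` is longer than all words of `R`, so the walk never follows its overwritten link.
        intro h'
        have := hS.inj hxc hq.closed h'
        rw [hRz] at hx
        have h1 := hx.1.length_le
        have h2 := hq.suffix.length_le
        rw [this] at h1
        simp at h2
        omega
      intro v c u t r p g TG tm'' R₂ hp2 hRR2 hD5 hmv hfin htm''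
      dsimp only at hp2 hRR2 hD5 hmv hfin htm'' ⊢
      -- If the extension of some `x` in `R₂` had closure `q`, so would the extensions of all longer
      -- words of the chain up to `z`, and the loop would not have stopped at the top of `R₂`.
      have hmoved : R \ R₂ = movedEdges U s.d q := by
        ext x
        constructor
        · intro hx
          have hxR := hp.sub hx.1
          refine ⟨hxR, ?_⟩
          have h1 := hmv x hx
          rw [htrC x hx.1] at h1
          obtain ⟨w, hw⟩ := exists_isCl (hRin x hx.1)
          rw [hS.tr_cl x _ w hxR.2 hw] at h1
          rwa [hS.inj hw.closed hq.closed h1] at hw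
        · rintro ⟨⟨h1, h2⟩, h3⟩
          refine ⟨hmax x h1 h2 h3.isInfix, fun hx => ?_⟩
          rcases hp2 with ⟨-, h4⟩ | ⟨z₂, hz₂, hz₂U, -, h4⟩
          · rw [h4] at hx; exact hx
          · have hz₂R : z₂ ∈ R₂ := by rw [h4]; exact ⟨List.suffix_refl _, hz₂⟩
            refine hfin z₂ hz₂R (fun x hx => by rw [h4] at hx; exact hx.1) ?_
            have hz₂R' := hRR2 hz₂R
            rw [htrC z₂ hz₂R']
            rw [hRz] at hz₂R'
            rw [h4] at hx
            exact hS.tr_cl z₂ _ q hz₂ (h3.mid (concat_suffix_concat.2 ⟨rfl, hx.1⟩)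
              ((concat_suffix_concat.2 ⟨rfl, hz₂R'.1⟩).trans hq.suffix))
      rw [hmoved] at hD5
      refine hQ _ _ _ _ _ _ _ _ _ _ _ _ _ _ _ _ _ _ _ _ _ _ _ _ _ rfl ?_ (by omega) ?_
      · rw [Set.insert_comm] at hD5
        rw [List.length_append, List.length_singleton] at hSam
        refine ⟨_, _, _, hD5, hSam, ?_, ?_⟩
        · simp [extendStates]
        · rw [extendStates_of_closed (Closed.nil U) (by simp), hnil]
      · have := closedSuffixes_le_of_rest (d := s.d) (U := U) _ (hRR2.trans hp.sub) hy
          fun x h1 h2 h3 => ?_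
        · have h6 := Nat.mul_le_mul_left (100 * (B + 1)) this
          have h7 : 80 * (B + 1) * al' + 80 * (B + 1) * 0 ≤ 100 * (B + 1) * al' + 0 := by nlinarith
          obtain ⟨e, rfl⟩ := Nat.exists_eq_add_of_le hale'
          obtain ⟨e', rfl⟩ := Nat.exists_eq_add_of_le hale
          have h8 : 80 * ((B + 1) * e) ≤ 100 * ((B + 1) * e) := by omega
          nlinarith
        · by_contra hx
          -- If `xd` is closed in `U` and its edge was redirected, then `xd = q`; but then `q` would
          -- be a suffix of the repeat, which is a proper suffix of `q`.
          have hxm : x ∈ movedEdges U s.d q := hmoved ▸ ⟨hmax x h1 h2 h3.isInfix, hx⟩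
          have hxq : x ++ [s.d] = q := h3.isCl.unique hxm.2
          have hle := hy.max (x ++ [s.d]) (concat_suffix_concat.2 ⟨rfl, h1⟩) h3.isInfix
          rw [hxq] at hle
          exact hyq (hq.suffix.eq_of_length_le hle.length_le)

end Extension

/-! ### Naming the symbols -/

section Sorting

variable {α : Type*} [LinearOrder α] {T : List α}

/-- Comparison of the symbols at the positions `a - 1` and `b - 1`. -/
def SLt (T : List α) (a b : ℕ) : Prop := ∃ x ∈ T[a - 1]?, ∃ y ∈ T[b - 1]?, x < y

theorem SLt.trans {a b c : ℕ} (h : SLt T a b) (h' : SLt T b c) : SLt T a c := by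
  obtain ⟨x, hx, y, hy, hxy⟩ := h
  obtain ⟨y', hy', z, hz, hyz⟩ := h'
  rw [Option.mem_def] at hy hy'
  rw [hy] at hy'
  cases hy'
  exact ⟨x, hx, z, hz, hxy.trans hyz⟩

theorem SLt.ne {a b : ℕ} (h : SLt T a b) : T[a - 1]? ≠ T[b - 1]? := by
  obtain ⟨x, hx, y, hy, hxy⟩ := h
  rw [Option.mem_def] at hx hy
  rw [hx, hy]
  exact fun h => hxy.ne (Option.some.inj h)

theorem eq_of_not_sLt {a b : ℕ} (ha : a - 1 < T.length) (hb : b - 1 < T.length)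
    (h : ¬ SLt T a b) (h' : ¬ SLt T b a) : T[a - 1]? = T[b - 1]? := by
  have h1 := List.getElem?_eq_getElem ha
  have h2 := List.getElem?_eq_getElem hb
  rw [h1, h2]
  congr 1
  by_contra hne
  rcases lt_or_gt_of_ne hne with hlt | hlt
  · exact h ⟨_, h1, _, h2, hlt⟩
  · exact h' ⟨_, h2, _, h1, hlt⟩

/-- `RP` sends the positions that are not represented in `P` to earlier ones with the same
symbol. -/
def RepOk {α : Type*} (T : List α) (RP : ℕ → ℕ) (P : ℕ → Prop) : Prop :=
  ∀ p < T.length, (RP p = p ∧ P (p + 1)) ∨ (RP p < p ∧ T[RP p]? = T[p]? ∧ ¬ P (p + 1))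

theorem RepOk.remove {α : Type*} {T : List α} {RP : ℕ → ℕ} {P P' : ℕ → Prop} (h : RepOk T RP P) {a b : ℕ} (ha : 0 < a)
    (hab : a < b) (heq : T[a - 1]? = T[b - 1]?) (hP : ∀ x, P' x ↔ P x ∧ x ≠ b) :
    RepOk T (Function.update RP (b - 1) (a - 1)) P' := by
  intro p hp
  by_cases hpb : p = b - 1
  · subst hpb
    rw [Function.update_self]
    refine .inr ⟨by omega, heq, fun h' => ((hP _).1 h').2 (by omega)⟩
  · rw [Function.update_of_ne hpb]
    rcases h p hp with ⟨h1, h2⟩ | ⟨h1, h2, h3⟩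
    · exact .inl ⟨h1, (hP _).2 ⟨h2, by omega⟩⟩
    · exact .inr ⟨h1, h2, fun h' => h3 ((hP _).1 h').1⟩

/-- A strictly sorted list contains each symbol at most once. This brings `σ` into the running time.
-/
theorem length_le_of_sorted {l : List ℕ} (h : l.Pairwise (SLt T)) (hb : ∀ a ∈ l, a - 1 < T.length) :
    l.length ≤ T.toFinset.card := by
  have hnd : (l.map fun a => T[a - 1]?).Nodup := by
    rw [List.Nodup, List.pairwise_map]
    exact h.imp fun h => h.ne
  have h1 := List.toFinset_card_of_nodup hnd
  rw [List.length_map] at h1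
  rw [← h1, ← Finset.card_map Function.Embedding.some (s := T.toFinset)]
  refine Finset.card_le_card fun o ho => ?_
  simp only [List.mem_toFinset, List.mem_map] at ho
  obtain ⟨a, ha, rfl⟩ := ho
  rw [List.getElem?_eq_getElem (hb a ha)]
  simp

/-- A linked list `l` from the dummy node `0` to its last node `t`. -/
def Seg (NX : ℕ → ℕ) : ℕ → List ℕ → ℕ → Prop
  | a, [], t => t = a
  | a, x :: l, t => NX a = x ∧ Seg NX x l t

theorem Seg.congr {NX NX' : ℕ → ℕ} {l : List ℕ} {t : ℕ} : ∀ {a : ℕ}, Seg NX a l t →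
    (∀ x ∈ (a :: l).dropLast, NX' x = NX x) → Seg NX' a l t := by
  induction l with
  | nil => exact fun h _ => h
  | cons x l ih =>
    rintro a ⟨h1, h2⟩ h
    rw [List.dropLast_cons_of_ne_nil (by simp)] at h
    exact ⟨by rw [h a (by simp), h1], ih h2 fun y hy => h y (List.mem_cons_of_mem _ hy)⟩

theorem Seg.eq_last {NX : ℕ → ℕ} {l : List ℕ} {t : ℕ} : ∀ {a : ℕ}, Seg NX a l t →
    a :: l = (a :: l).dropLast ++ [t] := by
  induction l with
  | nil => rintro a rfl; rfl
  | cons x l ih =>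
    rintro a ⟨-, h2⟩
    rw [List.dropLast_cons_of_ne_nil (by simp), List.cons_append, ← ih h2]

theorem Seg.update_last {NX : ℕ → ℕ} {l : List ℕ} {t a w : ℕ} (h : Seg NX a l t)
    (hnd : (a :: l).Nodup) : Seg (Function.update NX t w) a l t := by
  refine h.congr fun x hx => Function.update_of_ne ?_ _ _
  rintro rfl
  rw [h.eq_last] at hnd
  exact (List.nodup_append.1 hnd).2.2 _ hx _ (by simp) rfl

theorem Seg.snoc {NX : ℕ → ℕ} {l : List ℕ} {t w : ℕ} : ∀ {a : ℕ}, Seg NX a l t → NX t = w →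
    Seg NX a (l ++ [w]) w := by
  induction l with
  | nil => rintro a rfl h; exact ⟨h, rfl⟩
  | cons x l ih => rintro a ⟨h1, h2⟩ h; exact ⟨h1, ih h2 h⟩

theorem Seg.chain {NX : ℕ → ℕ} {l x : List ℕ} {t : ℕ} : ∀ {a : ℕ}, Seg NX a l t → (∀ b ∈ l, b ≠ 0) →
    LChain NX (NX t) x → LChain NX (NX a) (l ++ x) := by
  induction l with
  | nil => rintro a rfl _ h; exact h
  | cons y l ih =>
    rintro a ⟨rfl, h2⟩ h0 h
    exact ⟨rfl, h0 _ (by simp), ih h2 (fun b hb => h0 b (by simp [hb])) h⟩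

theorem nodup_cons_snoc {a b : ℕ} {l : List ℕ} (h : (a :: l).Nodup) (hb : b ≠ a) (hbl : b ∉ l) :
    (a :: (l ++ [b])).Nodup := by
  rw [← List.cons_append, ← List.concat_eq_append]
  exact h.concat (by simp [hb, hbl])

/-- Merge the lists `u` and `v`; the result is linked from the dummy node `0`. -/
def mergeCmd : Cmd :=
  .set .t (.const 0) ;;
  .loop (.and (.ne (.reg .u) (.const 0)) (.ne (.reg .v) (.const 0)))
    (.ite (.sl (.sub (.reg .u) (.const 1)) (.sub (.reg .v) (.const 1)))
      (.store .NX (.reg .t) (.reg .u) ;; .set .t (.reg .u) ;; .set .u (.ld .NX (.reg .u)))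
      (.ite (.sl (.sub (.reg .v) (.const 1)) (.sub (.reg .u) (.const 1)))
        (.store .NX (.reg .t) (.reg .v) ;; .set .t (.reg .v) ;; .set .v (.ld .NX (.reg .v)))
        (.store .RP (.sub (.reg .v) (.const 1)) (.sub (.reg .u) (.const 1)) ;;
          .set .v (.ld .NX (.reg .v))))) ;;
  .ite (.eq (.reg .u) (.const 0)) (.store .NX (.reg .t) (.reg .v)) (.store .NX (.reg .t) (.reg .u))

variable {lim : ℕ}

-- List nodes are positions plus one, so that `0` can serve as end mark and as dummy head. Of two
-- nodes with equal symbols, the one of the second list is dropped and refers to the other. Since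
-- all positions in `x` precede those in `y`, these references point backwards.
set_option maxHeartbeats 1000000 in
theorem wp_merge {s : St α} {Q : St α → Prop} {x y : List ℕ} {P : ℕ → Prop}
    (hlim : T.length < lim) (hx : LChain s.NX s.u x) (hy : LChain s.NX s.v y)
    (hxs : x.Pairwise (SLt T)) (hys : y.Pairwise (SLt T)) (hxy : ∀ a ∈ x, ∀ b ∈ y, a < b)
    (hb : ∀ a, a ∈ x ∨ a ∈ y → 0 < a ∧ a ≤ T.length) (hP : ∀ a, a ∈ x ∨ a ∈ y → P a)
    (hR : RepOk T s.RP P)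
    (hQ : ∀ z t u v NX RP tm, LChain NX (NX 0) z → z.Pairwise (SLt T) →
      (∀ a ∈ z, a ∈ x ∨ a ∈ y) → RepOk T RP (fun a => (P a ∧ a ∉ x ∧ a ∉ y) ∨ a ∈ z) →
      (∀ a, a ≠ 0 → a ∉ x → a ∉ y → NX a = s.NX a) → tm ≤ s.tm + 50 * (x.length + y.length) + 20 →
      Q { s with t := t, u := u, v := v, NX := NX, RP := RP, tm := tm }) :
    WP T lim mergeCmd s Q := by
  simp only [mergeCmd, wp_seq, wp_set, Ex.ev, St.set, St.tick, Ex.size]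
  refine wp_loop_of (fun k s' => ∃ l x' y' t u v NX RP tm, k = x'.length + y'.length ∧
      Seg NX 0 l t ∧ (0 :: l).Nodup ∧ LChain NX u x' ∧ LChain NX v y' ∧
      (l ++ x').Pairwise (SLt T) ∧ (l ++ y').Pairwise (SLt T) ∧
      (∀ a ∈ l, a ∈ x ∨ a ∈ y) ∧ (∀ a ∈ x', a ∈ x) ∧ (∀ a ∈ y', a ∈ y) ∧
      (∀ a ∈ l, a ∉ x' ∧ a ∉ y') ∧
      RepOk T RP (fun a => (P a ∧ a ∉ x ∧ a ∉ y) ∨ a ∈ l ∨ a ∈ x' ∨ a ∈ y') ∧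
      (∀ a, a ≠ 0 → a ∉ x → a ∉ y → NX a = s.NX a) ∧
      tm + 50 * k ≤ s.tm + 50 * (x.length + y.length) + 1 ∧
      s' = { s with t := t, u := u, v := v, NX := NX, RP := RP, tm := tm })
    ?_ ?_ ?_ (x.length + y.length) _ ?_
  · rintro k s' ⟨l, x', y', t, u, v, NX, RP, tm, -, -, -, -, -, -, -, -, -, -, -, -, -, -, rfl⟩
    simp [Tst.ok]
  · rintro k s' ⟨l, x', y', t, u, v, NX, RP, tm, rfl, hseg, hnd, hu, hv, hlx, hly, hl, hx', hy',
      hd, hR, hfr, htm, rfl⟩ hev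
    simp only [Tst.ev, Ex.ev, St.get] at hev
    obtain ⟨hu0, hv0⟩ := hev
    rcases x' with _ | ⟨a, x'⟩
    · exact absurd hu hu0
    rcases y' with _ | ⟨b, y'⟩
    · exact absurd hv hv0
    obtain ⟨rfl, -, hu⟩ := hu
    obtain ⟨rfl, -, hv⟩ := hv
    have hux := hx' u (by simp)
    have hvy := hy' v (by simp)
    have hub := hb u (.inl hux)
    have hvb := hb v (.inr hvy)
    have huv := hxy u hux v hvy
    have hul : u ∉ l := fun h => (hd u h).1 (by simp)
    have hvl : v ∉ l := fun h => (hd v h).2 (by simp)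
    have hxp := (List.pairwise_append.1 hlx).2.1
    have hyp := (List.pairwise_append.1 hly).2.1
    have hux' : u ∉ x' := fun h => ((List.pairwise_cons.1 hxp).1 u h).ne rfl
    have hvy' : v ∉ y' := fun h => ((List.pairwise_cons.1 hyp).1 v h).ne rfl
    have hxy' : ∀ a ∈ u :: x', a ∉ v :: y' := fun a h h' => (hxy a (hx' a h) a (hy' a h')).ne rfl
    have htl : t = 0 ∨ t ∈ l := by
      have := hseg.eq_last
      have h1 : t ∈ 0 :: l := by rw [this]; simp
      simpa using h1
    have htx : t ∉ u :: x' := by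
      rcases htl with rfl | h
      · exact fun h => absurd (hb 0 (.inl (hx' 0 h))).1 (by simp)
      · exact (hd t h).1
    have hty : t ∉ v :: y' := by
      rcases htl with rfl | h
      · exact fun h => absurd (hb 0 (.inr (hy' 0 h))).1 (by simp)
      · exact (hd t h).2
    have htlt : t < lim := by
      rcases htl with rfl | h
      · omega
      · have := hb t (hl t h); omega
    have htf : ∀ w a, a ≠ 0 → a ∉ x → a ∉ y → Function.update NX t w a = s.NX a := by
      intro w a h0 h1 h2
      rw [Function.update_of_ne, hfr a h0 h1 h2]
      rintro rfl
      rcases htl with h | h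
      · exact h0 h
      · rcases hl a h with h | h
        · exact h1 h
        · exact h2 h
    have hupd : ∀ (w : ℕ) (z : List ℕ), t ∉ z → ∀ a ∈ z, Function.update NX t w a = NX a := fun w z h a ha =>
      Function.update_of_ne (by rintro rfl; exact h ha) _ _
    rw [wp_ite]
    refine ⟨⟨by simp only [Ex.ev, St.get, St.tick]; omega,
      by simp only [Ex.ev, St.get, St.tick]; omega⟩, fun hlt => ?_, fun hlt => ?_⟩
    · replace hlt : SLt T u v := hlt
      simp only [wp_seq, wp_set, wp_store, Ex.ev, St.get, St.set, St.arr, St.setArr, St.tick,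
        Ex.size, Tst.size]
      refine ⟨htlt, _, ?_, l ++ [u], x', v :: y', u, _, v, _, RP, _, rfl, ?_, ?_, ?_, ?_, ?_, ?_,
        ?_, ?_, hy', ?_, ?_, htf u, ?_, rfl⟩
      · simp only [List.length_cons]; omega
      · exact (hseg.update_last hnd).snoc (Function.update_self _ _ _)
      · exact nodup_cons_snoc hnd hu0 hul
      · rw [hupd u _ htx u (by simp)]
        exact hu.congr (hupd u _ fun h => htx (List.mem_cons_of_mem _ h))
      · exact ⟨rfl, hv0, by
          rw [hupd u _ hty v (by simp)]
          exact hv.congr (hupd u _ fun h => hty (List.mem_cons_of_mem _ h))⟩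
      · simpa using hlx
      · rw [List.append_assoc, List.pairwise_append]
        refine ⟨(List.pairwise_append.1 hlx).1, ?_, ?_⟩
        · simp only [List.singleton_append]
          rw [List.pairwise_cons]
          refine ⟨?_, hyp⟩
          simp only [List.mem_cons]
          rintro c (rfl | hc)
          · exact hlt
          · exact hlt.trans ((List.pairwise_cons.1 hyp).1 c hc)
        · intro a ha c hc
          simp only [List.singleton_append, List.mem_cons] at hc
          rcases hc with rfl | hc
          · exact (List.pairwise_append.1 hlx).2.2 a ha c (by simp)
          · exact (List.pairwise_append.1 hly).2.2 a ha c (by simpa using hc)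
      · simp only [List.mem_append, List.mem_singleton]
        rintro a (h | rfl)
        · exact hl a h
        · exact .inl hux
      · exact fun a h => hx' a (List.mem_cons_of_mem _ h)
      · simp only [List.mem_append, List.mem_singleton]
        rintro a (h | rfl)
        · exact ⟨fun h' => (hd a h).1 (List.mem_cons_of_mem _ h'), (hd a h).2⟩
        · exact ⟨hux', hxy' a (by simp)⟩
      · convert hR using 3 with a
        simp only [List.mem_append, List.mem_cons]
        tauto
      · simp only [List.length_cons] at htm ⊢; omega
    · replace hlt : ¬ SLt T u v := hlt
      rw [wp_ite]
      refine ⟨⟨by simp only [Ex.ev, St.get, St.tick]; omega,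
        by simp only [Ex.ev, St.get, St.tick]; omega⟩, fun hlt' => ?_, fun hlt' => ?_⟩
      · replace hlt' : SLt T v u := hlt'
        simp only [wp_seq, wp_set, wp_store, Ex.ev, St.get, St.set, St.arr, St.setArr, St.tick,
          Ex.size, Tst.size]
        refine ⟨htlt, _, ?_, l ++ [v], u :: x', y', v, u, _, _, RP, _, rfl, ?_, ?_, ?_, ?_, ?_, ?_,
          ?_, hx', ?_, ?_, ?_, htf v, ?_, rfl⟩
        · simp only [List.length_cons]; omega
        · exact (hseg.update_last hnd).snoc (Function.update_self _ _ _)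
        · exact nodup_cons_snoc hnd hv0 hvl
        · exact ⟨rfl, hu0, by
            rw [hupd v _ htx u (by simp)]
            exact hu.congr (hupd v _ fun h => htx (List.mem_cons_of_mem _ h))⟩
        · rw [hupd v _ hty v (by simp)]
          exact hv.congr (hupd v _ fun h => hty (List.mem_cons_of_mem _ h))
        · rw [List.append_assoc, List.pairwise_append]
          refine ⟨(List.pairwise_append.1 hlx).1, ?_, ?_⟩
          · simp only [List.singleton_append]
            rw [List.pairwise_cons]
            refine ⟨?_, hxp⟩
            simp only [List.mem_cons]
            rintro c (rfl | hc)
            · exact hlt'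
            · exact hlt'.trans ((List.pairwise_cons.1 hxp).1 c hc)
          · intro a ha c hc
            simp only [List.singleton_append, List.mem_cons] at hc
            rcases hc with rfl | hc
            · exact (List.pairwise_append.1 hly).2.2 a ha c (by simp)
            · exact (List.pairwise_append.1 hlx).2.2 a ha c (by simpa using hc)
        · simpa using hly
        · simp only [List.mem_append, List.mem_singleton]
          rintro a (h | rfl)
          · exact hl a h
          · exact .inr hvy
        · exact fun a h => hy' a (List.mem_cons_of_mem _ h)
        · simp only [List.mem_append, List.mem_singleton]
          rintro a (h | rfl)
          · exact ⟨(hd a h).1, fun h' => (hd a h).2 (List.mem_cons_of_mem _ h')⟩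
          · exact ⟨fun h => hxy' a h (by simp), hvy'⟩
        · convert hR using 3 with a
          simp only [List.mem_append, List.mem_cons]
          tauto
        · simp only [List.length_cons] at htm ⊢; omega
      · replace hlt' : ¬ SLt T v u := hlt'
        have heq := eq_of_not_sLt (by omega) (by omega) hlt hlt'
        simp only [wp_seq, wp_set, wp_store, Ex.ev, St.get, St.set, St.arr, St.setArr, St.tick,
          Ex.size, Tst.size]
        refine ⟨by omega, _, ?_, l, u :: x', y', t, u, _, NX, _, _, rfl, hseg, hnd, ⟨rfl, hu0, hu⟩,
          hv, hlx, ?_, hl, hx', ?_, ?_, ?_, hfr, ?_, rfl⟩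
        · simp only [List.length_cons]; omega
        · refine hly.sublist ?_
          exact (List.Sublist.refl l).append (List.sublist_cons_self v y')
        · exact fun a h => hy' a (List.mem_cons_of_mem _ h)
        · exact fun a h => ⟨(hd a h).1, fun h' => (hd a h).2 (List.mem_cons_of_mem _ h')⟩
        · refine hR.remove hub.1 huv heq fun a => ?_
          simp only [List.mem_cons]
          constructor
          · rintro (h | h | h | h)
            · exact ⟨.inl h, fun h' => h.2.2 (h' ▸ hvy)⟩
            · exact ⟨.inr (.inl h), fun h' => hvl (h' ▸ h)⟩
            · refine ⟨.inr (.inr (.inl h)), ?_⟩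
              rintro rfl
              exact hxy' a (by simpa using h) (by simp)
            · exact ⟨.inr (.inr (.inr (.inr h))), fun h' => hvy' (h' ▸ h)⟩
          · tauto
        · simp only [List.length_cons] at htm ⊢; omega
  · rintro k s' ⟨l, x', y', t, u, v, NX, RP, tm, rfl, hseg, hnd, hu, hv, hlx, hly, hl, hx', hy',
      hd, hR, hfr, htm, rfl⟩ hev
    simp only [Tst.ev, Ex.ev, St.get, not_and, not_not] at hev
    have htl : t = 0 ∨ t ∈ l := by
      have := hseg.eq_last
      have h1 : t ∈ 0 :: l := by rw [this]; simp
      simpa using h1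
    have htx : t ∉ x' := by
      rcases htl with rfl | h
      · exact fun h => absurd (hb 0 (.inl (hx' 0 h))).1 (by simp)
      · exact (hd t h).1
    have hty : t ∉ y' := by
      rcases htl with rfl | h
      · exact fun h => absurd (hb 0 (.inr (hy' 0 h))).1 (by simp)
      · exact (hd t h).2
    have htlt : t < lim := by
      rcases htl with rfl | h
      · omega
      · have := hb t (hl t h); omega
    have htf : ∀ w a, a ≠ 0 → a ∉ x → a ∉ y → Function.update NX t w a = s.NX a := by
      intro w a h0 h1 h2
      rw [Function.update_of_ne, hfr a h0 h1 h2]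
      rintro rfl
      rcases htl with h | h
      · exact h0 h
      · rcases hl a h with h | h
        · exact h1 h
        · exact h2 h
    have hupd : ∀ (w : ℕ) (z : List ℕ), t ∉ z → ∀ a ∈ z, Function.update NX t w a = NX a := fun w z h a ha =>
      Function.update_of_ne (by rintro rfl; exact h ha) _ _
    have hl0 : ∀ b ∈ l, b ≠ 0 := fun b h => (hb b (hl b h)).1.ne'
    simp only [wp_ite, wp_store, Tst.ok, Tst.ev, Ex.ev, St.get, St.arr, St.setArr, St.tick,
        Ex.size, Tst.size]
    refine ⟨trivial, fun h0 => ⟨htlt, ?_⟩, fun h0 => ⟨htlt, ?_⟩⟩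
    · have hx0 : x' = [] := by
        rcases x' with _ | ⟨a, x'⟩
        · rfl
        · exact absurd (hu.1.symm.trans h0) hu.2.1
      subst hx0
      refine hQ (l ++ y') _ _ _ _ _ _ ((hseg.update_last hnd).chain hl0 ?_) hly ?_ ?_ (htf v)
        (by omega)
      · rw [Function.update_self]; exact hv.congr (hupd v _ hty)
      · intro a ha
        rcases List.mem_append.1 ha with h | h
        · exact hl a h
        · exact .inr (hy' a h)
      · simpa using hR
    · have hy0 : y' = [] := by
        rcases y' with _ | ⟨a, y'⟩
        · rfl
        · exact absurd (hv.1.symm.trans (hev h0)) hv.2.1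
      subst hy0
      refine hQ (l ++ x') _ _ _ _ _ _ ((hseg.update_last hnd).chain hl0 ?_) hlx ?_ ?_ (htf u)
        (by omega)
      · rw [Function.update_self]; exact hu.congr (hupd u _ htx)
      · intro a ha
        rcases List.mem_append.1 ha with h | h
        · exact hl a h
        · exact .inl (hx' a h)
      · simpa using hR
  · refine ⟨[], x, y, 0, s.u, s.v, s.NX, s.RP, s.tm + (0 + 1), rfl, rfl, by simp, hx, hy, by simpa,
      by simpa, by simp, fun _ h => h, fun _ h => h, by simp, ?_, fun _ _ _ _ => rfl, by omega, rfl⟩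
    convert hR using 2 with a
    constructor
    · rintro (h | h | h | h)
      · exact h.1
      · simp at h
      · exact hP _ (.inl h)
      · exact hP _ (.inr h)
    · intro h
      by_cases h1 : a ∈ x
      · exact .inr (.inr (.inl h1))
      · by_cases h2 : a ∈ y
        · exact .inr (.inr (.inr h2))
        · exact .inl ⟨h, h1, h2⟩

end Sorting

/-! ### Rounds of the merge sort and their cost -/

section Sorting

variable {α : Type*} [LinearOrder α] {T : List α}

/-- The blocks of the merge sort: strictly sorted lists of representatives. -/
structure Blocks (T : List α) (RP : ℕ → ℕ) (bl : List (List ℕ)) : Prop where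
  sorted : ∀ A ∈ bl, A.Pairwise (SLt T)
  order : bl.Pairwise (fun A B => ∀ a ∈ A, ∀ b ∈ B, a < b)
  bound : ∀ a ∈ bl.flatten, 0 < a ∧ a ≤ T.length
  rep : RepOk T RP (· ∈ bl.flatten)

theorem Blocks.merge {RP RP' : ℕ → ℕ} {outs rest : List (List ℕ)} {x y z : List ℕ}
    (h : Blocks T RP (outs ++ x :: y :: rest)) (hz : z.Pairwise (SLt T))
    (hzm : ∀ a ∈ z, a ∈ x ∨ a ∈ y)
    (hR : RepOk T RP' (fun a => (a ∈ (outs ++ x :: y :: rest).flatten ∧ a ∉ x ∧ a ∉ y) ∨ a ∈ z)) :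
    Blocks T RP' (outs ++ z :: rest) := by
  obtain ⟨o1, o2, o3⟩ := List.pairwise_append.1 h.order
  obtain ⟨o4, o5⟩ := List.pairwise_cons.1 o2
  obtain ⟨o6, o7⟩ := List.pairwise_cons.1 o5
  refine ⟨?_, ?_, ?_, ?_⟩
  · intro A hA
    simp only [List.mem_append, List.mem_cons] at hA
    rcases hA with hA | rfl | hA
    · exact h.sorted A (by simp [hA])
    · exact hz
    · exact h.sorted A (by simp [hA])
  · refine List.pairwise_append.2 ⟨o1, List.pairwise_cons.2 ⟨?_, o7⟩, ?_⟩
    · intro B hB a ha b hb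
      rcases hzm a ha with h1 | h1
      · exact o4 B (by simp [hB]) a h1 b hb
      · exact o6 B hB a h1 b hb
    · intro A hA B hB a ha b hb
      simp only [List.mem_cons] at hB
      rcases hB with rfl | hB
      · rcases hzm b hb with h1 | h1
        · exact o3 A hA x (by simp) a ha b h1
        · exact o3 A hA y (by simp) a ha b h1
      · exact o3 A hA B (by simp [hB]) a ha b hb
  · intro a ha
    simp only [List.flatten_append, List.flatten_cons, List.mem_append] at ha
    refine h.bound a ?_
    simp only [List.flatten_append, List.flatten_cons, List.mem_append]
    rcases ha with ha | ha | ha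
    · exact .inl ha
    · rcases hzm a ha with h1 | h1 <;> simp [h1]
    · simp [ha]
  · convert hR using 2 with a
    simp only [List.flatten_append, List.flatten_cons, List.mem_append]
    constructor
    · rintro (h1 | h1 | h1)
      · obtain ⟨A, hA, ha⟩ := List.mem_flatten.1 h1
        exact .inl ⟨.inl h1, fun h' => (o3 A hA x (by simp) a ha a h').ne rfl,
          fun h' => (o3 A hA y (by simp) a ha a h').ne rfl⟩
      · exact .inr h1
      · obtain ⟨A, hA, ha⟩ := List.mem_flatten.1 h1
        exact .inl ⟨.inr (.inr (.inr h1)), fun h' => (o4 A (by simp [hA]) a h' a ha).ne rfl,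
          fun h' => (o6 A hA a h' a ha).ne rfl⟩
    · tauto

/-- The two bounds behind the minimum in `sortCost`: the nodes are distinct positions, and a block
holds at most one node per symbol. -/
theorem Blocks.length_le {RP : ℕ → ℕ} {bl : List (List ℕ)} (h : Blocks T RP bl) :
    bl.flatten.length ≤ T.length ∧ bl.flatten.length ≤ bl.length * T.toFinset.card := by
  constructor
  · have hnd : bl.flatten.Nodup := by
      refine List.nodup_flatten.2 ⟨fun A hA => ?_, h.order.imp fun h a ha hb => ?_⟩
      · exact (h.sorted A hA).imp fun h => fun h' => h.ne (by rw [h'])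
      · exact (h a ha a hb).ne rfl
    rw [← List.toFinset_card_of_nodup hnd]
    refine (Finset.card_le_card (t := Finset.Icc 1 T.length) fun a ha => ?_).trans (by simp)
    have := h.bound a (by simpa using ha)
    rw [Finset.mem_Icc]; omega
  · rw [List.length_flatten]
    refine (List.sum_le_card_nsmul _ T.toFinset.card fun m hm => ?_).trans (by simp)
    obtain ⟨A, hA, rfl⟩ := List.mem_map.1 hm
    refine length_le_of_sorted (h.sorted A hA) fun a ha => ?_
    have := h.bound a (List.mem_flatten.2 ⟨A, hA, ha⟩)
    omega

/-- The lists `bl` start at the nodes `HD i`, `HD (i + 1)`, … -/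
def Chains (HD NX : ℕ → ℕ) (i : ℕ) (bl : List (List ℕ)) : Prop :=
  ∀ m A, bl[m]? = some A → LChain NX (HD (i + m)) A

theorem Chains.congr {HD NX HD' NX' : ℕ → ℕ} {i i' : ℕ} {bl : List (List ℕ)} (h : Chains HD NX i bl)
    (hHD : ∀ m < bl.length, HD' (i' + m) = HD (i + m)) (hNX : ∀ a ∈ bl.flatten, NX' a = NX a) :
    Chains HD' NX' i' bl := by
  intro m A hA
  obtain ⟨hm, rfl⟩ := List.getElem?_eq_some_iff.1 hA
  rw [hHD m hm]
  exact (h m _ hA).congr fun a ha => hNX a (List.mem_flatten.2 ⟨_, List.getElem_mem hm, ha⟩)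

theorem Chains.snoc {HD NX : ℕ → ℕ} {i : ℕ} {bl : List (List ℕ)} {z : List ℕ} (h : Chains HD NX i bl)
    (hz : LChain NX (HD (i + bl.length)) z) : Chains HD NX i (bl ++ [z]) := by
  intro m A hA
  rcases lt_trichotomy m bl.length with hm | rfl | hm
  · rw [List.getElem?_append_left hm] at hA
    exact h m A hA
  · simp at hA
    exact hA ▸ hz
  · rw [List.getElem?_eq_none (by simp; omega)] at hA
    cases hA

theorem Chains.tail {HD NX : ℕ → ℕ} {i : ℕ} {bl : List (List ℕ)} {z : List ℕ}
    (h : Chains HD NX i (z :: bl)) : LChain NX (HD i) z ∧ Chains HD NX (i + 1) bl := by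
  refine ⟨h 0 z rfl, fun m A hA => ?_⟩
  rw [show i + 1 + m = i + (m + 1) by omega]
  exact h (m + 1) A hA

/-- Merge pairs of adjacent blocks. -/
def passCmd : Cmd :=
  .set .i (.const 0) ;; .set .j (.const 0) ;;
  .loop (.lt (.reg .i) (.reg .k))
    (.set .u (.ld .HD (.reg .i)) ;; .set .v (.ld .HD (.succ (.reg .i))) ;; mergeCmd ;;
      .store .HD (.reg .j) (.ld .NX (.const 0)) ;; .set .i (.succ (.succ (.reg .i))) ;;
      .set .j (.succ (.reg .j))) ;;
  .store .HD (.reg .j) (.const 0) ;; .set .k (.reg .j)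

variable {lim : ℕ}

theorem wp_pass {s : St α} {Q : St α → Prop} {bl : List (List ℕ)} (hlim : T.length < lim)
    (hk : s.k = bl.length) (hkn : s.k ≤ T.length) (hk2 : 2 ≤ s.k) (hB : Blocks T s.RP bl)
    (hC : Chains s.HD s.NX 0 bl) (h0 : s.HD s.k = 0)
    (hQ : ∀ bl' i j k t u v HD NX RP tm, k = bl'.length → k = (s.k + 1) / 2 → Blocks T RP bl' →
      Chains HD NX 0 bl' → HD k = 0 → tm ≤ s.tm + 50 * (bl.flatten.length + s.k) →
      Q { s with i := i, j := j, k := k, t := t, u := u, v := v, HD := HD, NX := NX, RP := RP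
                 tm := tm }) :
    WP T lim passCmd s Q := by
  simp only [passCmd, wp_seq, wp_set, Ex.ev, St.get, St.set, St.tick, Ex.size]
  refine wp_loop_of (fun κ s' => ∃ outs ins i j t u v HD NX RP tm, κ = ins.length ∧
      outs.length = j ∧ i = 2 * j ∧ i ≤ s.k + 1 ∧ ins.length = s.k - i ∧ Chains HD NX 0 outs ∧
      Chains HD NX i ins ∧ HD s.k = 0 ∧ Blocks T RP (outs ++ ins) ∧
      tm + 50 * ins.flatten.length + 40 * ins.length ≤ s.tm + 50 * bl.flatten.length +
        40 * bl.length + 4 ∧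
      s' = { s with i := i, j := j, t := t, u := u, v := v, HD := HD, NX := NX, RP := RP
                    tm := tm })
    ?_ ?_ ?_ bl.length _ ?_
  · rintro κ s' ⟨outs, ins, i, j, t, u, v, HD, NX, RP, tm, -, -, -, -, -, -, -, -, -, -, rfl⟩
    simp [Tst.ok]
  · rintro κ s' ⟨outs, ins, i, j, t, u, v, HD, NX, RP, tm, rfl, hj, hij, hik, hil, hCo, hCi, h0, hB,
      htm, rfl⟩ hev
    simp only [Tst.ev, Ex.ev, St.get] at hev
    obtain ⟨x, y, rest, hx, hy, hC', hl, hB', hfl, hll⟩ : ∃ x y rest, LChain NX (HD i) x ∧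
        LChain NX (HD (i + 1)) y ∧ Chains HD NX (i + 2) rest ∧ rest.length = s.k - (i + 2) ∧
        Blocks T RP (outs ++ x :: y :: rest) ∧
        ins.flatten.length = x.length + y.length + rest.flatten.length ∧
        rest.length < ins.length := by
      rcases ins with _ | ⟨x, _ | ⟨y, rest⟩⟩
      · simp at hil; omega
      -- A last block without partner is merged with the empty list, because `HD` is `0` behind the
      -- last block.
      · simp only [List.length_cons, List.length_nil] at hil
        refine ⟨x, [], [], hCi.tail.1, ?_, ?_, by simp; omega, ?_, by simp, by simp⟩
        · rw [show i + 1 = s.k by omega]; exact h0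
        · intro m A hA; simp at hA
        · refine ⟨?_, ?_, ?_, ?_⟩
          · intro A hA
            simp only [List.mem_append, List.mem_cons] at hA
            rcases hA with hA | rfl | rfl | hA
            · exact hB.sorted A (by simp [hA])
            · exact hB.sorted A (by simp)
            · exact List.Pairwise.nil
            · simp at hA
          · rw [show outs ++ [x, []] = (outs ++ [x]) ++ [[]] by simp, List.pairwise_append]
            refine ⟨hB.order, by simp, ?_⟩
            intro A _ B hB a _ b hb
            simp only [List.mem_singleton] at hB
            subst hB
            simp at hb
          · simpa using hB.bound
          · simpa using hB.rep
      · have h1 := hCi.tail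
        have h2 := h1.2.tail
        simp only [List.length_cons] at hil
        exact ⟨x, y, rest, h1.1, h2.1, h2.2, by omega, hB, by simp [add_assoc], by simp⟩
    obtain ⟨o1, o2, o3⟩ := List.pairwise_append.1 hB'.order
    obtain ⟨o4, o5⟩ := List.pairwise_cons.1 o2
    obtain ⟨o6, o7⟩ := List.pairwise_cons.1 o5
    simp only [wp_seq, wp_set, wp_store, Ex.ev, St.get, St.set, St.arr, St.setArr, St.tick,
      Ex.size, Tst.size]
    refine wp_merge (x := x) (y := y) (P := (· ∈ (outs ++ x :: y :: rest).flatten)) hlim hx hy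
      (hB'.sorted x (by simp)) (hB'.sorted y (by simp)) (o4 y (by simp)) ?_ ?_ hB'.rep ?_
    · rintro a (h | h) <;> exact hB'.bound a (by simp [h])
    · rintro a (h | h) <;> simp [h]
    intro z t u v NX' RP' tm' hz hzs hzm hR hfr htm'
    dsimp only at hfr htm' ⊢
    have hnz : ∀ a ∈ (outs ++ x :: y :: rest).flatten, a ≠ 0 := fun a h => (hB'.bound a h).1.ne'
    refine ⟨by omega, rest.length, hll, outs ++ [z], rest, i + 1 + 1, j + 1, t, u, v,
      Function.update HD j (NX' 0), NX', RP', _, rfl, by simp [hj], by omega, by omega, hl, ?_, ?_,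
      ?_, ?_, ?_, rfl⟩
    · refine Chains.snoc (hCo.congr ?_ ?_) ?_
      · intro m hm
        rw [Function.update_of_ne (by omega)]
      · intro a ha
        have ha' := ha
        obtain ⟨A, hA, haA⟩ := List.mem_flatten.1 ha
        exact hfr a (hnz a (by simp only [List.flatten_append, List.mem_append]; exact .inl ha))
          (fun h' => (o3 A hA x (by simp) a haA a h').ne rfl)
          (fun h' => (o3 A hA y (by simp) a haA a h').ne rfl)
      · rw [hj, Nat.zero_add, Function.update_self]; exact hz
    -- Results are stored at index `j`, before all blocks still to be read, because `i = 2 * j`.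
    · refine hC'.congr ?_ ?_
      · intro m hm
        rw [Function.update_of_ne (by omega)]
      · intro a ha
        have ha' := ha
        obtain ⟨A, hA, haA⟩ := List.mem_flatten.1 ha
        exact hfr a (hnz a (by
          simp only [List.flatten_append, List.flatten_cons, List.mem_append]; simp [ha']))
          (fun h' => (o4 A (by simp [hA]) a h' a haA).ne rfl)
          (fun h' => (o6 A hA a h' a haA).ne rfl)
    · rw [Function.update_of_ne (by omega), h0]
    · simpa using hB'.merge hzs hzm hR
    · rw [hfl] at htm
      omega
  · rintro κ s' ⟨outs, ins, i, j, t, u, v, HD, NX, RP, tm, rfl, hj, hij, hik, hil, hCo, hCi, h0, hB,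
      htm, rfl⟩ hev
    simp only [Tst.ev, Ex.ev, St.get] at hev
    have hins : ins = [] := List.length_eq_zero_iff.1 (by omega)
    subst hins
    simp only [wp_store, Ex.ev, St.get, St.arr, St.setArr, St.tick, Ex.size, Tst.size]
    refine ⟨by omega, hQ outs _ _ _ _ _ _ _ _ _ _ hj.symm (by omega) (by simpa using hB) ?_
      (Function.update_self _ _ _) ?_⟩
    · refine hCo.congr (fun m hm => Function.update_of_ne (by omega) _ _) fun _ _ => rfl
    · simp only [List.flatten_nil, List.length_nil] at htm
      omega
  · exact ⟨[], bl, 0, 0, s.t, s.u, s.v, s.HD, s.NX, s.RP, _, rfl, rfl, rfl, by omega, by omega,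
      fun m A hA => by simp at hA, hC, h0, by simpa using hB, by omega, rfl⟩

/-- The number of steps of the merge sort with `k` blocks, up to a constant factor. -/
def sortCost (n σ k : ℕ) : ℕ :=
  if k < 2 then 0 else min (n + k) (k * (σ + 1)) + sortCost n σ ((k + 1) / 2)
termination_by k
decreasing_by omega

/-- A geometric series: a round costs at most `k * (σ + 1)`, and the number of blocks halves. -/
theorem sortCost_le_mul (n σ : ℕ) (k : ℕ) : sortCost n σ k ≤ 4 * (σ + 1) * (k - 1) := by
  induction k using Nat.strong_induction_on with
  | _ k ih =>
    rw [sortCost]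
    split_ifs with h
    · exact Nat.zero_le _
    · have h1 := ih ((k + 1) / 2) (by omega)
      have h2 := min_le_right (n + k) (k * (σ + 1))
      have h3 : k + 4 * ((k + 1) / 2 - 1) ≤ 4 * (k - 1) := by omega
      have h4 := Nat.mul_le_mul_left (σ + 1) h3
      nlinarith

/-- Each of the first `j` rounds is charged `n + k ≤ 2 * n`; the geometric bound takes over for the
roughly `k / 2 ^ j` blocks that remain. -/
theorem sortCost_le (n σ : ℕ) (j : ℕ) : ∀ k ≤ n,
    sortCost n σ k ≤ 2 * n * j + 4 * (σ + 1) * ((k - 1) / 2 ^ j) := by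
  induction j with
  | zero => intro k _; simpa using sortCost_le_mul n σ k
  | succ j ih =>
    intro k hk
    rw [sortCost]
    split_ifs with h
    · exact Nat.zero_le _
    · have h1 := ih ((k + 1) / 2) (by omega)
      have h2 := min_le_left (n + k) (k * (σ + 1))
      have h3 : ((k + 1) / 2 - 1) / 2 ^ j ≤ (k - 1) / 2 ^ (j + 1) := by
        rw [pow_succ, mul_comm, ← Nat.div_div_eq_div_mul]
        exact Nat.div_le_div_right (by omega)
      have h4 := Nat.mul_le_mul_left (4 * (σ + 1)) h3
      nlinarith

/-- The choice `j = log σ + 1` makes `2 ^ j` at least `σ + 1`, so the geometric part is linear as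
well. -/
theorem sortCost_le_log (n σ : ℕ) : sortCost n σ n ≤ 6 * n * (Nat.log 2 σ + 1) := by
  have h1 := sortCost_le n σ (Nat.log 2 σ + 1) n le_rfl
  have h2 : σ + 1 ≤ 2 ^ (Nat.log 2 σ + 1) := Nat.lt_pow_succ_log_self (by norm_num) σ
  have h3 := Nat.div_mul_le_self (n - 1) (2 ^ (Nat.log 2 σ + 1))
  have h4 := Nat.mul_le_mul_left ((n - 1) / 2 ^ (Nat.log 2 σ + 1)) h2
  have h5 : n * 1 ≤ n * (Nat.log 2 σ + 1) := Nat.mul_le_mul_left _ (by omega)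
  have h6 : n - 1 ≤ n := by omega
  nlinarith

end Sorting

/-! ### From sorted representatives to names -/

section Sorting

variable {α : Type*} [LinearOrder α] {T : List α}

/-- When at most one block is left, the representatives carry pairwise different symbols. An earlier
position with the symbol of a representative `p` would lead, along decreasing references, to a
second representative with that symbol. -/
theorem Blocks.first {RP : ℕ → ℕ} {bl : List (List ℕ)} (h : Blocks T RP bl) (hl : bl.length < 2) :
    ∀ p < T.length, (RP p = p ∧ ∀ a < p, T[a]? ≠ T[p]?) ∨ (RP p < p ∧ T[RP p]? = T[p]?) := by
  have hs : bl.flatten.Pairwise (fun a b => T[a - 1]? ≠ T[b - 1]?) := by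
    rcases bl with _ | ⟨A, _ | ⟨B, bl⟩⟩
    · simp
    · simpa using (h.sorted A (by simp)).imp fun h => h.ne
    · simp at hl
  have : Std.Symm (fun a b => T[a - 1]? ≠ T[b - 1]?) := ⟨fun _ _ h => h.symm⟩
  have hs' := fun {a b} ha hb => hs.forall (a := a) ha (b := b) hb
  intro p hp
  rcases h.rep p hp with ⟨h1, h2⟩ | ⟨h1, h2, -⟩
  · refine .inl ⟨h1, fun a => ?_⟩
    induction a using Nat.strong_induction_on with
    | _ a ih =>
      intro ha
      rcases h.rep a (ha.trans hp) with ⟨h3, h4⟩ | ⟨h3, h4, -⟩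
      · simpa using hs' h4 h2 (by omega)
      · rw [← h4]
        exact ih _ h3 (h3.trans ha)
  · exact .inr ⟨h1, h2⟩

/-- `NM` names the symbols of the first `m` positions by numbers from `1` to `cnt`. -/
structure Named (T : List α) (m : ℕ) (NM : ℕ → ℕ) (cnt : ℕ) : Prop where
  pos : ∀ i < m, 1 ≤ NM i
  le : ∀ i < m, NM i ≤ cnt
  iff : ∀ i < m, ∀ j < m, NM i = NM j ↔ T[i]? = T[j]?
  card : cnt = (T.take m).toFinset.card

theorem Named.new {m cnt : ℕ} {NM : ℕ → ℕ} (h : Named T m NM cnt) (hm : m < T.length)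
    (hT : ∀ a < m, T[a]? ≠ T[m]?) : Named T (m + 1) (Function.update NM m (cnt + 1)) (cnt + 1) := by
  refine ⟨fun i hi => ?_, fun i hi => ?_, fun i hi j hj => ?_, ?_⟩
  · by_cases him : i = m
    · simp [him]
    · rw [Function.update_of_ne him]; exact h.pos i (by omega)
  · by_cases him : i = m
    · simp [him]
    · rw [Function.update_of_ne him]; exact (h.le i (by omega)).trans (by omega)
  · by_cases him : i = m <;> by_cases hjm : j = m
    · simp [him, hjm]
    · rw [him, Function.update_self, Function.update_of_ne hjm]
      have := h.le j (by omega)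
      exact ⟨fun h' => by omega, fun h' => absurd h'.symm (hT j (by omega))⟩
    · rw [hjm, Function.update_self, Function.update_of_ne him]
      have := h.le i (by omega)
      exact ⟨fun h' => by omega, fun h' => absurd h' (hT i (by omega))⟩
    · rw [Function.update_of_ne him, Function.update_of_ne hjm]
      exact h.iff i (by omega) j (by omega)
  · rw [List.take_succ_eq_append_getElem hm, List.toFinset_append, List.toFinset_cons,
      List.toFinset_nil, Finset.union_insert, Finset.union_empty, Finset.card_insert_of_notMem,
      h.card]
    intro hmem
    rw [List.mem_toFinset] at hmem
    obtain ⟨a, ha, hae⟩ := List.mem_iff_getElem.1 hmem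
    rw [List.length_take] at ha
    rw [List.getElem_take] at hae
    refine hT a (by omega) ?_
    rw [List.getElem?_eq_getElem (by omega), List.getElem?_eq_getElem hm, hae]

theorem Named.old {m cnt r : ℕ} {NM : ℕ → ℕ} (h : Named T m NM cnt) (hm : m < T.length)
    (hr : r < m) (hT : T[r]? = T[m]?) : Named T (m + 1) (Function.update NM m (NM r)) cnt := by
  refine ⟨fun i hi => ?_, fun i hi => ?_, fun i hi j hj => ?_, ?_⟩
  · by_cases him : i = m
    · rw [him, Function.update_self]; exact h.pos r hr
    · rw [Function.update_of_ne him]; exact h.pos i (by omega)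
  · by_cases him : i = m
    · rw [him, Function.update_self]; exact h.le r hr
    · rw [Function.update_of_ne him]; exact h.le i (by omega)
  · by_cases him : i = m <;> by_cases hjm : j = m
    · simp [him, hjm]
    · rw [him, Function.update_self, Function.update_of_ne hjm, ← hT]
      exact h.iff r hr j (by omega)
    · rw [hjm, Function.update_self, Function.update_of_ne him, ← hT]
      exact h.iff i (by omega) r hr
    · rw [Function.update_of_ne him, Function.update_of_ne hjm]
      exact h.iff i (by omega) j (by omega)
  · rw [List.take_succ_eq_append_getElem hm, List.toFinset_append, List.toFinset_cons,
      List.toFinset_nil, Finset.union_insert, Finset.union_empty, Finset.insert_eq_of_mem, h.card]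
    rw [List.mem_toFinset, List.mem_iff_getElem]
    refine ⟨r, by rw [List.length_take]; omega, ?_⟩
    rw [List.getElem_take]
    rw [List.getElem?_eq_getElem (by omega), List.getElem?_eq_getElem hm] at hT
    exact Option.some.inj hT

/-- Name the symbols. -/
def nameCmd : Cmd :=
  .set .i (.const 0) ;;
  .loop (.lt (.reg .i) (.reg .n))
    (.store .HD (.reg .i) (.succ (.reg .i)) ;; .store .RP (.reg .i) (.reg .i) ;;
      .set .i (.succ (.reg .i))) ;;
  .set .k (.reg .n) ;;
  .loop (.lt (.const 1) (.reg .k)) passCmd ;;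
  .set .x (.const 0) ;; .set .i (.const 0) ;;
  .loop (.lt (.reg .i) (.reg .n))
    (.ite (.eq (.ld .RP (.reg .i)) (.reg .i))
        (.set .x (.succ (.reg .x)) ;; .store .NM (.reg .i) (.reg .x))
        (.store .NM (.reg .i) (.ld .NM (.ld .RP (.reg .i)))) ;;
      .set .i (.succ (.reg .i))) ;;
  .set .dol (.succ (.reg .x))

variable {lim : ℕ}

theorem blocks_init {RP : ℕ → ℕ} (hRP : ∀ m < T.length, RP m = m) :
    Blocks T RP ((List.range T.length).map fun m => [m + 1]) := by
  have hmem : ∀ a, a ∈ ((List.range T.length).map fun m => [m + 1]).flatten ↔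
      0 < a ∧ a ≤ T.length := by
    intro a
    simp only [List.mem_flatten, List.mem_map, List.mem_range]
    constructor
    · rintro ⟨l, ⟨m, hm, rfl⟩, h⟩
      simp at h; omega
    · intro h
      exact ⟨[a - 1 + 1], ⟨a - 1, by omega, rfl⟩, by simp; omega⟩
  refine ⟨?_, ?_, fun a ha => (hmem a).1 ha, ?_⟩
  · intro A hA
    obtain ⟨m, -, rfl⟩ := List.mem_map.1 hA
    simp
  · rw [List.pairwise_map]
    refine List.pairwise_lt_range.imp fun h => ?_
    simpa using h
  · exact fun p hp => .inl ⟨hRP p hp, (hmem _).2 (by omega)⟩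

theorem wp_nameInit {s : St α} {Q : St α → Prop} (hn : s.n = T.length) (hlim : T.length < lim)
    (hi : s.i = 0) (hHD : s.HD = fun _ => 0)
    (hQ : ∀ i HD RP tm, (∀ m, HD m = if m < T.length then m + 1 else 0) →
      (∀ m < T.length, RP m = m) → tm ≤ s.tm + 20 * T.length + 10 →
      Q { s with i := i, HD := HD, RP := RP, tm := tm }) :
    WP T lim (.loop (.lt (.reg .i) (.reg .n))
      (.store .HD (.reg .i) (.succ (.reg .i)) ;; .store .RP (.reg .i) (.reg .i) ;;
        .set .i (.succ (.reg .i)))) s Q := by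
  refine wp_loop_of (fun κ s' => ∃ i HD RP tm, i + κ = T.length ∧
    (∀ m, HD m = if m < i then m + 1 else 0) ∧ (∀ m < i, RP m = m) ∧ tm ≤ s.tm + 20 * i ∧
    s' = { s with i := i, HD := HD, RP := RP, tm := tm }) ?_ ?_ ?_ T.length _ ?_
  · rintro κ s' ⟨i, HD, RP, tm, -, -, -, -, rfl⟩
    simp [Tst.ok]
  · rintro κ s' ⟨i, HD, RP, tm, hκ, h1, h2, htm, rfl⟩ hev
    simp only [Tst.ev, Ex.ev, St.get, hn] at hev
    simp only [wp_seq, wp_set, wp_store, Ex.ev, St.get, St.set, St.arr, St.setArr, St.tick,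
      Ex.size, Tst.size]
    refine ⟨by omega, by omega, κ - 1, by omega, i + 1, _, _, _, by omega, ?_, ?_, ?_, rfl⟩
    · intro m
      by_cases hm : m = i
      · simp [hm]
      · rw [Function.update_of_ne hm, h1]
        congr 1
        simp only [eq_iff_iff]; omega
    · intro m hm
      by_cases hm' : m = i
      · simp [hm']
      · rw [Function.update_of_ne hm', h2 m (by omega)]
    · omega
  · rintro κ s' ⟨i, HD, RP, tm, hκ, h1, h2, htm, rfl⟩ hev
    simp only [Tst.ev, Ex.ev, St.get, hn] at hev
    have : i = T.length := by omega
    subst this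
    simp only [St.tick, Ex.size, Tst.size]
    exact hQ _ _ _ _ h1 h2 (by omega)
  · exact ⟨0, s.HD, s.RP, s.tm, by simp, by simp [hHD], by simp, by simp, by rw [← hi]⟩

theorem wp_sort {s : St α} {Q : St α → Prop} {bl : List (List ℕ)} (hlim : T.length < lim)
    (hk : s.k = bl.length) (hkn : s.k = T.length) (hB : Blocks T s.RP bl)
    (hC : Chains s.HD s.NX 0 bl) (h0 : s.HD s.k = 0)
    (hQ : ∀ bl' i j k t u v HD NX RP tm, bl'.length < 2 → Blocks T RP bl' →
      tm ≤ s.tm + 60 * sortCost T.length T.toFinset.card T.length + 10 →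
      Q { s with i := i, j := j, k := k, t := t, u := u, v := v, HD := HD, NX := NX, RP := RP
                 tm := tm }) :
    WP T lim (.loop (.lt (.const 1) (.reg .k)) passCmd) s Q := by
  refine wp_loop_of (fun κ s' => ∃ bl i j t u v HD NX RP tm, κ = bl.length ∧ κ ≤ T.length ∧
    Blocks T RP bl ∧ Chains HD NX 0 bl ∧ HD κ = 0 ∧
    tm + 60 * sortCost T.length T.toFinset.card κ ≤
      s.tm + 60 * sortCost T.length T.toFinset.card T.length ∧
    s' = { s with i := i, j := j, k := κ, t := t, u := u, v := v, HD := HD, NX := NX, RP := RP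
                  tm := tm }) ?_ ?_ ?_ T.length _ ?_
  · rintro κ s' ⟨bl, i, j, t, u, v, HD, NX, RP, tm, -, -, -, -, -, -, rfl⟩
    simp [Tst.ok]
  · rintro κ s' ⟨bl, i, j, t, u, v, HD, NX, RP, tm, hκ, hκn, hB, hC, h0, htm, rfl⟩ hev
    simp only [Tst.ev, Ex.ev, St.get] at hev
    simp only [St.tick, Ex.size, Tst.size]
    refine wp_pass (bl := bl) hlim hκ hκn (by show 2 ≤ κ; omega) hB hC h0 ?_
    intro bl' i j k t u v HD NX RP tm' h1 h2 hB' hC' h0' htm'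
    dsimp only at h2 htm' ⊢
    refine ⟨k, by omega, bl', i, j, t, u, v, HD, NX, RP, tm', h1, by omega, hB', hC', h0', ?_, rfl⟩
    rw [sortCost, if_neg (by omega), ← h2] at htm
    obtain ⟨h3, h4⟩ := hB.length_le
    have h5 : bl.flatten.length + κ ≤
        min (T.length + κ) (κ * (T.toFinset.card + 1)) := by
      refine le_min (by omega) ?_
      rw [mul_add, mul_one, hκ]
      omega
    omega
  · rintro κ s' ⟨bl, i, j, t, u, v, HD, NX, RP, tm, hκ, hκn, hB, hC, h0, htm, rfl⟩ hev
    simp only [Tst.ev, Ex.ev, St.get] at hev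
    simp only [St.tick, Ex.size, Tst.size]
    exact hQ bl _ _ _ _ _ _ _ _ _ _ (by omega) hB (by omega)
  · exact ⟨bl, s.i, s.j, s.t, s.u, s.v, s.HD, s.NX, s.RP, s.tm, by omega, le_rfl, hB, hC,
      hkn ▸ h0, le_rfl, by rw [← hkn]⟩

/-- References point backwards, so a scan from left to right finds the name of the referenced
position already assigned. -/
theorem wp_assignNames {s : St α} {Q : St α → Prop} (hn : s.n = T.length) (hlim : T.length < lim)
    (hi : s.i = 0) (hx : s.x = 0)
    (hRP : ∀ p < T.length, (s.RP p = p ∧ ∀ a < p, T[a]? ≠ T[p]?) ∨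
      (s.RP p < p ∧ T[s.RP p]? = T[p]?))
    (hQ : ∀ i x NM tm, Named T T.length NM x → tm ≤ s.tm + 30 * T.length + 10 →
      Q { s with i := i, x := x, NM := NM, tm := tm }) :
    WP T lim (.loop (.lt (.reg .i) (.reg .n))
      (.ite (.eq (.ld .RP (.reg .i)) (.reg .i))
          (.set .x (.succ (.reg .x)) ;; .store .NM (.reg .i) (.reg .x))
          (.store .NM (.reg .i) (.ld .NM (.ld .RP (.reg .i)))) ;;
        .set .i (.succ (.reg .i)))) s Q := by
  refine wp_loop_of (fun κ s' => ∃ i x NM tm, i + κ = T.length ∧ Named T i NM x ∧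
    tm ≤ s.tm + 30 * i ∧ s' = { s with i := i, x := x, NM := NM, tm := tm }) ?_ ?_ ?_ T.length _ ?_
  · rintro κ s' ⟨i, x, NM, tm, -, -, -, rfl⟩
    simp [Tst.ok]
  · rintro κ s' ⟨i, x, NM, tm, hκ, h1, htm, rfl⟩ hev
    simp only [Tst.ev, Ex.ev, St.get, hn] at hev
    simp only [wp_seq, wp_set, wp_store, wp_ite, Tst.ok, Tst.ev, Ex.ev, St.get, St.set, St.arr,
      St.setArr, St.tick, Ex.size, Tst.size]
    refine ⟨trivial, fun h => ⟨by omega, κ - 1, by omega, i + 1, _, _, _, by omega, ?_, ?_, rfl⟩,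
      fun h => ⟨by omega, κ - 1, by omega, i + 1, _, _, _, by omega, ?_, ?_, rfl⟩⟩
    · rcases hRP i hev with ⟨-, h2⟩ | ⟨h2, -⟩
      · exact h1.new hev h2
      · omega
    · omega
    · rcases hRP i hev with ⟨h2, -⟩ | ⟨h2, h3⟩
      · exact absurd h2 h
      · exact h1.old hev h2 h3
    · omega
  · rintro κ s' ⟨i, x, NM, tm, hκ, h1, htm, rfl⟩ hev
    simp only [Tst.ev, Ex.ev, St.get, hn] at hev
    have : i = T.length := by omega
    subst this
    simp only [St.tick, Ex.size, Tst.size]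
    exact hQ _ _ _ _ h1 (by omega)
  · exact ⟨0, 0, s.NM, s.tm, by simp, ⟨by simp, by simp, by simp, by simp⟩, by simp,
      by
      cases s; simp only at hi hx; subst hi hx; rfl⟩

theorem wp_name {s : St α} {Q : St α → Prop} (hn : s.n = T.length) (hlim : T.length < lim)
    (hHD : s.HD = fun _ => 0) (hNX : s.NX = fun _ => 0)
    (hQ : ∀ i j k t u v x HD NX RP NM tm, Named T T.length NM x →
      tm ≤ s.tm + 500 * (T.length * (Nat.log 2 T.toFinset.card + 1)) + 100 →
      Q { s with i := i, j := j, k := k, t := t, u := u, v := v, x := x, dol := x + 1, HD := HD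
                 NX := NX, RP := RP, NM := NM, tm := tm }) :
    WP T lim nameCmd s Q := by
  rw [nameCmd, wp_seq, wp_set, wp_seq]
  simp only [Ex.ev, St.set, St.tick, Ex.size]
  refine wp_nameInit hn hlim rfl hHD ?_
  intro i HD RP tm hHD hRP htm
  simp only [wp_seq, wp_set, Ex.ev, St.get, St.set, St.tick, Ex.size] at htm ⊢
  refine wp_sort (bl := (List.range T.length).map fun m => [m + 1]) hlim (by simp [hn]) hn
    (blocks_init hRP) ?_ ?_ ?_
  · intro m A hA
    simp only [List.getElem?_map, Option.map_eq_some_iff] at hA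
    obtain ⟨m', hm', rfl⟩ := hA
    obtain ⟨h1, h2⟩ := List.getElem?_eq_some_iff.1 hm'
    rw [List.length_range] at h1
    rw [List.getElem_range] at h2
    subst h2
    refine ⟨?_, by omega, ?_⟩
    · simp [hHD, h1]
    · simp [hNX, LChain]
  · simp [hHD, hn]
  intro bl i j k t u v HD NX RP tm' hbl hB htm'
  simp only at htm' ⊢
  refine wp_assignNames hn hlim rfl rfl (hB.first hbl) ?_
  intro i x NM tm'' hN htm''
  simp only at htm'' ⊢
  refine hQ _ _ _ _ _ _ _ _ _ _ _ _ hN ?_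
  have h1 := sortCost_le_log T.length T.toFinset.card
  have h2 : T.length * 1 ≤ T.length * (Nat.log 2 T.toFinset.card + 1) :=
    Nat.mul_le_mul_left _ (by omega)
  rw [mul_assoc] at h1
  omega

end Sorting

/-! ### Periods of the factors that start at a fixed position -/

section Periods

variable {N : ℕ → ℕ} {b l q : ℕ}

/-- `q` is a period of `N[b..b+l)`. -/
def Per (N : ℕ → ℕ) (b l q : ℕ) : Prop := ∀ i, i + q < l → N (b + i) = N (b + i + q)

/-- `q` is the minimum period of `N[b..b+l)`. -/
structure IsMinPer (N : ℕ → ℕ) (b l q : ℕ) : Prop where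
  pos : 1 ≤ q
  per : Per N b l q
  min : ∀ q', 1 ≤ q' → Per N b l q' → q ≤ q'

theorem per_self (N : ℕ → ℕ) (b l : ℕ) : Per N b l l := fun i h => by omega

theorem IsMinPer.le (h : IsMinPer N b l q) (hl : 1 ≤ l) : q ≤ l := h.min l hl (per_self N b l)

theorem exists_isMinPer (N : ℕ → ℕ) (b : ℕ) {l : ℕ} (hl : 1 ≤ l) : ∃ q, IsMinPer N b l q := by
  classical
  have h : ∃ q, 1 ≤ q ∧ Per N b l q := ⟨l, hl, per_self N b l⟩
  exact ⟨Nat.find h, (Nat.find_spec h).1, (Nat.find_spec h).2, fun q' h1 h2 =>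
    Nat.find_min' h ⟨h1, h2⟩⟩

theorem Per.mono {l' : ℕ} (h : Per N b l' q) (hl : l ≤ l') : Per N b l q :=
  fun i hi => h i (by omega)

theorem IsMinPer.mono {l' q' : ℕ} (h : IsMinPer N b l q) (h' : IsMinPer N b l' q') (hl : l ≤ l') :
    q ≤ q' := h.min q' h'.pos (h'.per.mono hl)

/-- The period `q` identifies `N[b+q..b+l)` with the prefix of length `l - q`, and a shift by `q'`
with a shift by `q' - q` in that prefix. -/
theorem Per.sub_iff (h : Per N b l q) {q' : ℕ} (hq : q ≤ q') :
    Per N b l q' ↔ Per N b (l - q) (q' - q) := by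
  refine forall_congr' fun i => ?_
  constructor
  · intro h' hi
    have h1 := h' (by omega)
    have h2 := h (i + (q' - q)) (by omega)
    rw [h1, show b + i + q' = b + (i + (q' - q)) + q by omega, ← h2, add_assoc]
  · intro h' hi
    have h1 := h' (by omega)
    have h2 := h (i + (q' - q)) (by omega)
    rw [h1, show b + i + q' = b + (i + (q' - q)) + q by omega, ← h2, add_assoc]

theorem per_succ_iff (hq : q ≤ l) :
    Per N b (l + 1) q ↔ Per N b l q ∧ N (b + (l - q)) = N (b + l) := by
  constructor
  · intro h
    refine ⟨h.mono (by omega), ?_⟩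
    rw [h (l - q) (by omega)]
    congr 1; omega
  · rintro ⟨h1, h2⟩ i hi
    by_cases hil : i + q < l
    · exact h1 i hil
    · rw [show i = l - q by omega, h2]
      congr 1; omega

/-- `q` is a period of `N[b..b+l)` and no smaller number is a period of `N[b..b+l]`. -/
structure PeriodCandidate (N : ℕ → ℕ) (b l q : ℕ) : Prop where
  pos : 1 ≤ q
  le : q ≤ l
  per : Per N b l q
  min : ∀ q', 1 ≤ q' → q' < q → ¬ Per N b (l + 1) q'

theorem IsMinPer.candidate (h : IsMinPer N b l q) (hl : 1 ≤ l) : PeriodCandidate N b l q :=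
  ⟨h.pos, h.le hl, h.per, fun q' h1 h2 h3 => absurd (h.min q' h1 (h3.mono (by omega))) (by omega)⟩

theorem PeriodCandidate.isMinPer (h : PeriodCandidate N b l q) (he : N (b + (l - q)) = N (b + l)) :
    IsMinPer N b (l + 1) q :=
  ⟨h.pos, (per_succ_iff h.le).2 ⟨h.per, he⟩, fun q' h1 h2 => by
    by_contra h3
    exact h.min q' h1 (by omega) h2⟩

theorem PeriodCandidate.isMinPer_succ (h : PeriodCandidate N b l l) (he : N b ≠ N (b + l)) :
    IsMinPer N b (l + 1) (l + 1) := by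
  refine ⟨by omega, per_self _ _ _, fun q' h1 h2 => ?_⟩
  by_contra h3
  rcases (show q' < l ∨ q' = l by omega) with h4 | rfl
  · exact h.min q' h1 h4 h2
  · have := ((per_succ_iff le_rfl).1 h2).2
    simp at this
    exact he this

/-- The correctness of following the failure function. If the new symbol refutes `q`, then a period
of the longer factor exceeds `q`; it is also a period at length `l`, hence `q` plus a period of the
prefix of length `l - q`. The least such number is `q + q'`. -/
theorem PeriodCandidate.next (h : PeriodCandidate N b l q) (hql : q < l)
    (he : N (b + (l - q)) ≠ N (b + l)) {q' : ℕ} (hq' : IsMinPer N b (l - q) q') :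
    PeriodCandidate N b l (q + q') := by
  have hle := hq'.le (by omega)
  refine ⟨by have := h.pos; omega, by omega, ?_, ?_⟩
  · rw [h.per.sub_iff (by omega), Nat.add_sub_cancel_left]
    exact hq'.per
  · intro p h1 h2 h3
    rcases lt_trichotomy p q with h4 | rfl | h4
    · exact h.min p h1 h4 h3
    · exact he ((per_succ_iff hql.le).1 h3).2
    · have h5 := (h.per.sub_iff h4.le).1 (h3.mono (by omega))
      have := hq'.min (p - q) (by omega) h5
      omega

end Periods

/-! ### Greedy phrases -/

section Greedy

variable {α : Type*} {T : List α} {N : ℕ → ℕ} {b l q h : ℕ}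

theorem factor_getElem? (T : List α) (b l i : ℕ) :
    (factor T b l)[i]? = if i < l then T[b + i]? else none := by
  rw [factor, List.getElem?_take]
  split_ifs
  · rw [List.getElem?_drop]
  · rfl

theorem factor_length (hbl : b + l ≤ T.length) : (factor T b l).length = l := by
  simp [factor]; omega

theorem factor_eq_iff {s p : ℕ} :
    factor T s p = factor T b p ↔ ∀ x < p, T[s + x]? = T[b + x]? := by
  constructor
  · intro h x hx
    have := congrArg (·[x]?) h
    simpa only [factor_getElem?, if_pos hx] using this
  · intro h
    refine List.ext_getElem? fun i => ?_
    rw [factor_getElem?, factor_getElem?]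
    split_ifs with hi
    · exact h i hi
    · rfl

theorem isPeriod_factor_iff (hN : ∀ i < T.length, ∀ j < T.length, N i = N j ↔ T[i]? = T[j]?)
    (hbl : b + l ≤ T.length) {p : ℕ} :
    IsPeriod (factor T b l) p ↔ 1 ≤ p ∧ p ≤ l ∧ Per N b l p := by
  rw [IsPeriod, factor_length hbl, List.hasPeriod_iff_getElem?, factor_length hbl]
  refine and_congr_right fun _ => and_congr_right fun _ => forall_congr' fun i => ?_
  constructor
  · intro h hi
    have := h (by omega)
    rw [factor_getElem?, factor_getElem?, if_pos (by omega), if_pos hi] at this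
    rw [hN _ (by omega) _ (by omega), this, add_assoc]
  · intro h hi
    have := h (by omega)
    rw [hN _ (by omega) _ (by omega)] at this
    rw [factor_getElem?, factor_getElem?, if_pos (by omega), if_pos (by omega), this, add_assoc]

theorem IsMinPer.minPeriod_eq (hq : IsMinPer N b l q)
    (hN : ∀ i < T.length, ∀ j < T.length, N i = N j ↔ T[i]? = T[j]?) (hl : 1 ≤ l)
    (hbl : b + l ≤ T.length) : minPeriod (factor T b l) = q := by
  refine IsLeast.csInf_eq ⟨?_, ?_⟩
  · exact (isPeriod_factor_iff hN hbl).2 ⟨hq.pos, hq.le hl, hq.per⟩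
  · intro p hp
    have := (isPeriod_factor_iff hN hbl).1 hp
    exact hq.min p this.1 this.2.2

/-- Sources exist exactly for the periods up to `m`, and minimum periods grow with the length, so
the condition on all `l'` reduces to that on `l`. The `1` in `max m 1` stands for runs of one
symbol, which need no source. -/
theorem isGreatest_candidate {H : List ℕ} {m : ℕ}
    (hN : ∀ i < T.length, ∀ j < T.length, N i = N j ↔ T[i]? = T[j]?)
    (hm : ∀ p, b + p ≤ T.length → ((∃ s, IsSource h T H b p s) ↔ p ≤ m)) (hl : 1 ≤ l)
    (hbl : b + l ≤ T.length) (hq : IsMinPer N b l q) (hqm : q ≤ max m 1)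
    (hmax : b + l = T.length ∨ ∃ q', IsMinPer N b (l + 1) q' ∧ max m 1 < q') :
    IsGreatest {l | IsCandidate h T H b l} l := by
  have key : ∀ l q, 1 ≤ l → b + l ≤ T.length → IsMinPer N b l q →
      (IsCandidate h T H b l ↔ q ≤ max m 1) := by
    intro l q hl hbl hq
    constructor
    · rintro ⟨-, -, h1 | h1⟩
      · have := hq.min 1 le_rfl ((isPeriod_factor_iff hN hbl).1 h1).2.2
        omega
      · have h2 := h1 l hl le_rfl
        rw [hq.minPeriod_eq hN hl hbl, hm q (by have := hq.le hl; omega)] at h2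
        omega
    · intro hqm
      refine ⟨hl, hbl, ?_⟩
      by_cases h1 : q = 1
      · subst h1
        exact .inl ((isPeriod_factor_iff hN hbl).2 ⟨le_rfl, hl, hq.per⟩)
      · refine .inr fun l' hl1 hl2 => ?_
        obtain ⟨q', hq'⟩ := exists_isMinPer N b hl1
        have h2 := hq'.mono hq hl2
        have h3 := hq'.le hl1
        have h4 := hq.pos
        rw [hq'.minPeriod_eq hN hl1 (by omega), hm q' (by omega)]
        omega
  refine ⟨(key l q hl hbl hq).2 hqm, fun l' hl' => ?_⟩
  by_contra hlt
  have hl1 := hl'.1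
  have hl2 := hl'.2.1
  rcases hmax with h1 | ⟨q', h1, h2⟩
  · omega
  · obtain ⟨q'', hq''⟩ := exists_isMinPer N b hl1
    have := (key l' q'' hl1 hl2 hq'').1 hl'
    have := h1.mono hq'' (by omega)
    omega

/-- The names of the symbols of `T[b..b+p)`. -/
def names (N : ℕ → ℕ) (b p : ℕ) : List ℕ := (List.range p).map fun x => N (b + x)

theorem names_succ (N : ℕ → ℕ) (b p : ℕ) : names N b (p + 1) = names N b p ++ [N (b + p)] := by
  simp [names, List.range_succ]

theorem names_length (N : ℕ → ℕ) (b p : ℕ) : (names N b p).length = p := by simp [names]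

theorem map_range_prefix {β : Type*} (f : ℕ → β) {m n : ℕ} (h : m ≤ n) :
    (List.range m).map f <+: (List.range n).map f := by
  obtain ⟨k, rfl⟩ := Nat.exists_eq_add_of_le h
  rw [List.range_add, List.map_append]
  exact List.prefix_append _ _

theorem prefix_map_range_iff {β : Type*} {f : ℕ → β} {n : ℕ} {P : List β} :
    P <+: (List.range n).map f ↔ ∃ m ≤ n, P = (List.range m).map f := by
  constructor
  · intro h
    have hl := h.length_le
    rw [List.length_map, List.length_range] at hl
    refine ⟨P.length, hl, ?_⟩
    exact (List.prefix_of_prefix_length_le h (map_range_prefix f hl) (by simp)).eq_of_length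
      (by simp)
  · rintro ⟨m, hm, rfl⟩
    exact map_range_prefix f hm

theorem names_suffix_iff {f : ℕ → ℕ} {p m : ℕ} :
    names N b p <:+ (List.range m).map f ↔
      ∃ s, s + p = m ∧ ∀ x < p, f (s + x) = N (b + x) := by
  constructor
  · intro h
    have hl := h.length_le
    rw [names_length, List.length_map, List.length_range] at hl
    obtain ⟨s, rfl⟩ := Nat.exists_eq_add_of_le' hl
    refine ⟨s, rfl, ?_⟩
    rw [List.range_add, List.map_append] at h
    have h2 : names N b p = ((List.range p).map (s + ·)).map f :=
      (List.suffix_of_suffix_length_le h (List.suffix_append _ _) (by simp [names])).eq_of_length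
        (by simp [names])
    rw [List.map_map, names, List.map_inj_left] at h2
    exact fun x hx => (h2 x (by simpa using hx)).symm
  · rintro ⟨s, rfl, h⟩
    rw [List.range_add, List.map_append]
    have h2 : names N b p = ((List.range p).map (s + ·)).map f := by
      rw [List.map_map, names, List.map_inj_left]
      exact fun x hx => (h x (by simpa using hx)).symm
    rw [h2]
    exact List.suffix_append _ _

/-- The text whose factors are the admissible occurrences: positions of height `h` are replaced
by a separator. -/
def admissible (N HT : ℕ → ℕ) (h dol b : ℕ) : List ℕ :=
  (List.range b).map fun i => if HT i < h then N i else dol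

theorem admissible_succ (N HT : ℕ → ℕ) (h dol b : ℕ) :
    admissible N HT h dol (b + 1) = admissible N HT h dol b ++ [if HT b < h then N b else dol] := by
  simp [admissible, List.range_succ]

/-- No name equals the separator, so an occurrence in the masked text avoids exactly the positions
that are too high. -/
theorem isSource_iff {HT : ℕ → ℕ} {dol p s : ℕ}
    (hN : ∀ i < T.length, ∀ j < T.length, N i = N j ↔ T[i]? = T[j]?)
    (hdol : ∀ i < T.length, N i ≠ dol) (hbp : b + p ≤ T.length) :
    IsSource h T ((List.range b).map HT) b p s ↔ s + p ≤ b ∧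
      names N b p <:+ (List.range (s + p)).map fun i => if HT i < h then N i else dol := by
  rw [IsSource, factor_eq_iff, names_suffix_iff]
  refine and_congr_right fun hs => ?_
  have hget : ∀ i, i < b → ((List.range b).map HT).getD i 0 = HT i := by
    intro i hi
    simp [List.getD_eq_getElem?_getD, hi]
  constructor
  · rintro ⟨h1, h2⟩
    refine ⟨s, rfl, fun x hx => ?_⟩
    have h3 := h2 (s + x) (by omega) (by omega)
    rw [hget _ (by omega)] at h3
    rw [if_pos h3, hN _ (by omega) _ (by omega)]
    exact h1 x hx
  · rintro ⟨s', hs', h1⟩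
    obtain rfl : s' = s := by omega
    have h2 : ∀ x < p, HT (s' + x) < h ∧ N (s' + x) = N (b + x) := by
      intro x hx
      have := h1 x hx
      split_ifs at this with h3
      · exact ⟨h3, this⟩
      · exact absurd this.symm (hdol _ (by omega))
    refine ⟨fun x hx => (hN _ (by omega) _ (by omega)).1 (h2 x hx).2, fun i hi1 hi2 => ?_⟩
    rw [hget _ (by omega)]
    obtain ⟨x, rfl⟩ := Nat.exists_eq_add_of_le hi1
    exact (h2 x (by omega)).1

theorem exists_isSource_iff {HT : ℕ → ℕ} {dol p : ℕ}
    (hN : ∀ i < T.length, ∀ j < T.length, N i = N j ↔ T[i]? = T[j]?)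
    (hdol : ∀ i < T.length, N i ≠ dol) (hbp : b + p ≤ T.length) :
    (∃ s, IsSource h T ((List.range b).map HT) b p s) ↔ names N b p <:+: admissible N HT h dol b := by
  simp only [isSource_iff hN hdol hbp]
  rw [infix_iff_exists_prefix]
  constructor
  · rintro ⟨s, h1, h2⟩
    exact ⟨_, map_range_prefix _ h1, h2⟩
  · rintro ⟨P, h1, h2⟩
    obtain ⟨m, hm, rfl⟩ := prefix_map_range_iff.1 h1
    have hl := h2.length_le
    rw [names_length, List.length_map, List.length_range] at hl
    obtain ⟨s, rfl⟩ := Nat.exists_eq_add_of_le' hl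
    exact ⟨s, hm, h2⟩

/-- All occurrences have the same length, so the least end belongs to the leftmost start. -/
theorem IsFirst.isLeast {HT : ℕ → ℕ} {dol p e : ℕ}
    (hf : IsFirst (admissible N HT h dol b) (names N b p) e)
    (hN : ∀ i < T.length, ∀ j < T.length, N i = N j ↔ T[i]? = T[j]?)
    (hdol : ∀ i < T.length, N i ≠ dol) (hbp : b + p ≤ T.length) :
    p ≤ e ∧ IsLeast {s | IsSource h T ((List.range b).map HT) b p s} (e - p) := by
  obtain ⟨⟨P, h1, h2, h3⟩, h4⟩ := hf
  obtain ⟨m, hm, rfl⟩ := prefix_map_range_iff.1 h1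
  simp only [List.length_map, List.length_range] at h3
  subst h3
  have hl := h2.length_le
  rw [names_length, List.length_map, List.length_range] at hl
  refine ⟨hl, ?_, fun s hs => ?_⟩
  · refine (isSource_iff hN hdol hbp).2 ⟨by omega, ?_⟩
    rwa [Nat.sub_add_cancel hl]
  · obtain ⟨h5, h6⟩ := (isSource_iff hN hdol hbp).1 hs
    have := h4 _ (map_range_prefix _ h5) h6
    simp only [List.length_map, List.length_range] at this
    omega

/-- Prefixes of factors are factors, so the matching lengths form an initial segment. -/
theorem exists_longest {U : List ℕ} (N : ℕ → ℕ) (b n : ℕ) (hb : b ≤ n) :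
    ∃ m, b + m ≤ n ∧ ∀ p, b + p ≤ n → (names N b p <:+: U ↔ p ≤ m) := by
  classical
  have h0 : names N b 0 <:+: U := by simp [names]
  have hP : ∀ p, names N b (p + 1) <:+: U → names N b p <:+: U := fun p hp => by
    rw [names_succ] at hp
    exact (List.prefix_append _ _).isInfix.trans hp
  have hmono : ∀ p p', p ≤ p' → names N b p' <:+: U → names N b p <:+: U := by
    intro p p' hpp
    induction p', hpp using Nat.le_induction with
    | base => exact id
    | succ p' _ ih => exact fun h => ih (hP _ h)
  refine ⟨Nat.findGreatest (fun p => names N b p <:+: U) (n - b), ?_, fun p hp => ⟨fun h => ?_,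
    fun h => hmono _ _ h (Nat.findGreatest_spec (P := fun p => names N b p <:+: U)
      (Nat.zero_le (n - b)) h0)⟩⟩
  · have := Nat.findGreatest_le (P := fun p => names N b p <:+: U) (n - b)
    omega
  · exact Nat.le_findGreatest (by omega) h

end Greedy

/-! ### Reading words that need not be closed -/

section Walk

variable {LEN LNK FST : ℕ → ℕ} {tr : ℕ → ℕ → ℕ} {S : Set ℕ} {U : List ℕ} {ν : List ℕ → ℕ}

theorem IsCl.concat_occ {x y : List ℕ} (h : IsCl U x y) (c : ℕ) {P : List ℕ} (hP : P <+: U) :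
    x ++ [c] <:+ P ↔ y ++ [c] <:+ P :=
  -- The appended letter `0` is arbitrary: only prefixes of `U` are considered.
  h.occ_concat (c := 0) c (hP.trans (List.prefix_append U [0]))

/-- A word and its closure have the same right extensions, so reading may continue from the state of
the closure. -/
theorem Sam.tr_of_isCl (h : Sam LEN LNK FST tr S U ν) {x y : List ℕ} (hy : IsCl U x y) (c : ℕ) :
    (tr (ν y) c = 0 ∧ ¬ x ++ [c] <:+: U) ∨
      ∃ w, IsCl U (x ++ [c]) w ∧ tr (ν y) c = ν w ∧ tr (ν y) c ≠ 0 := by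
  have hiff : x ++ [c] <:+: U ↔ y ++ [c] <:+: U := by
    simp only [infix_iff_exists_prefix]
    exact exists_congr fun P => and_congr_right fun hP => hy.concat_occ c hP
  by_cases h0 : tr (ν y) c = 0
  · exact .inl ⟨h0, fun h' => (h.tr_ne_zero_iff hy.closed).2 (hiff.1 h') h0⟩
  · obtain ⟨w, hw⟩ := exists_isCl ((h.tr_ne_zero_iff hy.closed).1 h0)
    exact .inr ⟨w, hw.congr fun P hP => (hy.concat_occ c hP).symm, h.tr_cl y c w hy.closed hw, h0⟩

end Walk

/-! ### Computing a phrase -/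

section Search

variable {α : Type*} [LinearOrder α] {T : List α} {lim : ℕ}

/-- Read names from position `b` on, as long as they spell a factor of the text of the
automaton. -/
def matchCmd : Cmd :=
  .loop (.and (.lt (.reg .e) (.reg .n)) (.ne (.reg .g) (.const 0)))
    (.set .c (.ld .NM (.reg .e)) ;; findCmd ;;
      .ite (.eq (.reg .u) (.const 0)) (.set .g (.const 0))
        (.set .v (.ld .TG (.reg .u)) ;; .set .e (.succ (.reg .e))))

/-- The state reached is always that of the closure of the word read. By `hm` the reading gets stuck
after `m` names unless the text ends there. -/
theorem wp_match {s : St α} {Q : St α → Prop} {B m : ℕ} {U : List ℕ} (hI : SamInv B U s)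
    (hB : ∀ i < s.n, s.NM i < 2 ^ B) (he : s.e = s.b) (hv : s.v = 1) (hg : s.g = 1)
    (hmn : s.b + m ≤ s.n) (hm : ∀ p, s.b + p ≤ s.n → (names s.NM s.b p <:+: U ↔ p ≤ m))
    (hQ : ∀ e v c t r u g tm, e = s.b + m → tm ≤ s.tm + 40 * (B + 1) * (m + 1) + 10 →
      Q { s with e := e, v := v, c := c, t := t, r := r, u := u, g := g, tm := tm }) :
    WP T lim matchCmd s Q := by
  obtain ⟨S, tr, ν, hD, hS, -, hnil⟩ := hI
  refine wp_loop_of (fun κ s' => ∃ p v c t r u g tm y, p ≤ m ∧ IsCl U (names s.NM s.b p) y ∧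
    v = ν y ∧ (g = 0 → p = m) ∧ κ = (m - p) + (if g ≠ 0 then 1 else 0) ∧
    tm + 40 * (B + 1) * κ ≤ s.tm + 40 * (B + 1) * (m + 1) ∧
    s' = { s with e := s.b + p, v := v, c := c, t := t, r := r, u := u, g := g, tm := tm })
    ?_ ?_ ?_ (m + 1) _ ?_
  · rintro κ s' ⟨p, v, c, t, r, u, g, tm, y, -, -, -, -, -, -, rfl⟩
    simp [Tst.ok]
  · rintro κ s' ⟨p, v, c, t, r, u, g, tm, y, hp, hy, rfl, hgm, hκ, htm, rfl⟩ hev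
    simp only [Tst.ev, Ex.ev, St.get] at hev
    obtain ⟨hpn, hg0⟩ := hev
    have hsucc := hm (p + 1) (by omega)
    rw [names_succ] at hsucc
    obtain ⟨κ, rfl⟩ : ∃ κ', κ = κ' + 1 := ⟨κ - 1, by simp [hg0] at hκ; omega⟩
    simp only [hg0, ne_eq, not_false_eq_true, if_true] at hκ
    simp only [wp_seq, wp_set, Ex.ev, St.get, St.set, St.arr, St.tick, Ex.size, Tst.size]
    refine wp_find (tr := tr) hD (hS.mem hy.closed) (hB _ hpn) (fun t r tm' h0 _ htm' => ?_)
      (fun t r u tm' hu0 _ hTG hne _ htm' => ?_)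
    · rw [wp_ite]
      refine ⟨trivial, fun _ => ?_, fun h => absurd rfl h⟩
      simp only [wp_set, Ex.ev, St.set, St.tick, Ex.size, Tst.size]
      simp only at h0 htm'
      have hpm : p = m := by
        rcases hS.tr_of_isCl hy (s.NM (s.b + p)) with ⟨-, h1⟩ | ⟨w, -, -, h1⟩
        · rw [hsucc] at h1; omega
        · exact absurd h0 h1
      refine ⟨m - p, by omega, p, ν y, _, t, r, 0, 0, _, y, hp, hy, rfl, fun _ => hpm, by simp, ?_,
        rfl⟩
      have hκ' : κ = m - p := by omega
      rw [hκ'] at htm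
      nlinarith
    · rw [wp_ite]
      refine ⟨trivial, fun h => absurd h hu0, fun _ => ?_⟩
      simp only [wp_seq, wp_set, Ex.ev, St.get, St.set, St.arr, St.tick, Ex.size, Tst.size]
      simp only at hTG hne htm'
      rcases hS.tr_of_isCl hy (s.NM (s.b + p)) with ⟨h1, -⟩ | ⟨w, hw, hw2, -⟩
      · exact absurd h1 hne
      · have hpm : p + 1 ≤ m := hsucc.1 hw.isInfix
        rw [← names_succ] at hw
        refine ⟨κ, by omega, p + 1, s.TG u, _, t, r, u, g, _, w, hpm, hw, hTG.trans hw2,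
          fun h => absurd h hg0, by simp [hg0]; omega, ?_, rfl⟩
        nlinarith
  · rintro κ s' ⟨p, v, c, t, r, u, g, tm, y, hp, hy, rfl, hgm, hκ, htm, rfl⟩ hev
    simp only [Tst.ev, Ex.ev, St.get, not_and, not_not] at hev
    simp only [St.tick, Ex.size, Tst.size]
    refine hQ _ _ _ _ _ _ _ _ ?_ ?_
    · by_cases hpn : s.b + p < s.n
      · rw [hgm (hev hpn)]
      · omega
    · have : 0 ≤ 40 * (B + 1) * κ := Nat.zero_le _
      omega
  · refine ⟨0, s.v, s.c, s.t, s.r, s.u, s.g, s.tm, [], Nat.zero_le _, ?_, hv.trans hnil.symm,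
      by simp [hg], by simp [hg], le_rfl, by rw [show s.b + 0 = s.e from he.symm]⟩
    simpa [names] using (Closed.nil U).isCl

/-- Read `f` names from position `b` on. -/
def locateCmd : Cmd :=
  .loop (.ne (.reg .f) (.const 0))
    (.set .c (.ld .NM (.reg .e)) ;; findCmd ;; .set .v (.ld .TG (.reg .u)) ;;
      .set .e (.succ (.reg .e)) ;; .set .f (.sub (.reg .f) (.const 1)))

/-- A word and its closure end at the same places, so `FST` of the state reached is correct for the
word itself. A second reading is needed since `matchCmd` has gone beyond the period. -/
theorem wp_locate {s : St α} {Q : St α → Prop} {B : ℕ} {U : List ℕ} (hI : SamInv B U s)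
    (hB : ∀ i < s.n, s.NM i < 2 ^ B) (he : s.e = s.b) (hv : s.v = 1)
    (hfn : s.b + s.f ≤ s.n) (hf : names s.NM s.b s.f <:+: U)
    (hQ : ∀ e v c t r u f tm, IsFirst U (names s.NM s.b s.f) (s.FST v) →
      tm ≤ s.tm + 40 * (B + 1) * s.f + 10 →
      Q { s with e := e, v := v, c := c, t := t, r := r, u := u, f := f, tm := tm }) :
    WP T lim locateCmd s Q := by
  obtain ⟨S, tr, ν, hD, hS, -, hnil⟩ := hI
  refine wp_loop_of (fun κ s' => ∃ p v c t r u tm y, p + κ = s.f ∧ IsCl U (names s.NM s.b p) y ∧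
    v = ν y ∧ tm ≤ s.tm + 40 * (B + 1) * p ∧
    s' = { s with e := s.b + p, v := v, c := c, t := t, r := r, u := u, f := κ, tm := tm })
    ?_ ?_ ?_ s.f _ ?_
  · rintro κ s' ⟨p, v, c, t, r, u, tm, y, -, -, -, -, rfl⟩
    simp [Tst.ok]
  · rintro κ s' ⟨p, v, c, t, r, u, tm, y, hp, hy, rfl, htm, rfl⟩ hev
    simp only [Tst.ev, Ex.ev, St.get] at hev
    have hin : names s.NM s.b p ++ [s.NM (s.b + p)] <:+: U := by
      rw [← names_succ]
      exact (map_range_prefix _ (by omega)).isInfix.trans hf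
    simp only [wp_seq, wp_set, Ex.ev, St.get, St.set, St.arr, St.tick, Ex.size, Tst.size]
    refine wp_find (tr := tr) hD (hS.mem hy.closed) (hB _ (by omega)) (fun t r tm' h0 _ htm' => ?_)
      (fun t r u tm' hu0 _ hTG hne _ htm' => ?_)
    · simp only at h0
      rcases hS.tr_of_isCl hy (s.NM (s.b + p)) with ⟨-, h1⟩ | ⟨w, -, -, h1⟩
      · exact absurd hin h1
      · exact absurd h0 h1
    · simp only at hTG hne htm' ⊢
      rcases hS.tr_of_isCl hy (s.NM (s.b + p)) with ⟨-, h1⟩ | ⟨w, hw, hw2, -⟩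
      · exact absurd hin h1
      · rw [← names_succ] at hw
        refine ⟨κ - 1, by omega, p + 1, s.TG u, _, t, r, u, _, w, by omega, hw, hTG.trans hw2, ?_,
          rfl⟩
        nlinarith
  · rintro κ s' ⟨p, v, c, t, r, u, tm, y, hp, hy, rfl, htm, rfl⟩ hev
    simp only [Tst.ev, Ex.ev, St.get, not_not] at hev
    obtain rfl : p = s.f := by omega
    simp only [St.tick, Ex.size, Tst.size]
    exact hQ _ _ _ _ _ _ _ _ (hy.isFirst (hS.fst y hy.closed)) (by omega)
  · refine ⟨0, s.v, s.c, s.t, s.r, s.u, s.tm, [], by omega, ?_, hv.trans hnil.symm, by omega,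
      by rw [show s.b + 0 = s.e from he.symm]⟩
    simpa [names] using (Closed.nil U).isCl

/-- Follow the failure function from `j` on. -/
def failCmd : Cmd :=
  .loop (.and (.lt (.reg .b) (.reg .j)) (.ne (.ld .NM (.reg .j)) (.ld .NM (.reg .i))))
    (.set .j (.ld .F (.reg .j)))

/-- Compute the longest factor at `b` with minimum period at most `m`. -/
def periodCmd : Cmd :=
  .loop (.and (.lt (.reg .i) (.reg .n)) (.ne (.reg .g) (.const 0)))
    (.set .j (.reg .k) ;; failCmd ;;
      .ite (.eq (.ld .NM (.reg .j)) (.ld .NM (.reg .i))) (.set .j (.succ (.reg .j)))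
        -- An empty branch, as the language has no `skip`.
        (.set .j (.reg .j)) ;;
      .ite (.lt (.reg .m) (.sub (.succ (.reg .i)) (.reg .j))) (.set .g (.const 0))
        (.set .i (.succ (.reg .i)) ;; .set .k (.reg .j) ;; .store .F (.reg .i) (.reg .k)))

/-- `F (b + l')` is the position behind the longest proper border, read as a prefix, of the prefix
of length `l'`. Every fallback lowers `j`, and this pays for it. -/
theorem wp_fail {s : St α} {Q : St α → Prop} {l : ℕ} (hi : s.i = s.b + l) (hbj : s.b ≤ s.j)
    (hji : s.j < s.i) (hc : PeriodCandidate s.NM s.b l (s.i - s.j))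
    (hF : ∀ l', 1 ≤ l' → l' ≤ l →
      ∃ q', IsMinPer s.NM s.b l' q' ∧ s.F (s.b + l') = s.b + l' - q')
    (hQ : ∀ j tm, s.b ≤ j → j < s.i → PeriodCandidate s.NM s.b l (s.i - j) →
      (j = s.b ∨ s.NM j = s.NM s.i) → tm + 20 * (j - s.b) ≤ s.tm + 20 * (s.j - s.b) + 9 →
      Q { s with j := j, tm := tm }) :
    WP T lim failCmd s Q := by
  refine wp_loop_of (fun κ s' => ∃ tm, s.b ≤ κ ∧ κ < s.i ∧ PeriodCandidate s.NM s.b l (s.i - κ) ∧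
    tm + 20 * (κ - s.b) ≤ s.tm + 20 * (s.j - s.b) ∧ s' = { s with j := κ, tm := tm })
    ?_ ?_ ?_ s.j _ ?_
  · rintro κ s' ⟨tm, -, -, -, -, rfl⟩
    simp [Tst.ok]
  · rintro κ s' ⟨tm, h1, h2, h3, h4, rfl⟩ hev
    simp only [Tst.ev, Ex.ev, St.get, St.arr] at hev
    obtain ⟨h5, h6⟩ := hev
    obtain ⟨q', hq', hF'⟩ := hF (κ - s.b) (by omega) (by omega)
    rw [Nat.add_sub_cancel' h1] at hF'
    have hle := hq'.le (by omega)
    have hpos := hq'.pos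
    have hl : l - (s.i - κ) = κ - s.b := by omega
    have hnext := h3.next (q' := q') (by omega)
      (by rw [hl, Nat.add_sub_cancel' h1, ← hi]; exact h6) (by rw [hl]; exact hq')
    simp only [wp_set, Ex.ev, St.get, St.set, St.arr, St.tick, Ex.size, Tst.size]
    refine ⟨s.F κ, by omega, _, by omega, by omega, ?_, ?_, rfl⟩
    · rw [show s.i - s.F κ = s.i - κ + q' by omega]
      exact hnext
    · omega
  · rintro κ s' ⟨tm, h1, h2, h3, h4, rfl⟩ hev
    simp only [Tst.ev, Ex.ev, St.get, St.arr, not_and, not_not] at hev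
    simp only [St.tick, Ex.size, Tst.size]
    refine hQ _ _ h1 h2 h3 ?_ (by omega)
    by_cases h : s.b < κ
    · exact .inr (hev h)
    · exact .inl (by omega)
  · exact ⟨s.tm, hbj, hji, hc, le_rfl, rfl⟩

/-- Minimum periods are monotone, so the scan may stop at the first length whose minimum period
exceeds `m`. With the potential `k - b` the time is linear in the phrase, not in the rest of the
text. -/
theorem wp_period {s : St α} {Q : St α → Prop} (hbn : s.b < s.n) (hlim : s.n < lim)
    (hi : s.i = s.b + 1) (hk : s.k = s.b) (hF : s.F (s.b + 1) = s.b) (hg : s.g = 1) (hm : 1 ≤ s.m)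
    (hQ : ∀ i k j g F tm l q, i = s.b + l → 1 ≤ l → i ≤ s.n → i - k = q →
      IsMinPer s.NM s.b l q → q ≤ s.m →
      (s.b + l = s.n ∨ ∃ q', IsMinPer s.NM s.b (l + 1) q' ∧ s.m < q') → tm ≤ s.tm + 70 * l + 100 →
      Q { s with i := i, k := k, j := j, g := g, F := F, tm := tm }) :
    WP T lim periodCmd s Q := by
  refine wp_loop_of (fun κ s' => ∃ k j g F tm l q, 1 ≤ l ∧ s.b + l ≤ s.n ∧ k + q = s.b + l ∧
    IsMinPer s.NM s.b l q ∧ q ≤ s.m ∧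
    (∀ l', 1 ≤ l' → l' ≤ l → ∃ q', IsMinPer s.NM s.b l' q' ∧ F (s.b + l') = s.b + l' - q') ∧
    κ = (s.n - (s.b + l)) + (if g ≠ 0 then 1 else 0) ∧
    ((g ≠ 0 ∧ tm + 20 * (k - s.b) ≤ s.tm + 70 * l) ∨
      (g = 0 ∧ (∃ q', IsMinPer s.NM s.b (l + 1) q' ∧ s.m < q') ∧ tm ≤ s.tm + 70 * l + 70)) ∧
    s' = { s with i := s.b + l, k := k, j := j, g := g, F := F, tm := tm })
    ?_ ?_ ?_ ((s.n - (s.b + 1)) + 1) _ ?_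
  · rintro κ s' ⟨k, j, g, F, tm, l, q, -, -, -, -, -, -, -, -, rfl⟩
    simp [Tst.ok]
  · rintro κ s' ⟨k, j, g, F, tm, l, q, hl, hln, hkq, hq, hqm, hF, hκ, htm, rfl⟩ hev
    simp only [Tst.ev, Ex.ev, St.get] at hev
    obtain ⟨hlt, hg0⟩ := hev
    replace htm := (htm.resolve_right fun h => hg0 h.1).2
    simp only [hg0, ne_eq, not_false_eq_true, if_true] at hκ
    have hql := hq.le hl
    have hqpos := hq.pos
    simp only [wp_seq, wp_set, Ex.ev, St.get, St.set, St.tick, Ex.size, Tst.size]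
    refine wp_fail (l := l) rfl (by dsimp only; omega) (by dsimp only; omega) ?_ hF ?_
    · dsimp only
      rw [show s.b + l - k = q by omega]
      exact hq.candidate hl
    intro j tm' hj1 hj2 hc hfin htm'
    dsimp only at hj1 hj2 hc hfin htm' ⊢
    have hlj : l - (s.b + l - j) = j - s.b := by omega
    -- The common continuation of both outcomes of the comparison, once the minimum period at length
    -- `l + 1` is known.
    have key : ∀ j' tm'', IsMinPer s.NM s.b (l + 1) (s.b + l + 1 - j') → s.b ≤ j' → j' ≤ j + 1 →
        tm'' ≤ tm' + 10 →
        WP T lim (.ite (.lt (.reg .m) (.sub (.succ (.reg .i)) (.reg .j))) (.set .g (.const 0))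
          (.set .i (.succ (.reg .i)) ;; .set .k (.reg .j) ;; .store .F (.reg .i) (.reg .k)))
          { s with i := s.b + l, k := k, j := j', g := g, F := F, tm := tm'' }
          (fun s₁ => ∃ k' < κ, ∃ k j g F tm l q, 1 ≤ l ∧ s.b + l ≤ s.n ∧ k + q = s.b + l ∧
            IsMinPer s.NM s.b l q ∧ q ≤ s.m ∧
            (∀ l', 1 ≤ l' → l' ≤ l → ∃ q', IsMinPer s.NM s.b l' q' ∧
              F (s.b + l') = s.b + l' - q') ∧
            k' = (s.n - (s.b + l)) + (if g ≠ 0 then 1 else 0) ∧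
            ((g ≠ 0 ∧ tm + 20 * (k - s.b) ≤ s.tm + 70 * l) ∨
              (g = 0 ∧ (∃ q', IsMinPer s.NM s.b (l + 1) q' ∧ s.m < q') ∧
                tm ≤ s.tm + 70 * l + 70)) ∧
            s₁ = { s with i := s.b + l, k := k, j := j, g := g, F := F, tm := tm }) := by
      intro j' tm'' hmin hj3 hj4 htm''
      rw [wp_ite]
      simp only [Tst.ev, Tst.ok, Ex.ev, St.get]
      refine ⟨trivial, fun hlt2 => ?_, fun hlt2 => ?_⟩
      · simp only [wp_set, Ex.ev, St.set, St.tick, Ex.size, Tst.size]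
        exact ⟨s.n - (s.b + l), by omega, k, j', 0, F, _, l, q, hl, hln, hkq, hq, hqm, hF, by simp,
          .inr ⟨rfl, ⟨_, hmin, hlt2⟩, by omega⟩, rfl⟩
      · simp only [wp_seq, wp_set, wp_store, Ex.ev, St.get, St.set, St.arr, St.setArr, St.tick,
          Ex.size, Tst.size]
        have hpos := hmin.pos
        refine ⟨by omega, κ - 1, by omega, j', j', g, _, _, l + 1, _, by omega, by omega, ?_, hmin,
          by omega, ?_, ?_, .inl ⟨hg0, ?_⟩, rfl⟩
        · omega
        · intro l' h1 h2
          by_cases hl' : l' = l + 1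
          · subst hl'
            refine ⟨_, hmin, ?_⟩
            rw [← add_assoc, Function.update_self]
            omega
          · rw [Function.update_of_ne (by omega)]
            exact hF l' h1 (by omega)
        · simp [hg0]; omega
        · omega
    rw [wp_ite]
    simp only [Tst.ev, Tst.ok, Ex.ev, St.get, St.arr]
    refine ⟨trivial, fun heq => ?_, fun heq => ?_⟩
    · simp only [wp_set, Ex.ev, St.get, St.set, St.tick, Ex.size, Tst.size]
      refine key (j + 1) _ ?_ (by omega) le_rfl (by omega)
      rw [show s.b + l + 1 - (j + 1) = s.b + l - j by omega]
      refine hc.isMinPer ?_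
      rw [hlj, Nat.add_sub_cancel' hj1]
      exact heq
    · simp only [wp_set, Ex.ev, St.get, St.set, St.tick, Ex.size, Tst.size]
      refine key j _ ?_ hj1 (by omega) (by omega)
      obtain rfl : j = s.b := hfin.resolve_right heq
      rw [Nat.add_sub_cancel_left] at hc
      rw [add_assoc, Nat.add_sub_cancel_left]
      exact hc.isMinPer_succ heq
  · rintro κ s' ⟨k, j, g, F, tm, l, q, hl, hln, hkq, hq, hqm, hF, hκ, htm, rfl⟩ hev
    simp only [Tst.ev, Ex.ev, St.get, not_and, not_not] at hev
    simp only [St.tick, Ex.size, Tst.size]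
    refine hQ _ _ _ _ _ _ l q rfl hl hln (by omega) hq hqm ?_
      (by rcases htm with h | ⟨-, -, h⟩ <;> omega)
    by_cases h : s.b + l < s.n
    · exact .inr (htm.resolve_left fun h' => h'.1 (hev h)).2.1
    · exact .inl (by omega)
  · refine ⟨s.k, s.j, s.g, s.F, s.tm, 1, 1, le_rfl, hbn, by omega, ?_, hm, ?_, by simp [hg],
      .inl ⟨by omega, by omega⟩, by rw [← hi]⟩
    · exact ⟨le_rfl, per_self _ _ _, fun q' h _ => h⟩
    · intro l' h1 h2
      obtain rfl : l' = 1 := by omega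
      exact ⟨1, ⟨le_rfl, per_self _ _ _, fun q' h _ => h⟩, by omega⟩

end Search

/-! ### Appending the positions of a phrase -/

section Append

variable {α : Type*} [LinearOrder α] {T : List α} {lim : ℕ}

/-- The data of the naming phase. -/
structure Static {α : Type*} (T : List α) (h B : ℕ) (s : St α) : Prop where
  n : s.n = T.length
  h : s.h = h
  iff : ∀ i < T.length, ∀ j < T.length, s.NM i = s.NM j ↔ T[i]? = T[j]?
  ne : ∀ i < T.length, s.NM i ≠ s.dol
  lt : ∀ i < T.length, s.NM i < 2 ^ B
  dol_lt : s.dol < 2 ^ B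

/-- What does not change while the text of the automaton is extended. -/
structure Keeps {α : Type*} (a a' : St α) : Prop where
  n : a'.n = a.n
  h : a'.h = a.h
  i : a'.i = a.i
  per : a'.per = a.per
  s : a'.s = a.s
  f : a'.f = a.f
  dol : a'.dol = a.dol
  NM : a'.NM = a.NM
  out : a'.out = a.out

theorem Static.of_keeps {α : Type*} {T : List α} {h B : ℕ} {s s' : St α} (hst : Static T h B s) (hk : Keeps s s') :
    Static T h B s' := by
  refine ⟨hk.n.trans hst.n, hk.h.trans hst.h, ?_, ?_, ?_, ?_⟩
  · rw [hk.NM]; exact hst.iff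
  · rw [hk.NM, hk.dol]; exact hst.ne
  · rw [hk.NM]; exact hst.lt
  · rw [hk.dol]; exact hst.dol_lt

theorem map_range_update {β : Type*} (f : ℕ → β) (b : ℕ) (w : β) :
    (List.range b).map (Function.update f b w) = (List.range b).map f := by
  refine List.map_congr_left fun i hi => Function.update_of_ne ?_ _ _
  exact (List.mem_range.1 hi).ne

theorem admissible_update (N HT : ℕ → ℕ) (h dol b w : ℕ) :
    admissible N (Function.update HT b w) h dol b = admissible N HT h dol b := by
  refine List.map_congr_left fun i hi => ?_
  rw [Function.update_of_ne (List.mem_range.1 hi).ne]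

theorem admissible_length (N HT : ℕ → ℕ) (h dol b : ℕ) :
    (admissible N HT h dol b).length = b := by simp [admissible]

/-- Append the position `b` to the text of the automaton. -/
def appendCmd : Cmd :=
  .ite (.lt (.ld .HT (.reg .b)) (.reg .h)) (.set .d (.ld .NM (.reg .b))) (.set .d (.reg .dol)) ;;
  extendCmd ;; .set .b (.succ (.reg .b))

theorem wp_append {s : St α} {Q : St α → Prop} {h B : ℕ} (hst : Static T h B s)
    (hI : SamInv B (admissible s.NM s.HT h s.dol s.b) s) (hbn : s.b < T.length)
    (hlim : 5 * T.length + 4 ≤ lim)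
    (hQ : ∀ s', Keeps s s' → s'.m = s.m → s'.HT = s.HT → s'.b = s.b + 1 →
      SamInv B (admissible s.NM s.HT h s.dol (s.b + 1)) s' → s.al ≤ s'.al →
      s'.tm + 100 * (B + 1) * (closedSuffixes (admissible s.NM s.HT h s.dol (s.b + 1))
          (admissible s.NM s.HT h s.dol (s.b + 1)) + s.al) ≤
        s.tm + 100 * (B + 1) * (closedSuffixes (admissible s.NM s.HT h s.dol s.b)
          (admissible s.NM s.HT h s.dol s.b) + s'.al + 8) + 10 → Q s') :
    WP T lim appendCmd s Q := by
  have key : ∀ tm d, tm ≤ s.tm + 6 → d = (if s.HT s.b < h then s.NM s.b else s.dol) →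
      WP T lim (extendCmd ;; .set .b (.succ (.reg .b))) { s with d := d, tm := tm } Q := by
    intro tm d htm hd
    rw [wp_seq]
    refine wp_extend (U := admissible s.NM s.HT h s.dol s.b) (B := B) hI ?_ ?_ ?_
    · dsimp only
      rw [hd]
      split_ifs
      · exact hst.lt _ hbn
      · exact hst.dol_lt
    · rw [admissible_length]; omega
    · intro al last v c u t r w x cur p q cl g LEN LNK FST LH LC RC KEY TG SB tm' s' hs' hI' hal' htm'
      dsimp only at hI' hal' htm'
      rw [hd, ← admissible_succ] at hI' htm'
      simp only [wp_set, Ex.ev, St.get, St.set, St.tick, Ex.size]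
      subst hs'
      exact hQ _ ⟨rfl, rfl, rfl, rfl, rfl, rfl, rfl, rfl, rfl⟩ rfl rfl rfl hI' hal'
        (by dsimp only; omega)
  rw [appendCmd, wp_seq, wp_ite]
  simp only [Tst.ok, Tst.ev, Ex.ev, St.get, St.arr, hst.h]
  refine ⟨trivial, fun hlt => ?_, fun hlt => ?_⟩
  · simp only [wp_set, Ex.ev, St.get, St.arr, St.set, St.tick, Ex.size, Tst.size]
    exact key _ _ (by omega) (by rw [if_pos hlt])
  · simp only [wp_set, Ex.ev, St.get, St.set, St.tick, Ex.size, Tst.size]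
    exact key _ _ (by omega) (by rw [if_neg hlt])

/-- Append the positions of a phrase of period `1`. -/
def runCmd : Cmd :=
  .loop (.lt (.reg .b) (.reg .i)) (.store .HT (.reg .b) (.const 0) ;; appendCmd)

/-- Append the positions of a phrase with source `s`. -/
def copyPhraseCmd : Cmd :=
  .loop (.lt (.reg .b) (.reg .i))
    (.store .HT (.reg .b) (.succ (.ld .HT (.reg .m))) ;; .set .m (.succ (.reg .m)) ;;
      .ite (.eq (.reg .m) (.reg .f)) (.set .m (.reg .s)) (.set .m (.reg .m)) ;; appendCmd)

/-- The invariant after `t` steps of a loop that appends positions; `H` are their heights. -/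
structure Appended (h B : ℕ) (s : St α) (H : List ℕ) (t : ℕ) (s' : St α) : Prop where
  keeps : Keeps s s'
  b : s'.b = s.b + t
  heights : (List.range s'.b).map s'.HT = H
  inv : SamInv B (admissible s.NM s'.HT h s.dol s'.b) s'
  al : s.al ≤ s'.al
  time : s'.tm + 100 * (B + 1) * (closedSuffixes (admissible s.NM s'.HT h s.dol s'.b)
        (admissible s.NM s'.HT h s.dol s'.b) + s.al) ≤
      s.tm + 100 * (B + 1) * (closedSuffixes (admissible s.NM s.HT h s.dol s.b)
        (admissible s.NM s.HT h s.dol s.b) + s'.al + 9 * t)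

theorem Appended.init {α : Type*} {h B : ℕ} {s : St α} (hI : SamInv B (admissible s.NM s.HT h s.dol s.b) s) :
    Appended h B s ((List.range s.b).map s.HT) 0 s :=
  ⟨⟨rfl, rfl, rfl, rfl, rfl, rfl, rfl, rfl, rfl⟩, rfl, rfl, hI, le_rfl, le_rfl⟩

/-- The height of `b` does not enter the masked text of `T[0..b)`, so it may be stored before the
automaton is extended. The overhead of the loop body is covered by the ninth unit per position;
`wp_append` uses eight. -/
theorem Appended.next {h B t w m tm : ℕ} {s s₁ : St α} {H : List ℕ} {Q : St α → Prop}
    (hst : Static T h B s) (hA : Appended h B s H t s₁) (hbn : s₁.b < T.length)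
    (hlim : 5 * T.length + 4 ≤ lim) (htm : tm ≤ s₁.tm + 50)
    (hQ : ∀ s', s'.m = m → Appended h B s (H ++ [w]) (t + 1) s' → Q s') :
    WP T lim appendCmd { s₁ with HT := Function.update s₁.HT s₁.b w, m := m, tm := tm } Q := by
  have hst₁ := hst.of_keeps hA.keeps
  refine wp_append (h := h) (B := B) ⟨hst₁.n, hst₁.h, hst₁.iff, hst₁.ne, hst₁.lt, hst₁.dol_lt⟩ ?_
    hbn hlim ?_
  · dsimp only
    rw [admissible_update, hA.keeps.NM, hA.keeps.dol]
    exact hA.inv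
  · intro s' hk hm hHT hb hI hal htm'
    dsimp only at hk hm hHT hb hI hal htm'
    rw [admissible_update] at htm'
    rw [hA.keeps.NM, hA.keeps.dol, ← hHT, ← hb] at hI
    rw [hA.keeps.NM, hA.keeps.dol, ← hHT, ← hb] at htm'
    refine hQ s' hm ⟨⟨hk.n.trans hA.keeps.n, hk.h.trans hA.keeps.h, hk.i.trans hA.keeps.i,
      hk.per.trans hA.keeps.per, hk.s.trans hA.keeps.s, hk.f.trans hA.keeps.f,
      hk.dol.trans hA.keeps.dol, hk.NM.trans hA.keeps.NM, hk.out.trans hA.keeps.out⟩, ?_, ?_, hI,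
      hA.al.trans hal, ?_⟩
    · rw [hb, hA.b, add_assoc]
    · rw [hb, hHT, List.range_succ, List.map_append, map_range_update, hA.heights]
      simp
    · have := hA.time
      nlinarith

theorem wp_run {s : St α} {Q : St α → Prop} {h B l : ℕ} (hst : Static T h B s)
    (hI : SamInv B (admissible s.NM s.HT h s.dol s.b) s) (hi : s.i = s.b + l)
    (hin : s.i ≤ T.length) (hlim : 5 * T.length + 4 ≤ lim)
    (hQ : ∀ s', Appended h B s ((List.range s.b).map s.HT ++ List.replicate l 0) l s' →
      Q (s'.tick 3)) : WP T lim runCmd s Q := by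
  refine wp_loop_of (fun κ s' => ∃ t, t + κ = l ∧
    Appended h B s ((List.range s.b).map s.HT ++ List.replicate t 0) t s') ?_ ?_ ?_ l _ ?_
  · rintro κ s' -
    simp [Tst.ok]
  · rintro κ s' ⟨t, ht, hA⟩ hev
    simp only [Tst.ev, Ex.ev, St.get, hA.keeps.i, hA.b] at hev
    have hb := hA.b
    simp only [wp_seq, wp_store, Ex.ev, St.get, St.arr, St.setArr, St.tick, Ex.size, Tst.size]
    refine ⟨by omega, ?_⟩
    refine hA.next hst (by omega) hlim (by omega) fun s' _ hA' => ⟨κ - 1, by omega, t + 1, by omega, ?_⟩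
    rwa [List.replicate_succ', ← List.append_assoc]
  · rintro κ s' ⟨t, ht, hA⟩ hev
    simp only [Tst.ev, Ex.ev, St.get, hA.keeps.i, hA.b] at hev
    obtain rfl : t = l := by omega
    exact hQ _ hA
  · exact ⟨0, by omega, by simpa using Appended.init hI⟩

/-- The language cannot divide by a register; the pointer `m` realizes the remainder by wrapping
around. -/
theorem succ_mod {p : ℕ} (hp : 1 ≤ p) (t : ℕ) :
    (t + 1) % p = if t % p + 1 = p then 0 else t % p + 1 := by
  have hlt := Nat.mod_lt t hp
  rw [← Nat.mod_add_mod]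
  split_ifs with h
  · rw [h, Nat.mod_self]
  · exact Nat.mod_eq_of_lt (by omega)

theorem appendHeights_copy_succ {α : Type*} (H : List ℕ) (t s p : ℕ) :
    appendHeights (α := α) H (.copy (t + 1) s p) = appendHeights (α := α) H (.copy t s p) ++
      [(appendHeights (α := α) H (.copy t s p)).getD (s + t % p) 0 + 1] := by
  simp [appendHeights, List.range_succ]

theorem wp_copyPhrase {s : St α} {Q : St α → Prop} {h B l : ℕ} (hst : Static T h B s)
    (hI : SamInv B (admissible s.NM s.HT h s.dol s.b) s) (hi : s.i = s.b + l)
    (hin : s.i ≤ T.length) (hlim : 5 * T.length + 4 ≤ lim) (hm : s.m = s.s)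
    (hf : s.f = s.s + s.per) (hper : 1 ≤ s.per) (hsb : s.s + s.per ≤ s.b)
    (hQ : ∀ s', Appended h B s (appendHeights (α := α) ((List.range s.b).map s.HT)
      (.copy l s.s s.per)) l s' → Q (s'.tick 3)) : WP T lim copyPhraseCmd s Q := by
  refine wp_loop_of (fun κ s' => ∃ t, t + κ = l ∧ s'.m = s.s + t % s.per ∧
    Appended h B s (appendHeights (α := α) ((List.range s.b).map s.HT) (.copy t s.s s.per)) t s')
    ?_ ?_ ?_ l _ ?_
  · rintro κ s' -
    simp [Tst.ok]
  · rintro κ s' ⟨t, ht, hm', hA⟩ hev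
    simp only [Tst.ev, Ex.ev, St.get, hA.keeps.i, hA.b] at hev
    have hb := hA.b
    have hmod := Nat.mod_lt t hper
    -- The position referred to lies before the phrase, so its height has been stored already.
    have hget : (appendHeights (α := α) ((List.range s.b).map s.HT) (.copy t s.s s.per)).getD
        (s.s + t % s.per) 0 = s'.HT s'.m := by
      rw [← hA.heights, hm']
      simp [List.getD_eq_getElem?_getD, show s.s + t % s.per < s'.b by omega]
    have hmne : s'.m ≠ s'.b := by omega
    simp only [wp_seq, wp_set, wp_store, wp_ite, Tst.ok, Tst.ev, Ex.ev, St.get, St.set, St.arr,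
      St.setArr, St.tick, Ex.size, Tst.size]
    have hmod' := succ_mod hper t
    refine ⟨by omega, trivial, fun he => ?_, fun he => ?_⟩
    · rw [hA.keeps.f] at he
      refine hA.next hst (by omega) hlim ?_ ?_
      · omega
      intro s'' hm'' hA'
      refine ⟨κ - 1, by omega, t + 1, by omega, ?_, ?_⟩
      · rw [hm'', hmod', if_pos (by omega), hA.keeps.s]; simp
      · rwa [appendHeights_copy_succ, hget]
    · rw [hA.keeps.f] at he
      refine hA.next hst (by omega) hlim ?_ ?_
      · omega
      intro s'' hm'' hA'
      refine ⟨κ - 1, by omega, t + 1, by omega, ?_, ?_⟩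
      · rw [hm'', hmod', if_neg (by omega)]; omega
      · rwa [appendHeights_copy_succ, hget]
  · rintro κ s' ⟨t, ht, -, hA⟩ hev
    simp only [Tst.ev, Ex.ev, St.get, hA.keeps.i, hA.b] at hev
    obtain rfl : t = l := by omega
    exact hQ _ hA
  · refine ⟨0, by omega, by simp [hm], ?_⟩
    simpa [appendHeights] using Appended.init hI

end Append

/-! ### One greedy phrase -/

section Phrases

variable {α : Type*} [LinearOrder α] {T : List α} {lim : ℕ}

/-- Compute the next phrase and append its positions. -/
def phraseCmd : Cmd :=
  .set .e (.reg .b) ;; .set .v (.const 1) ;; .set .g (.const 1) ;; matchCmd ;;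
  .set .m (.sub (.reg .e) (.reg .b)) ;;
  .ite (.eq (.reg .m) (.const 0)) (.set .m (.const 1)) (.set .m (.reg .m)) ;;
  .set .i (.succ (.reg .b)) ;; .set .k (.reg .b) ;; .store .F (.reg .i) (.reg .k) ;;
  .set .g (.const 1) ;; periodCmd ;; .set .per (.sub (.reg .i) (.reg .k)) ;;
  .ite (.eq (.reg .per) (.const 1))
    (.emitW (.sub (.reg .i) (.reg .b)) ;; .emitS (.reg .b) ;; .emitW (.const 1) ;; runCmd)
    (.set .e (.reg .b) ;; .set .v (.const 1) ;; .set .f (.reg .per) ;; locateCmd ;;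
      -- Until here `f` counted names; now it is the end of the source, where `copyPhraseCmd` wraps
      -- around.
      .set .f (.ld .FST (.reg .v)) ;; .set .s (.sub (.reg .f) (.reg .per)) ;;
      .emitW (.sub (.reg .i) (.reg .b)) ;; .emitW (.reg .s) ;; .emitW (.reg .per) ;;
      .set .m (.reg .s) ;; copyPhraseCmd)

/-- All phrases are greedy. -/
def GreedyPhrases (h : ℕ) (T : List α) (E : List (Phrase α)) : Prop :=
  ∀ E₁ ph E₂, E = E₁ ++ ph :: E₂ → IsGreedyPhrase h T (heights E₁) (totalLength E₁) ph

theorem GreedyPhrases.snoc {α : Type*} {T : List α} {h : ℕ} {E : List (Phrase α)} {ph : Phrase α} (hE : GreedyPhrases h T E)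
    (hph : IsGreedyPhrase h T (heights E) (totalLength E) ph) : GreedyPhrases h T (E ++ [ph]) := by
  intro E₁ ph' E₂ he
  rcases List.eq_nil_or_concat' E₂ with rfl | ⟨E₃, x, rfl⟩
  · obtain ⟨rfl, h2⟩ := List.append_inj' he rfl
    simp only [List.cons.injEq, and_true] at h2
    rwa [← h2]
  · rw [← List.cons_append, ← List.append_assoc] at he
    exact hE E₁ ph' E₃ (List.append_inj' he rfl).1

theorem totalLength_snoc {α : Type*} (E : List (Phrase α)) (ph : Phrase α) :
    totalLength (E ++ [ph]) = totalLength E + ph.len := by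
  simp [totalLength]

theorem heights_snoc {α : Type*} (E : List (Phrase α)) (ph : Phrase α) :
    heights (E ++ [ph]) = appendHeights (heights E) ph := by
  simp [heights]

/-- The invariant between phrases. -/
structure MainInv (T : List α) (h B : ℕ) (E : List (Phrase α)) (s : St α) : Prop where
  static : Static T h B s
  b : s.b = totalLength E
  le : s.b ≤ T.length
  greedy : GreedyPhrases h T E
  out : s.out = E.flatMap Phrase.output
  heights : heights E = (List.range s.b).map s.HT
  inv : SamInv B (admissible s.NM s.HT h s.dol s.b) s

theorem Appended.mainInv {α : Type*} {T : List α} {h B l : ℕ} {E : List (Phrase α)} {s₀ s s' : St α} {ph : Phrase α}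
    (hA : Appended h B s (appendHeights ((List.range s.b).map s.HT) ph) l s')
    (hM : MainInv T h B E s₀) (hst : Static T h B s) (hb : s.b = s₀.b) (hHT : s.HT = s₀.HT)
    (hout : s.out = s₀.out ++ ph.output) (hl : ph.len = l) (hn : s.b + l ≤ T.length)
    (hg : IsGreedyPhrase h T ((List.range s.b).map s.HT) s.b ph) :
    MainInv T h B (E ++ [ph]) (s'.tick 3) := by
  rw [hb, hHT, ← hM.heights, hM.b] at hg
  have hst' := hst.of_keeps hA.keeps
  refine ⟨⟨hst'.n, hst'.h, hst'.iff, hst'.ne, hst'.lt, hst'.dol_lt⟩, ?_, ?_, hM.greedy.snoc hg, ?_, ?_, ?_⟩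
  · rw [totalLength_snoc, hl, ← hM.b, ← hb]; exact hA.b
  · exact hA.b.trans_le hn
  · rw [List.flatMap_append, ← hM.out]
    exact hA.keeps.out.trans (by simpa using hout)
  · rw [heights_snoc, hM.heights, ← hb, ← hHT]
    exact hA.heights.symm
  · have := hA.inv
    rw [← hA.keeps.NM, ← hA.keeps.dol] at this
    exact this

-- Matching `m` names, scanning for the period and locating `q` names are all charged to the `l`
-- positions of the phrase, since `m ≤ l` and `q ≤ l`. This is the term `20 * b` of the potential.
set_option maxHeartbeats 1000000 in
theorem wp_phrase {s : St α} {Q : St α → Prop} {h B : ℕ} {E : List (Phrase α)}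
    (hM : MainInv T h B E s) (hbn : s.b < T.length) (hlim : 5 * T.length + 4 ≤ lim)
    (hQ : ∀ s' ph, MainInv T h B (E ++ [ph]) s' → s.b < s'.b → s.al ≤ s'.al →
      s'.tm + 100 * (B + 1) * (closedSuffixes (admissible s'.NM s'.HT h s'.dol s'.b)
          (admissible s'.NM s'.HT h s'.dol s'.b) + s.al + 20 * s.b) ≤
        s.tm + 100 * (B + 1) * (closedSuffixes (admissible s.NM s.HT h s.dol s.b)
          (admissible s.NM s.HT h s.dol s.b) + s'.al + 20 * s'.b) → Q s') :
    WP T lim phraseCmd s Q := by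
  obtain ⟨m, hmn, hm⟩ := exists_longest (U := admissible s.NM s.HT h s.dol s.b) s.NM s.b T.length
    hM.le
  have hst := hM.static
  have hsrc : ∀ p, s.b + p ≤ T.length →
      ((∃ t, IsSource h T ((List.range s.b).map s.HT) s.b p t) ↔ p ≤ m) := fun p hp => by
    rw [exists_isSource_iff hst.iff hst.ne hp, hm p hp]
  have hnlt : ∀ i < s.n, s.NM i < 2 ^ B := by rw [hst.n]; exact hst.lt
  simp only [phraseCmd, wp_seq, wp_set, Ex.ev, St.get, St.set, St.tick, Ex.size]
  refine wp_match (m := m) hM.inv hnlt rfl rfl rfl (by dsimp only; rw [hst.n]; exact hmn)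
    (by dsimp only; rw [hst.n]; exact hm) ?_
  intro e v c t r u g tm he htm
  dsimp only at he htm ⊢
  -- Both branches of the test for `m = 0` continue with `max m 1`.
  have key : ∀ m' e v c t r u g tm', m' = max m 1 → tm' ≤ tm + 20 →
      WP T lim (.set .i (.succ (.reg .b)) ;; .set .k (.reg .b) ;; .store .F (.reg .i) (.reg .k) ;;
        .set .g (.const 1) ;; periodCmd ;; .set .per (.sub (.reg .i) (.reg .k)) ;;
        .ite (.eq (.reg .per) (.const 1))
          (.emitW (.sub (.reg .i) (.reg .b)) ;; .emitS (.reg .b) ;; .emitW (.const 1) ;; runCmd)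
          (.set .e (.reg .b) ;; .set .v (.const 1) ;; .set .f (.reg .per) ;; locateCmd ;;
            .set .f (.ld .FST (.reg .v)) ;; .set .s (.sub (.reg .f) (.reg .per)) ;;
            .emitW (.sub (.reg .i) (.reg .b)) ;; .emitW (.reg .s) ;; .emitW (.reg .per) ;;
            .set .m (.reg .s) ;; copyPhraseCmd))
        { s with m := m', e := e, v := v, c := c, t := t, r := r, u := u, g := g, tm := tm' } Q := by
    intro m' e v c t r u g tm' hm' htm'
    simp only [wp_seq, wp_set, wp_store, Ex.ev, St.get, St.set, St.arr, St.setArr, St.tick, Ex.size]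
    refine ⟨by omega, ?_⟩
    refine wp_period (by dsimp only; rw [hst.n]; exact hbn) (by dsimp only; rw [hst.n]; omega) rfl
      rfl (Function.update_self _ _ _) rfl (by dsimp only; omega) ?_
    intro i k j g F tm₂ l q hi hl hin hik hq hqm hmax htm₂
    dsimp only at hi hin hik hq hqm hmax htm₂ ⊢
    rw [hm'] at hqm hmax
    rw [hst.n] at hin hmax
    have hbl : s.b + l ≤ T.length := by omega
    have hgreat := isGreatest_candidate hst.iff hsrc hl hbl hq hqm hmax
    have hmp := hq.minPeriod_eq hst.iff hl hbl
    have hql := hq.le hl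
    have hqpos := hq.pos
    -- Either the phrase ends the text, or the minimum period at length `l + 1` exceeds `m` and is
    -- at most `l + 1`.
    have hml : m ≤ l := by
      rcases hmax with h1 | ⟨q', h1, h2⟩
      · omega
      · have := h1.le (by omega); omega
    rw [wp_ite, hik]
    simp only [Tst.ok, Tst.ev, Ex.ev, St.get]
    refine ⟨trivial, fun h1 => ?_, fun h1 => ?_⟩
    · subst h1
      simp only [wp_seq, wp_emitW, Ex.ev, St.get, St.emit, St.tick, Ex.size, Tst.size]
      refine wp_emitS T[s.b] (List.getElem?_eq_getElem hbn) ?_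
      simp only [St.emit, St.tick, Ex.size]
      refine wp_run (h := h) (B := B) (l := l)
        ⟨hst.n, hst.h, hst.iff, hst.ne, hst.lt, hst.dol_lt⟩ hM.inv hi (by dsimp only; omega) hlim ?_
      intro s' hA
      have hM' := Appended.mainInv (ph := .run l T[s.b]) hA hM
        ⟨hst.n, hst.h, hst.iff, hst.ne, hst.lt, hst.dol_lt⟩ rfl rfl
        (by simp [Phrase.output, hi]) rfl hbl
        ⟨hgreat, hmp, List.getElem?_eq_getElem hbn⟩
      have hb' := hA.b
      have hal' := hA.al
      have ht' := hA.time
      dsimp only at hb' hal' ht'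
      refine hQ _ _ hM' (by simp only [St.tick]; omega) hal' ?_
      simp only [St.tick]
      rw [hA.keeps.NM, hA.keeps.dol]
      dsimp only
      rw [hb'] at ht' ⊢
      have e1 : (B + 1) * m ≤ (B + 1) * l := Nat.mul_le_mul_left _ hml
      have e2 : l ≤ (B + 1) * l := Nat.le_mul_of_pos_left _ (by omega)
      have e3 : B + 1 ≤ (B + 1) * l := Nat.le_mul_of_pos_right _ hl
      nlinarith
    -- A period other than `1` has to be one of the lengths that have a source.
    · have hqm' : q ≤ m := by omega
      have hqn : s.b + q ≤ T.length := by omega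
      simp only [wp_seq, wp_set, Ex.ev, St.get, St.set, St.tick, Ex.size, Tst.size]
      refine wp_locate (B := B) hM.inv hnlt rfl rfl (by dsimp only; rw [hst.n]; omega)
        ((hm q hqn).2 hqm') ?_
      intro e v c t r u f tm₃ hfirst htm₃
      dsimp only at hfirst htm₃ ⊢
      obtain ⟨hqf, hleast⟩ := hfirst.isLeast hst.iff hst.ne hqn
      simp only [wp_emitW, Ex.ev, St.get, St.arr, St.emit, St.tick, Ex.size,
        ]
      have hsb := hleast.1.1
      refine wp_copyPhrase (h := h) (B := B) (l := l)
        ⟨hst.n, hst.h, hst.iff, hst.ne, hst.lt, hst.dol_lt⟩ hM.inv hi (by dsimp only; omega) hlim rfl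
        (by dsimp only; omega) hqpos hsb ?_
      intro s' hA
      have hM' := Appended.mainInv (ph := .copy l (s.FST v - q) q) hA hM
        ⟨hst.n, hst.h, hst.iff, hst.ne, hst.lt, hst.dol_lt⟩ rfl rfl
        (by simp [Phrase.output, hi]) rfl hbl ⟨hgreat, hmp, by omega, hleast⟩
      have hb' := hA.b
      have hal' := hA.al
      have ht' := hA.time
      dsimp only at hb' hal' ht'
      refine hQ _ _ hM' (by simp only [St.tick]; omega) hal' ?_
      simp only [St.tick]
      rw [hA.keeps.NM, hA.keeps.dol]
      dsimp only
      rw [hb'] at ht' ⊢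
      have e1 : (B + 1) * m ≤ (B + 1) * l := Nat.mul_le_mul_left _ hml
      have e2 : l ≤ (B + 1) * l := Nat.le_mul_of_pos_left _ (by omega)
      have e3 : B + 1 ≤ (B + 1) * l := Nat.le_mul_of_pos_right _ hl
      have e4 : (B + 1) * q ≤ (B + 1) * l := Nat.mul_le_mul_left _ hql
      nlinarith
  rw [wp_ite]
  simp only [Tst.ok, Tst.ev, Ex.ev, St.get]
  have hem : e - s.b = m := by omega
  rw [hem]
  refine ⟨trivial, fun h1 => ?_, fun h1 => ?_⟩
  · have := key 1 e v c t r u g (tm + (1 + 1 + 1) + (1 + (0 + 1) + 1) + (1 + 1)) (by omega) (by omega)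
    simp only [wp_seq, wp_set, Ex.ev, St.get, St.set, St.tick, Ex.size, Tst.size] at this ⊢
    exact this
  · have := key m e v c t r u g (tm + (1 + 1 + 1) + (1 + (0 + 1) + 1) + 1) (by omega) (by omega)
    simp only [wp_seq, wp_set, Ex.ev, St.get, St.set, St.tick, Ex.size, Tst.size] at this ⊢
    exact this

end Phrases

/-! ### Greedy encodings are modified LZ-like and bounded -/

section Encoding

variable {α : Type*} {T : List α}

theorem isPeriod_minPeriod {w : List α} (hw : w ≠ []) : IsPeriod w (minPeriod w) :=
  Nat.sInf_mem (s := {p | IsPeriod w p}) ⟨w.length, List.length_pos_iff.2 hw, le_rfl,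
    List.hasPeriod_of_length_le w _ le_rfl⟩

theorem eq_replicate_of_isPeriod_one {w : List α} {c : α} (h : IsPeriod w 1) (hc : w[0]? = some c) :
    w = List.replicate w.length c := by
  have h1 := List.hasPeriod_iff_getElem?.1 h.2.2
  have h2 : ∀ i, i < w.length → w[i]? = some c := by
    intro i
    induction i with
    | zero => exact fun _ => hc
    | succ i ih => exact fun hi => (h1 i (by omega)).symm.trans (ih (by omega))
  refine List.ext_getElem? fun i => ?_
  by_cases hi : i < w.length
  · rw [h2 i hi, List.getElem?_replicate, if_pos hi]
  · rw [List.getElem?_eq_none (by omega), List.getElem?_eq_none (by simp; omega)]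

theorem length_factor {b l : ℕ} (h : b + l ≤ T.length) : (factor T b l).length = l := by
  simp [factor]; omega

theorem IsGreedyPhrase.isModifiedPhrase {h b : ℕ} {H : List ℕ} {ph : Phrase α}
    (hg : IsGreedyPhrase h T H b ph) : IsModifiedPhrase T b ph := by
  have aux : ∀ l, IsCandidate h T H b l → IsPeriod (factor T b l) (minPeriod (factor T b l)) := by
    intro l hl
    refine isPeriod_minPeriod (List.ne_nil_of_length_pos ?_)
    rw [length_factor hl.2.1]
    exact hl.1
  cases ph with
  | run l c =>
    obtain ⟨h1, h2, h3⟩ := hg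
    have hl : IsCandidate h T H b l := h1.1
    refine ⟨hl.1, ?_⟩
    have hper := aux l hl
    rw [h2] at hper
    have := eq_replicate_of_isPeriod_one (c := c) hper ?_
    · rwa [length_factor hl.2.1] at this
    · have := hl.1
      simpa [factor, List.getElem?_take, show 0 < l from hl.1] using h3
  | copy l s p =>
    obtain ⟨h1, h2, h3, h4⟩ := hg
    have hl : IsCandidate h T H b l := h1.1
    have hs : IsSource h T H b p s := h4.1
    have hper := (aux l hl).2.1
    rw [h2, length_factor hl.2.1] at hper
    have := hs.1
    exact ⟨hl.2.1, h3, hper, h2, by omega, hs.2.1⟩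

theorem IsLZHB4.isModifiedEncoding {h : ℕ} {E : List (Phrase α)} (hE : IsLZHB4 h T E) :
    IsModifiedEncoding T E :=
  ⟨hE.1, fun E₁ ph E₂ he => (hE.2 E₁ ph E₂ he).isModifiedPhrase⟩

/-- All references go to `s + k % p`, which lies inside the source and hence inside `H`. So no new
height depends on another new one, and each is one more than a height below `h`. -/
theorem appendHeights_copy (H : List ℕ) {h s p : ℕ} (hp : 1 ≤ p) (hsp : s + p ≤ H.length)
    (hs : ∀ i, s ≤ i → i < s + p → H.getD i 0 < h) (l : ℕ) :
    ∃ R, appendHeights (α := α) H (.copy l s p) = H ++ R ∧ R.length = l ∧ ∀ x ∈ R, x ≤ h := by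
  induction l with
  | zero => exact ⟨[], by simp [appendHeights], rfl, by simp⟩
  | succ l ih =>
    obtain ⟨R, h1, h2, h3⟩ := ih
    have hmod := Nat.mod_lt l hp
    have hlt := hs (s + l % p) (by omega) (by omega)
    refine ⟨R ++ [H.getD (s + l % p) 0 + 1], ?_, by simp [h2], ?_⟩
    · rw [appendHeights_copy_succ, h1, List.getD_append _ _ _ _ (by omega), List.append_assoc]
    · intro x hx
      rcases List.mem_append.1 hx with hx | hx
      · exact h3 x hx
      · rw [List.mem_singleton.1 hx]
        omega

theorem GreedyPhrases.heights_bounded {h : ℕ} : ∀ {E : List (Phrase α)}, GreedyPhrases h T E →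
    (heights E).length = totalLength E ∧ IsBounded h E := by
  intro E
  induction E using List.reverseRecOn with
  | nil => exact fun _ => ⟨rfl, by simp [IsBounded, heights]⟩
  | append_singleton E ph ih =>
    intro hE
    obtain ⟨h1, h2⟩ := ih fun E₁ ph' E₂ he => hE E₁ ph' (E₂ ++ [ph]) (by simp [he])
    have hg := hE E ph [] rfl
    suffices ∃ R, appendHeights (heights E) ph = heights E ++ R ∧ R.length = ph.len ∧
        ∀ x ∈ R, x ≤ h by
      obtain ⟨R, h3, h4, h5⟩ := this
      rw [IsBounded, heights_snoc, h3, totalLength_snoc]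
      refine ⟨by simp [h1, h4], fun x hx => ?_⟩
      exact (List.mem_append.1 hx).elim (h2 x) (h5 x)
    cases ph with
    | run l c =>
      exact ⟨List.replicate l 0, rfl, by simp [Phrase.len], fun x hx => by
        rw [List.eq_of_mem_replicate hx]; exact Nat.zero_le h⟩
    | copy l s p =>
      obtain ⟨-, -, h3, h4⟩ := hg
      have hs : IsSource h T (heights E) (totalLength E) p s := h4.1
      exact appendHeights_copy _ (by omega) (h1 ▸ hs.1) hs.2.2 l

end Encoding

/-! ### The complete program and its bounds -/

section Main

variable {α : Type*} [LinearOrder α] {T : List α} {lim : ℕ}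

theorem SamInv.al_le {α : Type*} {B : ℕ} {U : List ℕ} {s : St α} (h : SamInv B U s) :
    s.al ≤ 5 * U.length + 3 := by
  obtain ⟨S, tr, ν, hD, hS, -, -⟩ := h
  have key : ∀ v ∈ S, ∃ x, Closed U x ∧ v = ν x := by
    intro v hv
    rw [hS.states] at hv
    obtain ⟨x, hx, rfl⟩ := hv
    exact ⟨x, hx, rfl⟩
  refine hD.al_le_of_words ν key fun v c hvc => ?_
  obtain ⟨x, hx, rfl⟩ := key v (hD.mem_of_tr hvc)
  exact ⟨x, hx, rfl, by_contra fun h' => hvc (hS.tr_none x c hx h')⟩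

theorem closed_nil_iff {x : List ℕ} : Closed [] x ↔ x = [] :=
  ⟨fun h => List.infix_nil.1 h.isInfix, fun h => h ▸ Closed.nil []⟩

theorem walk_const_zero (v c : ℕ) : ∀ d, walk (fun _ => 0) (fun _ => 0) v c (d + 1) = 0 := by
  intro d
  simp [walk, child]

/-- The automaton of the empty text consists of the root `1`, and cleared memory is its empty
dictionary. -/
theorem SamInv.init {α : Type*} (B : ℕ) {s : St α} (hal : s.al = 2) (hlast : s.last = 1)
    (hLC : s.LC = fun _ => 0) (hRC : s.RC = fun _ => 0) (hLH : s.LH = fun _ => 0)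
    (hLEN : s.LEN = fun _ => 0) (hLNK : s.LNK = fun _ => 0) (hFST : s.FST = fun _ => 0) :
    SamInv B [] s := by
  refine ⟨{1}, fun _ _ => 0, fun _ => 1, ⟨fun _ _ => 0, fun _ => 0, ?_, by simp⟩, ?_, hlast, rfl⟩
  · rw [hLC, hRC, hLH, hal]
    exact
      { zero := by simp
        LH_zero := by simp
        mem_lt := by simp
        al_pos := by simp
        ent_spec := by simp
        walk_spec := fun v _ c d u hu hu0 => absurd (hu.trans (walk_const_zero v c d)) hu0
        inj := by simp
        list := fun v _ => ⟨[], rfl, by simp, fun u => by simpa using fun h h' => h h'.symm⟩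
        cover := fun u h1 h2 => .inl (by simp; omega) }
  · rw [hLEN, hLNK, hFST]
    refine
      { states := ?_
        inj := ?_
        pos := by simp
        len := ?_
        fst := ?_
        lnk := ?_
        lnk_nil := rfl
        tr_cl := ?_
        tr_none := fun _ _ _ _ => rfl }
    · ext v
      simp [closed_nil_iff]
    · intro x hx y hy _
      rw [closed_nil_iff.1 hx, closed_nil_iff.1 hy]
    · intro x hx
      simp [closed_nil_iff.1 hx]
    · intro x hx
      rw [closed_nil_iff.1 hx]
      exact ⟨⟨[], List.prefix_refl _, List.suffix_refl _, rfl⟩, fun _ _ _ => Nat.zero_le _⟩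
    · intro x l hx hl
      have := closed_nil_iff.1 hx
      exact absurd (closed_nil_iff.1 hl.closed) (this ▸ hl.ne)
    · intro x c w _ hw
      have := hw.isInfix.length_le
      simp at this

/-- The program that computes the encoding. -/
def mainCmd : Cmd :=
  nameCmd ;; .set .al (.const 2) ;; .set .last (.const 1) ;; .set .b (.const 0) ;;
    .loop (.lt (.reg .b) (.reg .n)) phraseCmd

theorem wp_main (h : ℕ) (hlim : 5 * T.length + 4 ≤ lim) :
    WP T lim mainCmd (St.init α T.length h) fun s => ∃ E, IsLZHB4 h T E ∧
      s.out = E.flatMap Phrase.output ∧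
      s.tm ≤ 10000 * (T.length * (Nat.log 2 T.toFinset.card + 1) + 1) := by
  set L := Nat.log 2 T.toFinset.card + 1 with hL
  rw [mainCmd, wp_seq]
  refine wp_name rfl (by omega) rfl rfl ?_
  intro i j k t u v x HD NX RP NM tm hN htm
  rw [← hL] at htm
  simp only [wp_seq, wp_set, Ex.ev, St.set, St.tick, Ex.size]
  have hx : x < 2 ^ L := by
    rw [hN.card, List.take_length]
    exact Nat.lt_pow_succ_log_self one_lt_two _
  -- The separator `x + 1` may need one bit more than the names.
  have hB : x + 1 < 2 ^ (L + 1) := by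
    have : 1 ≤ 2 ^ L := Nat.one_le_two_pow
    rw [pow_succ]; omega
  set K := 100 * (L + 1 + 1) with hK
  -- The potential, telescoped over the phrases: `wp_phrase` uses 20 units per position, and the
  -- 21st pays for the loop test.
  refine wp_loop_of (fun κ s => ∃ E, s.b + κ = T.length ∧ MainInv T h (L + 1) E s ∧
    s.tm + K * closedSuffixes (admissible s.NM s.HT h s.dol s.b)
      (admissible s.NM s.HT h s.dol s.b) ≤ tm + 6 + K * (s.al + 21 * s.b)) ?_ ?_ ?_ T.length _ ?_
  · rintro κ s -
    simp [Tst.ok]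
  · rintro κ s ⟨E, hb, hM, ht⟩ hev
    simp only [Tst.ev, Ex.ev, St.get, hM.static.n] at hev
    refine wp_phrase (h := h) (B := L + 1) (E := E) ⟨⟨hM.static.n, hM.static.h,
      hM.static.iff, hM.static.ne, hM.static.lt, hM.static.dol_lt⟩, hM.b, hM.le, hM.greedy, hM.out,
      hM.heights, hM.inv⟩ hev hlim ?_
    intro s' ph hM' hlt hal ht'
    rw [← hK] at ht'
    simp only [St.tick, Tst.size, Ex.size] at hlt hal ht'
    have hle := hM'.le
    refine ⟨κ - (s'.b - s.b), by omega, _, by omega, hM', ?_⟩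
    have : K * (s.b + 1) ≤ K * s'.b := Nat.mul_le_mul_left _ hlt
    have : 100 ≤ K := by omega
    nlinarith
  · rintro κ s ⟨E, hb, hM, ht⟩ hev
    simp only [Tst.ev, Ex.ev, St.get, hM.static.n] at hev
    have hbn : s.b = T.length := by have := hM.le; omega
    refine ⟨E, ⟨hM.b.symm.trans hbn, hM.greedy⟩, hM.out, ?_⟩
    have hal := hM.inv.al_le
    rw [admissible_length, hbn] at hal
    -- The final pool is bounded by `5n + 3`, to which the `21n` of the potential are added.
    have h1 : K * (s.al + 21 * s.b) ≤ K * (26 * T.length + 3) :=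
      Nat.mul_le_mul_left _ (by omega)
    have h2 : L ≤ T.length * L + 1 := by
      rcases Nat.eq_zero_or_pos T.length with h0 | h0
      · have : T = [] := List.length_eq_zero_iff.1 h0
        simp [hL, this]
      · exact (Nat.le_mul_of_pos_left L h0).trans (Nat.le_succ _)
    have h3 : T.length ≤ T.length * L := Nat.le_mul_of_pos_right _ (by omega)
    simp only [St.tick, Tst.size, Ex.size, St.init] at htm ⊢
    have h4 : K * (26 * T.length + 3) = 2600 * (T.length * L) + 5200 * T.length + 300 * L + 600 := by
      rw [hK]; ring
    omega
  · have hadm : admissible NM (fun _ => 0) h (x + 1) 0 = [] := rfl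
    refine ⟨[], Nat.zero_add _, ⟨⟨rfl, rfl, hN.iff, ?_, ?_, hB⟩, rfl, Nat.zero_le _, ?_, rfl, rfl, ?_⟩, ?_⟩
    · intro i hi
      have := hN.le i hi
      dsimp only; omega
    · intro i hi
      have := hN.le i hi
      dsimp only; omega
    · intro E₁ ph E₂ he
      simp at he
    · exact SamInv.init (L + 1) rfl rfl rfl rfl rfl rfl rfl rfl
    · dsimp only [St.init]
      rw [hadm, closedSuffixes_nil]
      nlinarith

end Main

end LZHB

theorem mainTheorem7 :
    ∃ P : LZHB.Program, ∀ h : ℕ, ∃ C k : ℕ, ∀ (α : Type*) [LinearOrder α] (T : List α),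
      ∃ E : List (LZHB.Phrase α),
        LZHB.IsLZHB4 h T E ∧ LZHB.IsModifiedEncoding T E ∧ LZHB.IsBounded h E ∧
          LZHB.Computes P T h E
            (C * (T.length * (Nat.log 2 T.toFinset.card + 1) + 1))
            (C * (T.length + 1)) ((T.length + 2) ^ k) := by
  -- The constant is `15 * 10000 + 3`, from slowdown and setup. It does not depend on `h`, which
  -- enters only the exponent of the word bound, by way of `h + 1 ≤ 2 ^ h`.
  refine ⟨LZHB.mainCmd.program, fun h => ⟨150003, h + 16, fun α _ T => ?_⟩⟩
  obtain ⟨s, hs, E, hE, hout, htm⟩ :=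
    LZHB.wp_main (T := T) (lim := 8 * T.length + 8) h (by omega)
  refine ⟨E, hE, hE.isModifiedEncoding, (LZHB.GreedyPhrases.heights_bounded hE.2).2, ?_⟩
  refine LZHB.Cmd.computes ⟨s, hs, hout, htm⟩ (by omega) (by omega) ?_
  have hlog : Nat.log 2 T.toFinset.card ≤ T.length :=
    (Nat.log_le_self _ _).trans T.toFinset_card_le
  have h1 : T.length * (Nat.log 2 T.toFinset.card + 1) ≤ T.length * (T.length + 1) :=
    Nat.mul_le_mul_left _ (by omega)
  have h2 : h + 1 ≤ 2 ^ h := Nat.lt_two_pow_self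
  have h3 : 2 ^ (h + 14) ≤ (T.length + 2) ^ (h + 14) := Nat.pow_le_pow_left (by omega) _
  have h4 : (T.length + 2) ^ (h + 16) = (T.length + 2) ^ (h + 14) * (T.length + 2) ^ 2 := by
    rw [← pow_add]
  rw [pow_add] at h3
  have h5 : 16384 * (h + 1) ≤ (T.length + 2) ^ (h + 14) := by omega
  rw [h4]
  refine lt_of_lt_of_le ?_ (Nat.mul_le_mul_right _ h5)
  nlinarith [Nat.zero_le (h * T.length)]
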